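/- Let $N\in\{2,3,4\}$, let $n$ be an integer coprime to $N$, and put $\rho=e^{2\pi i n/N}$. Let $z\mapsto\sqrt z$ be any function on $\mathbb C$ with $(\sqrt z)^2=z$; a root of a product is understood as the product of the roots of the factors written. **Weights.** For $\alpha,\beta,w\in\mathbb C$ let $x=e^{w}$, $A_k=\sqrt{1-\rho^k\alpha^2}$, $B_k=\sqrt{1-\rho^k\beta^2}$, $r_k=\sqrt{1-\rho^k}$, $a_k=\alpha-\rho^k\beta x$, $b_k=\beta-\rho^k\alpha x$, $c_k=1-\rho^k\alpha\beta x$, $d_k=x-\rho^k\alpha\beta$. The vertex weights $X^{\iota_1,\iota_2}_{\kappa_2,\kappa_1}=X_{\alpha,\beta}(w)^{\iota_1,\iota_2}_{\kappa_2,\kappa_1}$ ($\iota_1,\iota_2,\kappa_1,\kappa_2\in\{1,\dots,N\}$) of the $N$-state Deguchi–Akutsu model are as follows; those not listed are $0$. $N=2$: $X^{1,1}_{1,1}=c_0$, $X^{1,2}_{1,2}=xA_0B_0$, $X^{1,2}_{2,1}=a_0$, $X^{2,1}_{1,2}=b_0$, $X^{2,1}_{2,1}=A_0B_0$, $X^{2,2}_{2,2}=d_0$.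 $N=3$: $X^{1,1}_{1,1}=c_0c_1$, $X^{1,2}_{1,2}=xA_0B_0c_1$, $X^{1,2}_{2,1}=a_0c_1$, $X^{1,3}_{1,3}=x^2A_0A_1B_0B_1$, $X^{1,3}_{2,2}=A_0B_1\frac{r_2}{r_1}xa_0$, $X^{1,3}_{3,1}=a_0a_1$, $X^{2,1}_{1,2}=b_0c_1$, $X^{2,1}_{2,1}=A_0B_0c_1$, $X^{2,2}_{1,3}=A_1B_0\frac{r_2}{r_1}xb_0$, $X^{2,2}_{2,2}=(1-\alpha^2)(1-\rho\beta^2)x-b_0(\beta x-\rho\alpha)$, $X^{2,2}_{3,1}=A_0B_1\frac{r_2}{r_1}a_0$, $X^{2,3}_{2,3}=xd_0A_1B_1$, $X^{2,3}_{3,2}=(1+\rho)a_0d_0$, $X^{3,1}_{1,3}=b_0b_1$, $X^{3,1}_{2,2}=A_1B_0\frac{r_2}{r_1}b_0$, $X^{3,1}_{3,1}=A_0A_1B_0B_1$, $X^{3,2}_{2,3}=(1+\rho)b_0d_0$, $X^{3,2}_{3,2}=A_1B_1d_0$, $X^{3,3}_{3,3}=d_0d_1$. $N=4$: $X^{1,1}_{1,1}=c_0c_1c_2$,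 $X^{1,2}_{1,2}=xA_0B_0c_1c_2$, $X^{1,2}_{2,1}=a_0c_1c_2$, $X^{1,3}_{1,3}=x^2A_0A_1B_0B_1c_2$, $X^{1,3}_{2,2}=A_0B_1\frac{r_2}{r_1}xa_0c_2$, $X^{1,3}_{3,1}=a_0a_1c_2$, $X^{1,4}_{1,4}=x^3A_0A_1A_2B_0B_1B_2$, $X^{1,4}_{2,3}=A_0A_1B_1B_2\frac{r_3}{r_1}x^2a_0$, $X^{1,4}_{3,2}=A_0B_2\frac{r_3}{r_1}xa_0a_1$, $X^{1,4}_{4,1}=a_0a_1a_2$, $X^{2,1}_{1,2}=b_0c_1c_2$, $X^{2,1}_{2,1}=A_0B_0c_1c_2$, $X^{2,2}_{1,3}=A_1B_0\frac{r_2}{r_1}xb_0c_2$, $X^{2,2}_{2,2}=\big((1-\alpha^2)(1-\rho\beta^2)x-b_0(\beta x-\rho\alpha)\big)c_2$, $X^{2,2}_{3,1}=A_0B_1\frac{r_2}{r_1}a_0c_2$, $X^{2,3}_{1,4}=A_1A_2B_0B_1\frac{r_3}{r_1}x^2b_0$, $X^{2,3}_{2,3}=xA_1B_1\big((1-\beta^2)(1-\rho^2\alpha^2)x-(1+\rho)(\alpha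 x-\rho\beta)a_0\big)$, $X^{2,3}_{3,2}=a_0\big((1-\alpha^2\beta^2)(1-\rho^3)x-\rho(\alpha x-\rho\beta)a_0\big)$, $X^{2,3}_{4,1}=A_0B_2\frac{r_3}{r_1}a_0a_1$, $X^{2,4}_{2,4}=x^2A_1A_2B_1B_2d_0$, $X^{2,4}_{3,3}=x\frac{r_2r_3}{1-\rho}A_1B_2d_0a_0$, $X^{2,4}_{4,2}=\frac{1-\rho^3}{1-\rho}d_0a_0a_1$, $X^{3,1}_{1,3}=b_0b_1c_2$, $X^{3,1}_{2,2}=A_1B_0\frac{r_2}{r_1}b_0c_2$, $X^{3,1}_{3,1}=A_0A_1B_0B_1c_2$, $X^{3,2}_{1,4}=A_2B_0\frac{r_3}{r_1}xb_0b_1$, $X^{3,2}_{2,3}=b_0\big((1-\alpha^2\beta^2)(1-\rho^3)x-\rho b_0(\beta x-\rho\alpha)\big)$, $X^{3,2}_{3,2}=A_1B_1\big((1-\alpha^2)(1-\rho^2\beta^2)x-(1+\rho)b_0(\beta x-\rho\alpha)\big)$, $X^{3,2}_{4,1}=A_0A_1B_1B_2\frac{r_3}{r_1}a_0$, $X^{3,3}_{2,4}=x\frac{r_2r_3}{1-\rho}A_2B_1d_0b_0$,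 $X^{3,3}_{3,3}=\big((1-\rho\alpha^2)(1-\rho^2\beta^2)x-(1+\rho+\rho^2)b_0(\beta x-\rho\alpha)\big)d_0$, $X^{3,3}_{4,2}=\frac{r_2r_3}{1-\rho}A_1B_2d_0a_0$, $X^{3,4}_{3,4}=xA_2B_2d_0d_1$, $X^{3,4}_{4,3}=\frac{1-\rho^3}{1-\rho}d_0d_1a_0$, $X^{4,1}_{1,4}=b_0b_1b_2$, $X^{4,1}_{2,3}=A_2B_0\frac{r_3}{r_1}b_0b_1$, $X^{4,1}_{3,2}=A_1A_2B_0B_1\frac{r_3}{r_1}b_0$, $X^{4,1}_{4,1}=A_0A_1A_2B_0B_1B_2$, $X^{4,2}_{2,4}=\frac{1-\rho^3}{1-\rho}d_0b_0b_1$, $X^{4,2}_{3,3}=\frac{r_2r_3}{1-\rho}A_2B_1d_0b_0$, $X^{4,2}_{4,2}=A_1A_2B_1B_2d_0$, $X^{4,3}_{3,4}=\frac{1-\rho^3}{1-\rho}d_0d_1b_0$, $X^{4,3}_{4,3}=A_2B_2d_0d_1$, $X^{4,4}_{4,4}=d_0d_1d_2$. **Partition function.** Let $L\ge 0$ and let $\alpha_i,\beta_i,u_i,v_i$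 ($1\le i\le L$) be complex numbers. Consider the square lattice of $L$ vertical lines, numbered from left to right and carrying $(u_i,\alpha_i)$, and $L$ horizontal lines, numbered from top to bottom and carrying $(v_j,\beta_j)$. A configuration assigns a state variable in $\{1,\dots,N\}$ to every bond, such that all boundary bonds on the left and on the top carry $1$ and all boundary bonds on the right and on the bottom carry $N$. The vertex at the crossing of the $i$-th vertical and the $j$-th horizontal line, with state variables $\iota_1$ above, $\iota_2$ to the right, $\kappa_2$ to the left and $\kappa_1$ below, has weight $X_{\alpha_i,\beta_j}(u_i-v_j)^{\iota_1,\iota_2}_{\kappa_2,\kappa_1}$. The domain wall partition function $Z^{DA}_{L\times L}$ is the sum over all configurations of the product of the weights of all $L^2$ vertices. **Claim.** $$Z^{DA}_{L\times L}=\prod_{j=1}^{L}\Big(e^{(N-1)j(u_j-v_j)}\prod_{k=1}^{N-1}\sqrt{1-\rho^{k-1}\alpha_j^2}\,\sqrt{1-\rho^{k-1}\beta_j^2}\Big)\prod_{1\le i<j\le L}\ \prod_{k=1}^{N-1}\big(1-\rho^{k-1}\alpha_i\alpha_je^{u_i-u_j}\big)\big(1-\rho^{k-1}\beta_j\beta_ie^{v_j-v_i}\big).$$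 -/

import Mathlib

/-!
Vertex weights of the `N`-state Deguchi-Akutsu models, `N = 2, 3, 4`.

Conventions.  `sq : ℂ → ℂ` is the square root in use (any function with `sq z ^ 2 = z`); the root of
a product is the product of the roots of its factors.  `x = exp (u - v)`.  The value
`W ι₁ ι₂ κ₂ κ₁` is the weight of the vertex with state variables `ι₁` above, `ι₂` to the right,
`κ₂` to the left and `κ₁` below; state variables are `1, …, N`, and weights that are not listed
vanish.
-/

/-- The six-vertex weights (`N = 2`). -/
noncomputable def weightDA2 (sq : ℂ → ℂ) (α β x : ℂ) : ℕ → ℕ → ℕ → ℕ → ℂ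
  | 1, 1, 1, 1 => 1 - α * β * x
  | 1, 2, 1, 2 => x * (sq (1 - α ^ 2) * sq (1 - β ^ 2))
  | 1, 2, 2, 1 => α - β * x
  | 2, 1, 1, 2 => β - α * x
  | 2, 1, 2, 1 => sq (1 - α ^ 2) * sq (1 - β ^ 2)
  | 2, 2, 2, 2 => x - α * β
  | _, _, _, _ => 0

/-- The nineteen-vertex weights (`N = 3`). -/
noncomputable def weightDA3 (sq : ℂ → ℂ) (ρ α β x : ℂ) : ℕ → ℕ → ℕ → ℕ → ℂ
  | 1, 1, 1, 1 => (1 - α * β * x) * (1 - α * β * ρ * x)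
  | 1, 2, 1, 2 => x * (sq (1 - α ^ 2) * sq (1 - β ^ 2)) * (1 - α * β * ρ * x)
  | 1, 2, 2, 1 => (α - β * x) * (1 - α * β * ρ * x)
  | 1, 3, 1, 3 => x ^ 2 * (sq (1 - α ^ 2) * sq (1 - α ^ 2 * ρ) *
      sq (1 - β ^ 2) * sq (1 - β ^ 2 * ρ))
  | 1, 3, 2, 2 => sq (1 - α ^ 2) * sq (1 - β ^ 2 * ρ) *
      (sq (1 - ρ ^ 2) / sq (1 - ρ)) * x * (α - β * x)
  | 1, 3, 3, 1 => (α - β * x) * (α - β * ρ * x)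
  | 2, 1, 1, 2 => (β - α * x) * (1 - α * β * ρ * x)
  | 2, 1, 2, 1 => sq (1 - α ^ 2) * sq (1 - β ^ 2) * (1 - α * β * ρ * x)
  | 2, 2, 1, 3 => sq (1 - α ^ 2 * ρ) * sq (1 - β ^ 2) *
      (sq (1 - ρ ^ 2) / sq (1 - ρ)) * x * (β - α * x)
  | 2, 2, 2, 2 => (1 - α ^ 2) * (1 - β ^ 2 * ρ) * x - (β - α * x) * (β * x - α * ρ)
  | 2, 2, 3, 1 => sq (1 - α ^ 2) * sq (1 - β ^ 2 * ρ) *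
      (sq (1 - ρ ^ 2) / sq (1 - ρ)) * (α - β * x)
  | 2, 3, 2, 3 => x * (x - α * β) * (sq (1 - α ^ 2 * ρ) * sq (1 - β ^ 2 * ρ))
  | 2, 3, 3, 2 => (1 + ρ) * (α - β * x) * (x - α * β)
  | 3, 1, 1, 3 => (β - α * x) * (β - α * ρ * x)
  | 3, 1, 2, 2 => sq (1 - β ^ 2) * sq (1 - α ^ 2 * ρ) *
      (sq (1 - ρ ^ 2) / sq (1 - ρ)) * (β - α * x)
  | 3, 1, 3, 1 => sq (1 - α ^ 2) * sq (1 - α ^ 2 * ρ) * sq (1 - β ^ 2) * sq (1 - β ^ 2 * ρ)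
  | 3, 2, 2, 3 => (1 + ρ) * (β - α * x) * (x - α * β)
  | 3, 2, 3, 2 => sq (1 - α ^ 2 * ρ) * sq (1 - β ^ 2 * ρ) * (x - α * β)
  | 3, 3, 3, 3 => (x - α * β) * (x - α * β * ρ)
  | _, _, _, _ => 0

/-- The forty-four-vertex weights (`N = 4`) with state variable `1` above, as a function of the
state variables to the right, to the left and below. -/
noncomputable def weightDA4Top1 (sq : ℂ → ℂ) (ρ α β x : ℂ) : ℕ → ℕ → ℕ → ℂ
  | 1, 1, 1 => (1 - α * β * x) * (1 - α * β * ρ * x) * (1 - α * β * ρ ^ 2 * x)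
  | 2, 1, 2 => x * (sq (1 - α ^ 2) * sq (1 - β ^ 2)) *
      (1 - α * β * ρ * x) * (1 - α * β * ρ ^ 2 * x)
  | 2, 2, 1 => (α - β * x) * (1 - α * β * ρ * x) * (1 - α * β * ρ ^ 2 * x)
  | 3, 1, 3 => x ^ 2 * (sq (1 - α ^ 2) * sq (1 - α ^ 2 * ρ) *
      sq (1 - β ^ 2) * sq (1 - β ^ 2 * ρ)) * (1 - α * β * ρ ^ 2 * x)
  | 3, 2, 2 => sq (1 - α ^ 2) * sq (1 - β ^ 2 * ρ) *
      (sq (1 - ρ ^ 2) / sq (1 - ρ)) * x * (α - β * x) * (1 - α * β * ρ ^ 2 * x)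
  | 3, 3, 1 => (α - β * x) * (α - β * ρ * x) * (1 - α * β * ρ ^ 2 * x)
  | 4, 1, 4 => x ^ 3 * (sq (1 - α ^ 2) * sq (1 - α ^ 2 * ρ) * sq (1 - α ^ 2 * ρ ^ 2)) *
      (sq (1 - β ^ 2) * sq (1 - β ^ 2 * ρ) * sq (1 - β ^ 2 * ρ ^ 2))
  | 4, 2, 3 => sq (1 - α ^ 2) * sq (1 - α ^ 2 * ρ) *
      sq (1 - β ^ 2 * ρ) * sq (1 - β ^ 2 * ρ ^ 2) *
      (sq (1 - ρ ^ 3) / sq (1 - ρ)) * x ^ 2 * (α - β * x)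
  | 4, 3, 2 => sq (1 - α ^ 2) * sq (1 - β ^ 2 * ρ ^ 2) *
      (sq (1 - ρ ^ 3) / sq (1 - ρ)) * x * (α - β * x) * (α - β * ρ * x)
  | 4, 4, 1 => (α - β * x) * (α - β * ρ * x) * (α - β * ρ ^ 2 * x)
  | _, _, _ => 0

/-- The forty-four-vertex weights (`N = 4`) with state variable `2` above, as a function of the
state variables to the right, to the left and below. -/
noncomputable def weightDA4Top2 (sq : ℂ → ℂ) (ρ α β x : ℂ) : ℕ → ℕ → ℕ → ℂ
  | 1, 1, 2 => (β - α * x) * (1 - α * β * ρ * x) * (1 - α * β * ρ ^ 2 * x)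
  | 1, 2, 1 => sq (1 - α ^ 2) * sq (1 - β ^ 2) *
      (1 - α * β * ρ * x) * (1 - α * β * ρ ^ 2 * x)
  | 2, 1, 3 => sq (1 - α ^ 2 * ρ) * sq (1 - β ^ 2) *
      (sq (1 - ρ ^ 2) / sq (1 - ρ)) * x * (β - α * x) * (1 - α * β * ρ ^ 2 * x)
  | 2, 2, 2 => ((1 - α ^ 2) * (1 - β ^ 2 * ρ) * x - (β - α * x) * (β * x - α * ρ)) *
      (1 - α * β * ρ ^ 2 * x)
  | 2, 3, 1 => sq (1 - α ^ 2) * sq (1 - β ^ 2 * ρ) *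
      (sq (1 - ρ ^ 2) / sq (1 - ρ)) * (α - β * x) * (1 - α * β * ρ ^ 2 * x)
  | 3, 1, 4 => sq (1 - α ^ 2 * ρ) * sq (1 - α ^ 2 * ρ ^ 2) *
      sq (1 - β ^ 2) * sq (1 - β ^ 2 * ρ) *
      (sq (1 - ρ ^ 3) / sq (1 - ρ)) * x ^ 2 * (β - α * x)
  | 3, 2, 3 => x * (sq (1 - α ^ 2 * ρ) * sq (1 - β ^ 2 * ρ)) *
      ((1 - β ^ 2) * (1 - α ^ 2 * ρ ^ 2) * x - (1 + ρ) * (α * x - β * ρ) * (α - β * x))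
  | 3, 3, 2 => (α - β * x) *
      ((1 - α ^ 2 * β ^ 2) * (1 - ρ ^ 3) * x - ρ * (α * x - β * ρ) * (α - β * x))
  | 3, 4, 1 => (sq (1 - ρ ^ 3) / sq (1 - ρ)) * (sq (1 - α ^ 2) * sq (1 - β ^ 2 * ρ ^ 2)) *
      (α - β * x) * (α - β * ρ * x)
  | 4, 2, 4 => x ^ 2 * (sq (1 - α ^ 2 * ρ) * sq (1 - α ^ 2 * ρ ^ 2) *
      sq (1 - β ^ 2 * ρ) * sq (1 - β ^ 2 * ρ ^ 2)) * (x - α * β)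
  | 4, 3, 3 => x * (sq (1 - ρ ^ 2) * sq (1 - ρ ^ 3) / (1 - ρ)) *
      (sq (1 - α ^ 2 * ρ) * sq (1 - β ^ 2 * ρ ^ 2)) * (x - α * β) * (α - β * x)
  | 4, 4, 2 => (1 - ρ ^ 3) / (1 - ρ) * (x - α * β) * (α - β * x) * (α - β * ρ * x)
  | _, _, _ => 0

/-- The forty-four-vertex weights (`N = 4`) with state variable `3` above, as a function of the
state variables to the right, to the left and below. -/
noncomputable def weightDA4Top3 (sq : ℂ → ℂ) (ρ α β x : ℂ) : ℕ → ℕ → ℕ → ℂ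
  | 1, 1, 3 => (β - α * x) * (β - α * ρ * x) * (1 - α * β * ρ ^ 2 * x)
  | 1, 2, 2 => sq (1 - β ^ 2) * sq (1 - α ^ 2 * ρ) *
      (sq (1 - ρ ^ 2) / sq (1 - ρ)) * (β - α * x) * (1 - α * β * ρ ^ 2 * x)
  | 1, 3, 1 => sq (1 - α ^ 2) * sq (1 - α ^ 2 * ρ) * sq (1 - β ^ 2) * sq (1 - β ^ 2 * ρ) *
      (1 - α * β * ρ ^ 2 * x)
  | 2, 1, 4 => sq (1 - α ^ 2 * ρ ^ 2) * sq (1 - β ^ 2) *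
      (sq (1 - ρ ^ 3) / sq (1 - ρ)) * x * (β - α * x) * (β - α * ρ * x)
  | 2, 2, 3 => (β - α * x) *
      ((1 - α ^ 2 * β ^ 2) * (1 - ρ ^ 3) * x - ρ * (β - α * x) * (β * x - α * ρ))
  | 2, 3, 2 => sq (1 - α ^ 2 * ρ) * sq (1 - β ^ 2 * ρ) *
      ((1 - α ^ 2) * (1 - β ^ 2 * ρ ^ 2) * x - (1 + ρ) * (β - α * x) * (β * x - α * ρ))
  | 2, 4, 1 => sq (1 - α ^ 2) * sq (1 - α ^ 2 * ρ) *
      sq (1 - β ^ 2 * ρ) * sq (1 - β ^ 2 * ρ ^ 2) *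
      (sq (1 - ρ ^ 3) / sq (1 - ρ)) * (α - β * x)
  | 3, 2, 4 => x * (sq (1 - ρ ^ 2) * sq (1 - ρ ^ 3) / (1 - ρ)) *
      (sq (1 - α ^ 2 * ρ ^ 2) * sq (1 - β ^ 2 * ρ)) * (x - α * β) * (β - α * x)
  | 3, 3, 3 => ((1 - α ^ 2 * ρ) * (1 - β ^ 2 * ρ ^ 2) * x -
      (1 + ρ + ρ ^ 2) * (β - α * x) * (β * x - α * ρ)) * (x - α * β)
  | 3, 4, 2 => sq (1 - α ^ 2 * ρ) * sq (1 - β ^ 2 * ρ ^ 2) *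
      (sq (1 - ρ ^ 2) * sq (1 - ρ ^ 3) / (1 - ρ)) * (x - α * β) * (α - β * x)
  | 4, 3, 4 => x * sq (1 - α ^ 2 * ρ ^ 2) * sq (1 - β ^ 2 * ρ ^ 2) *
      (x - α * β) * (x - α * β * ρ)
  | 4, 4, 3 => (1 - ρ ^ 3) / (1 - ρ) * (x - α * β) * (x - α * β * ρ) * (α - β * x)
  | _, _, _ => 0

/-- The forty-four-vertex weights (`N = 4`) with state variable `4` above, as a function of the
state variables to the right, to the left and below. -/
noncomputable def weightDA4Top4 (sq : ℂ → ℂ) (ρ α β x : ℂ) : ℕ → ℕ → ℕ → ℂ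
  | 1, 1, 4 => (β - α * x) * (β - α * ρ * x) * (β - α * ρ ^ 2 * x)
  | 1, 2, 3 => sq (1 - α ^ 2 * ρ ^ 2) * sq (1 - β ^ 2) *
      (sq (1 - ρ ^ 3) / sq (1 - ρ)) * (β - α * x) * (β - α * ρ * x)
  | 1, 3, 2 => sq (1 - α ^ 2 * ρ) * sq (1 - α ^ 2 * ρ ^ 2) *
      sq (1 - β ^ 2) * sq (1 - β ^ 2 * ρ) *
      (sq (1 - ρ ^ 3) / sq (1 - ρ)) * (β - α * x)
  | 1, 4, 1 => (sq (1 - α ^ 2) * sq (1 - α ^ 2 * ρ) * sq (1 - α ^ 2 * ρ ^ 2)) *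
      (sq (1 - β ^ 2) * sq (1 - β ^ 2 * ρ) * sq (1 - β ^ 2 * ρ ^ 2))
  | 2, 2, 4 => (1 - ρ ^ 3) / (1 - ρ) * (x - α * β) * (β - α * x) * (β - α * ρ * x)
  | 2, 3, 3 => sq (1 - α ^ 2 * ρ ^ 2) * sq (1 - β ^ 2 * ρ) *
      (sq (1 - ρ ^ 2) * sq (1 - ρ ^ 3) / (1 - ρ)) * (x - α * β) * (β - α * x)
  | 2, 4, 2 => sq (1 - α ^ 2 * ρ) * sq (1 - α ^ 2 * ρ ^ 2) *
      sq (1 - β ^ 2 * ρ) * sq (1 - β ^ 2 * ρ ^ 2) * (x - α * β)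
  | 3, 3, 4 => (1 - ρ ^ 3) / (1 - ρ) * (x - α * β) * (x - α * β * ρ) * (β - α * x)
  | 3, 4, 3 => sq (1 - α ^ 2 * ρ ^ 2) * sq (1 - β ^ 2 * ρ ^ 2) *
      (x - α * β) * (x - α * β * ρ)
  | 4, 4, 4 => (x - α * β) * (x - α * β * ρ) * (x - α * β * ρ ^ 2)
  | _, _, _ => 0

/-- The forty-four-vertex weights (`N = 4`). -/
noncomputable def weightDA4 (sq : ℂ → ℂ) (ρ α β x : ℂ) (ι₁ ι₂ κ₂ κ₁ : ℕ) : ℂ :=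
  match ι₁ with
  | 1 => weightDA4Top1 sq ρ α β x ι₂ κ₂ κ₁
  | 2 => weightDA4Top2 sq ρ α β x ι₂ κ₂ κ₁
  | 3 => weightDA4Top3 sq ρ α β x ι₂ κ₂ κ₁
  | 4 => weightDA4Top4 sq ρ α β x ι₂ κ₂ κ₁
  | _ => 0

/-- The weight `X_{α,β}(w)^{ι₁,ι₂}_{κ₂,κ₁}` of the `N`-state model with root of unity `ρ`, where
`w = u - v` is the difference of the vertical and the horizontal rapidity.  Only `N = 2, 3, 4`
are meaningful. -/
noncomputable def weightDA (N : ℕ) (sq : ℂ → ℂ) (ρ α β w : ℂ) (ι₁ ι₂ κ₂ κ₁ : ℕ) : ℂ :=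
  match N with
  | 2 => weightDA2 sq α β (Complex.exp w) ι₁ ι₂ κ₂ κ₁
  | 3 => weightDA3 sq ρ α β (Complex.exp w) ι₁ ι₂ κ₂ κ₁
  | 4 => weightDA4 sq ρ α β (Complex.exp w) ι₁ ι₂ κ₂ κ₁
  | _ => 0

/-- An assignment of a state variable to every bond of the `L × L` lattice: `c.1 i k` is the state
variable on the `k`-th bond, counted from the top, of the `i`-th vertical line, and `c.2 j k` the one
on the `k`-th bond, counted from the left, of the `j`-th horizontal line.  The element `s` of
`Fin N` stands for the state variable `s + 1`.  Vertical lines are numbered from left to right,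
horizontal lines from top to bottom. -/
abbrev BondConfig (N L : ℕ) : Type :=
  (Fin L → Fin (L + 1) → Fin N) × (Fin L → Fin (L + 1) → Fin N)

/-- Domain wall boundary conditions: the state variable is `1` on the top and left boundary bonds
and `N` on the bottom and right boundary bonds. -/
def IsDomainWall {N L : ℕ} (c : BondConfig N L) : Prop :=
  (∀ i, (c.1 i 0 : ℕ) + 1 = 1) ∧ (∀ i, (c.1 i (Fin.last L) : ℕ) + 1 = N) ∧
  (∀ j, (c.2 j 0 : ℕ) + 1 = 1) ∧ (∀ j, (c.2 j (Fin.last L) : ℕ) + 1 = N)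

/-- The weight of a configuration: the product of the weights of all vertices.  The `i`-th
vertical line carries `u i`, `α i`, and the `j`-th horizontal line carries `v j`, `β j`. -/
noncomputable def configWeight {N L : ℕ} (sq : ℂ → ℂ) (ρ : ℂ) (α β u v : Fin L → ℂ)
    (c : BondConfig N L) : ℂ :=
  ∏ i, ∏ j, weightDA N sq ρ (α i) (β j) (u i - v j)
    (c.1 i j.castSucc + 1) (c.2 j i.succ + 1) (c.2 j i.castSucc + 1) (c.1 i j.succ + 1)

open Classical in
/-- The domain wall partition function on the `L × L` lattice. -/
noncomputable def partitionDA (N L : ℕ) (sq : ℂ → ℂ) (ρ : ℂ) (α β u v : Fin L → ℂ) : ℂ :=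
  ∑ c : BondConfig N L with IsDomainWall c, configWeight sq ρ α β u v c

/-! Write M = N - 1 and count states from 0. A gauge transformation turns the weights into
polynomials without square roots. In the symmetric gauge, where both lines are raised with
coefficient 1, the weights intertwine a coproduct with its opposite for two raising operators, two
lowering operators and a charge, in the manner of an R-matrix of quantum affine sl2 at a root of
unity. These relations are finite checks for N = 2, 3, 4.

The Yang-Baxter equation follows (`vertexMat_yangBaxter`). Its defect on three sites inherits the
intertwining relations. For generic parameters these propagate vanishing from the entries whose
outer two sites are in the lowest state to all entries, and the remaining entries are the short
identities of `symWeight_corner_exchange`. Consequently two vertical lines with lowest state on top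
and highest state at the bottom commute up to explicit scalars (`columnMat_exchange`).

Now regard the domain wall sum as a polynomial in the exponential t of the first vertical rapidity.
Its degree is at most M times the number of rows, and t ^ M divides it. Moving the first column past
all the others gives G q = F q' with F and G coprime products of linear factors, so F divides q. The
degree bound then forces q = c t ^ M F (`columnMat_mul_wallMat_eq`). The constant c is read off at
the value of t for which the upper left vertex freezes. There the whole first row and first column
are forced and the sum reduces to the one of size smaller by one (`wallSum_corner`), so induction on
the size applies (`wallSum_eq_of_generic`).

Genericity is removed by perturbing the parameters along a curve and using continuity. The symmetric
gauge produces an extra product of factors 1 - ρ ^ k β ^ 2. This is cancelled by the same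
perturbation argument (`wallOf_mixedWeight`), after which a gauge transformation that needs no
division restores the square roots (`partitionDA_eq`). -/

section

/-! ### Polynomial weights and their gauges. -/

/-- Reduced weights, `N = 2`. -/
def coreWeight2 {R : Type*} [CommRing R] (α β x : R) : ℕ → ℕ → ℕ → ℕ → R
  | 0, 0, 0, 0 => 1 - α * β * x
  | 0, 1, 0, 1 => x
  | 0, 1, 1, 0 => α - β * x
  | 1, 0, 0, 1 => β - α * x
  | 1, 0, 1, 0 => 1
  | 1, 1, 1, 1 => x - α * β
  | _, _, _, _ => 0

/-- Reduced weights, `N = 3`. -/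
def coreWeight3 {R : Type*} [CommRing R] (ρ α β x : R) : ℕ → ℕ → ℕ → ℕ → R
  | 0, 0, 0, 0 => (1 - α * β * x) * (1 - ρ * α * β * x)
  | 0, 1, 0, 1 => x * (1 - ρ * α * β * x)
  | 0, 1, 1, 0 => (α - β * x) * (1 - ρ * α * β * x)
  | 0, 2, 0, 2 => x ^ 2
  | 0, 2, 1, 1 => (1 + ρ) * x * (α - β * x)
  | 0, 2, 2, 0 => (α - β * x) * (α - ρ * β * x)
  | 1, 0, 0, 1 => (β - α * x) * (1 - ρ * α * β * x)
  | 1, 0, 1, 0 => 1 - ρ * α * β * x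
  | 1, 1, 0, 2 => x * (β - α * x)
  | 1, 1, 1, 1 => (1 - α ^ 2) * (1 - ρ * β ^ 2) * x - (β - α * x) * (β * x - ρ * α)
  | 1, 1, 2, 0 => α - β * x
  | 1, 2, 1, 2 => x * (x - α * β)
  | 1, 2, 2, 1 => (1 + ρ) * (α - β * x) * (x - α * β)
  | 2, 0, 0, 2 => (β - α * x) * (β - ρ * α * x)
  | 2, 0, 1, 1 => (1 + ρ) * (β - α * x)
  | 2, 0, 2, 0 => 1
  | 2, 1, 1, 2 => (1 + ρ) * (β - α * x) * (x - α * β)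
  | 2, 1, 2, 1 => x - α * β
  | 2, 2, 2, 2 => (x - α * β) * (x - ρ * α * β)
  | _, _, _, _ => 0

/-- Reduced weights, `N = 4`, lowest state on top. -/
def coreWeight4Top0 {R : Type*} [CommRing R] (ρ α β x : R) : ℕ → ℕ → ℕ → R
  | 0, 0, 0 => (1 - α * β * x) * (1 - ρ * α * β * x) * (1 - ρ ^ 2 * α * β * x)
  | 1, 0, 1 => x * (1 - ρ * α * β * x) * (1 - ρ ^ 2 * α * β * x)
  | 1, 1, 0 => (α - β * x) * (1 - ρ * α * β * x) * (1 - ρ ^ 2 * α * β * x)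
  | 2, 0, 2 => x ^ 2 * (1 - ρ ^ 2 * α * β * x)
  | 2, 1, 1 => (1 + ρ) * x * (α - β * x) * (1 - ρ ^ 2 * α * β * x)
  | 2, 2, 0 => (α - β * x) * (α - ρ * β * x) * (1 - ρ ^ 2 * α * β * x)
  | 3, 0, 3 => x ^ 3
  | 3, 1, 2 => (1 + ρ + ρ ^ 2) * x ^ 2 * (α - β * x)
  | 3, 2, 1 => (1 + ρ + ρ ^ 2) * x * (α - β * x) * (α - ρ * β * x)
  | 3, 3, 0 => (α - β * x) * (α - ρ * β * x) * (α - ρ ^ 2 * β * x)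
  | _, _, _ => 0

/-- Reduced weights, `N = 4`, state `1` on top. -/
def coreWeight4Top1 {R : Type*} [CommRing R] (ρ α β x : R) : ℕ → ℕ → ℕ → R
  | 0, 0, 1 => (β - α * x) * (1 - ρ * α * β * x) * (1 - ρ ^ 2 * α * β * x)
  | 0, 1, 0 => (1 - ρ * α * β * x) * (1 - ρ ^ 2 * α * β * x)
  | 1, 0, 2 => x * (β - α * x) * (1 - ρ ^ 2 * α * β * x)
  | 1, 1, 1 => ((1 - α ^ 2) * (1 - ρ * β ^ 2) * x - (β - α * x) * (β * x - ρ * α)) *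
      (1 - ρ ^ 2 * α * β * x)
  | 1, 2, 0 => (α - β * x) * (1 - ρ ^ 2 * α * β * x)
  | 2, 0, 3 => x ^ 2 * (β - α * x)
  | 2, 1, 2 => x * ((1 - β ^ 2) * (1 - ρ ^ 2 * α ^ 2) * x -
      (1 + ρ) * (α * x - ρ * β) * (α - β * x))
  | 2, 2, 1 => (α - β * x) *
      ((1 - α ^ 2 * β ^ 2) * (1 - ρ ^ 3) * x - ρ * (α * x - ρ * β) * (α - β * x))
  | 2, 3, 0 => (α - β * x) * (α - ρ * β * x)
  | 3, 1, 3 => x ^ 2 * (x - α * β)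
  | 3, 2, 2 => (1 + ρ + ρ ^ 2) * x * (x - α * β) * (α - β * x)
  | 3, 3, 1 => (1 + ρ + ρ ^ 2) * (x - α * β) * (α - β * x) * (α - ρ * β * x)
  | _, _, _ => 0

/-- Reduced weights, `N = 4`, state `2` on top. -/
def coreWeight4Top2 {R : Type*} [CommRing R] (ρ α β x : R) : ℕ → ℕ → ℕ → R
  | 0, 0, 2 => (β - α * x) * (β - ρ * α * x) * (1 - ρ ^ 2 * α * β * x)
  | 0, 1, 1 => (1 + ρ) * (β - α * x) * (1 - ρ ^ 2 * α * β * x)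
  | 0, 2, 0 => 1 - ρ ^ 2 * α * β * x
  | 1, 0, 3 => x * (β - α * x) * (β - ρ * α * x)
  | 1, 1, 2 => (β - α * x) *
      ((1 - α ^ 2 * β ^ 2) * (1 - ρ ^ 3) * x - ρ * (β - α * x) * (β * x - ρ * α))
  | 1, 2, 1 => (1 - α ^ 2) * (1 - ρ ^ 2 * β ^ 2) * x -
      (1 + ρ) * (β - α * x) * (β * x - ρ * α)
  | 1, 3, 0 => α - β * x
  | 2, 1, 3 => (1 + ρ) * x * (x - α * β) * (β - α * x)
  | 2, 2, 2 => ((1 - ρ * α ^ 2) * (1 - ρ ^ 2 * β ^ 2) * x -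
      (1 + ρ + ρ ^ 2) * (β - α * x) * (β * x - ρ * α)) * (x - α * β)
  | 2, 3, 1 => (1 + ρ) * (x - α * β) * (α - β * x)
  | 3, 2, 3 => x * (x - α * β) * (x - ρ * α * β)
  | 3, 3, 2 => (1 + ρ + ρ ^ 2) * (x - α * β) * (x - ρ * α * β) * (α - β * x)
  | _, _, _ => 0

/-- Reduced weights, `N = 4`, highest state on top. -/
def coreWeight4Top3 {R : Type*} [CommRing R] (ρ α β x : R) : ℕ → ℕ → ℕ → R
  | 0, 0, 3 => (β - α * x) * (β - ρ * α * x) * (β - ρ ^ 2 * α * x)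
  | 0, 1, 2 => (1 + ρ + ρ ^ 2) * (β - α * x) * (β - ρ * α * x)
  | 0, 2, 1 => (1 + ρ + ρ ^ 2) * (β - α * x)
  | 0, 3, 0 => 1
  | 1, 1, 3 => (1 + ρ + ρ ^ 2) * (x - α * β) * (β - α * x) * (β - ρ * α * x)
  | 1, 2, 2 => (1 + ρ + ρ ^ 2) * (x - α * β) * (β - α * x)
  | 1, 3, 1 => x - α * β
  | 2, 2, 3 => (1 + ρ + ρ ^ 2) * (x - α * β) * (x - ρ * α * β) * (β - α * x)
  | 2, 3, 2 => (x - α * β) * (x - ρ * α * β)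
  | 3, 3, 3 => (x - α * β) * (x - ρ * α * β) * (x - ρ ^ 2 * α * β)
  | _, _, _ => 0

/-- Reduced weights, `N = 4`. -/
def coreWeight4 {R : Type*} [CommRing R] (ρ α β x : R) (t r l b : ℕ) : R :=
  match t with
  | 0 => coreWeight4Top0 ρ α β x r l b
  | 1 => coreWeight4Top1 ρ α β x r l b
  | 2 => coreWeight4Top2 ρ α β x r l b
  | 3 => coreWeight4Top3 ρ α β x r l b
  | _ => 0

/-- `(ρ^m a², ρ)`-shifted factorial. -/
def raiseFactor {R : Type*} [CommRing R] (ρ a : R) (m n : ℕ) : R :=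
  ∏ j ∈ Finset.range (n - m), (1 - ρ ^ (m + j) * a ^ 2)

/-- The weights with the square roots removed by a gauge transformation, up to the factors
`raiseFactor`; states are counted from `0`, in the order top, right, left, bottom. -/
def coreWeight {R : Type*} [CommRing R] (N : ℕ) (ρ α β x : R) (t r l b : ℕ) : R :=
  match N with
  | 2 => coreWeight2 α β x t r l b
  | 3 => coreWeight3 ρ α β x t r l b
  | 4 => coreWeight4 ρ α β x t r l b
  | _ => 0

/-- The weight in the gauge where both lines are raised with unit coefficient. -/
def symWeight {R : Type*} [CommRing R] (N : ℕ) (ρ α β x : R) (t r l b : ℕ) : R :=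
  coreWeight N ρ α β x t r l b * raiseFactor ρ α b t * raiseFactor ρ β l r

/-- The `ρ`-integer `1 + ρ + ⋯ + ρ ^ (k - 1)`. -/
def qInt {R : Type*} [CommRing R] (ρ : R) (k : ℕ) : R := ∑ i ∈ Finset.range k, ρ ^ i

/-- Coefficient of the lowering operator on the `k`-th state of a line with parameter `a`. -/
def lowerCoeff {R : Type*} [CommRing R] (ρ a : R) (k : ℕ) : R :=
  qInt ρ k * (1 - ρ ^ (k - 1) * a ^ 2)
end

/-! ### Finite checks: intertwining relations and the seed of the Yang-Baxter equation. -/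

section
set_option linter.unusedSimpArgs false

/-- This is one matrix entry of an intertwining relation: the coproduct of a raising operator acts
on the incoming pair (top, right) and its opposite on the outgoing pair (left, bottom). The suffix
`one` marks the relation without spectral parameter, `zero` the one in which x appears. When t + 1
or r + 1 reaches N the weight falls into the default case 0, which is the correct boundary value. -/
theorem symWeight2_raise_one {R : Type*} [CommRing R] (ρ α β x : R) (h : ρ = -1) (t r l b : ℕ)
    (ht : t < 2) (hr : r < 2) (hl : l < 2) (hb : b < 2) (hice : t + r + 1 = l + b) :
    symWeight 2 ρ α β x (t + 1) r l b + α * ρ ^ t * symWeight 2 ρ α β x t (r + 1) l b =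
      (if l = 0 then 0 else symWeight 2 ρ α β x t r (l - 1) b) +
        β * ρ ^ l * (if b = 0 then 0 else symWeight 2 ρ α β x t r l (b - 1)) := by
  interval_cases t <;> interval_cases r <;> interval_cases l <;> first | omega |
    (interval_cases b <;> first | omega |
      (simp only [symWeight, coreWeight, coreWeight2, raiseFactor, lowerCoeff, qInt,
        Finset.sum_range_succ, Finset.sum_range_zero,
        Finset.prod_range_succ, Finset.prod_range_zero, Nat.reduceSub, Nat.reduceAdd, h]; grind))

theorem symWeight2_raise_zero {R : Type*} [CommRing R] (ρ α β x : R) (h : ρ = -1) (t r l b : ℕ)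
    (ht : t < 2) (hr : r < 2) (hl : l < 2) (hb : b < 2) (hice : t + r + 1 = l + b) :
    β * x * ρ ^ r * symWeight 2 ρ α β x (t + 1) r l b + symWeight 2 ρ α β x t (r + 1) l b =
      α * ρ ^ b * (if l = 0 then 0 else symWeight 2 ρ α β x t r (l - 1) b) +
        x * (if b = 0 then 0 else symWeight 2 ρ α β x t r l (b - 1)) := by
  interval_cases t <;> interval_cases r <;> interval_cases l <;> first | omega |
    (interval_cases b <;> first | omega |
      (simp only [symWeight, coreWeight, coreWeight2, raiseFactor, lowerCoeff, qInt,
        Finset.sum_range_succ, Finset.sum_range_zero,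
        Finset.prod_range_succ, Finset.prod_range_zero, Nat.reduceSub, Nat.reduceAdd, h]; grind))

/-- The lowering operator carries all the coefficients in this gauge. The truncated differences t -
1 and r - 1 are harmless at 0, because `lowerCoeff` vanishes there. -/
theorem symWeight2_lower_one {R : Type*} [CommRing R] (ρ α β x : R) (h : ρ = -1) (t r l b : ℕ)
    (ht : t < 2) (hr : r < 2) (hl : l < 2) (hb : b < 2) (hice : t + r = l + b + 1) :
    lowerCoeff ρ α t * symWeight 2 ρ α β x (t - 1) r l b +
        α * ρ ^ t * (lowerCoeff ρ β r * symWeight 2 ρ α β x t (r - 1) l b) =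
      lowerCoeff ρ β (l + 1) * symWeight 2 ρ α β x t r (l + 1) b +
        β * ρ ^ l * (lowerCoeff ρ α (b + 1) * symWeight 2 ρ α β x t r l (b + 1)) := by
  interval_cases t <;> interval_cases r <;> interval_cases l <;> first | omega |
    (interval_cases b <;> first | omega |
      (simp only [symWeight, coreWeight, coreWeight2, raiseFactor, lowerCoeff, qInt,
        Finset.sum_range_succ, Finset.sum_range_zero,
        Finset.prod_range_succ, Finset.prod_range_zero, Nat.reduceSub, Nat.reduceAdd, h]; grind))

theorem symWeight2_lower_zero {R : Type*} [CommRing R] (ρ α β x : R) (h : ρ = -1) (t r l b : ℕ)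
    (ht : t < 2) (hr : r < 2) (hl : l < 2) (hb : b < 2) (hice : t + r = l + b + 1) :
    β * ρ ^ r * (lowerCoeff ρ α t * symWeight 2 ρ α β x (t - 1) r l b) +
        x * (lowerCoeff ρ β r * symWeight 2 ρ α β x t (r - 1) l b) =
      α * x * ρ ^ b * (lowerCoeff ρ β (l + 1) * symWeight 2 ρ α β x t r (l + 1) b) +
        lowerCoeff ρ α (b + 1) * symWeight 2 ρ α β x t r l (b + 1) := by
  interval_cases t <;> interval_cases r <;> interval_cases l <;> first | omega |
    (interval_cases b <;> first | omega |
      (simp only [symWeight, coreWeight, coreWeight2, raiseFactor, lowerCoeff, qInt,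
        Finset.sum_range_succ, Finset.sum_range_zero,
        Finset.prod_range_succ, Finset.prod_range_zero, Nat.reduceSub, Nat.reduceAdd, h]; grind))

/-- These are the components of the Yang-Baxter equation with lowest state on the first and third
lines at both ends and state b on the second. The ice rule leaves a single summation index. All
other components are deduced from these. -/
theorem symWeight2_corner_exchange {R : Type*} [CommRing R] (ρ α₁ α₂ β x y : R) (h : ρ = -1) (b : ℕ)
    (hb : b < 2) :
    ∑ k ∈ Finset.range (b + 1), symWeight 2 ρ α₁ α₂ x 0 b (b - k) k *
        symWeight 2 ρ α₁ β (x * y) k 0 k 0 * symWeight 2 ρ α₂ β y (b - k) k 0 b =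
      ∑ k ∈ Finset.range (b + 1), symWeight 2 ρ α₂ β y b 0 k (b - k) *
        symWeight 2 ρ α₁ β (x * y) 0 k 0 k * symWeight 2 ρ α₁ α₂ x k (b - k) b 0 := by
  interval_cases b <;>
    (simp only [symWeight, coreWeight, coreWeight2, raiseFactor, Finset.sum_range_succ,
      Finset.sum_range_zero,
        Finset.prod_range_succ, Finset.prod_range_zero, Nat.reduceSub, Nat.reduceAdd, h]; grind)

theorem symWeight3_raise_one {R : Type*} [CommRing R] (ρ α β x : R) (h : ρ ^ 2 = -1 - ρ) (t r l b :
    ℕ)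
    (ht : t < 3) (hr : r < 3) (hl : l < 3) (hb : b < 3) (hice : t + r + 1 = l + b) :
    symWeight 3 ρ α β x (t + 1) r l b + α * ρ ^ t * symWeight 3 ρ α β x t (r + 1) l b =
      (if l = 0 then 0 else symWeight 3 ρ α β x t r (l - 1) b) +
        β * ρ ^ l * (if b = 0 then 0 else symWeight 3 ρ α β x t r l (b - 1)) := by
  have h3 : ρ ^ 3 = 1 := by linear_combination (ρ - 1) * h
  interval_cases t <;> interval_cases r <;> interval_cases l <;> first | omega |
    (interval_cases b <;> first | omega |
      (simp only [symWeight, coreWeight, coreWeight3, raiseFactor, lowerCoeff, qInt,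
        Finset.sum_range_succ, Finset.sum_range_zero,
        Finset.prod_range_succ, Finset.prod_range_zero, Nat.reduceSub, Nat.reduceAdd, h,
          h3]; grind))

theorem symWeight3_raise_zero {R : Type*} [CommRing R] (ρ α β x : R) (h : ρ ^ 2 = -1 - ρ) (t r l b
    : ℕ)
    (ht : t < 3) (hr : r < 3) (hl : l < 3) (hb : b < 3) (hice : t + r + 1 = l + b) :
    β * x * ρ ^ r * symWeight 3 ρ α β x (t + 1) r l b + symWeight 3 ρ α β x t (r + 1) l b =
      α * ρ ^ b * (if l = 0 then 0 else symWeight 3 ρ α β x t r (l - 1) b) +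
        x * (if b = 0 then 0 else symWeight 3 ρ α β x t r l (b - 1)) := by
  have h3 : ρ ^ 3 = 1 := by linear_combination (ρ - 1) * h
  interval_cases t <;> interval_cases r <;> interval_cases l <;> first | omega |
    (interval_cases b <;> first | omega |
      (simp only [symWeight, coreWeight, coreWeight3, raiseFactor, lowerCoeff, qInt,
        Finset.sum_range_succ, Finset.sum_range_zero,
        Finset.prod_range_succ, Finset.prod_range_zero, Nat.reduceSub, Nat.reduceAdd, h,
          h3]; grind))

theorem symWeight3_lower_one {R : Type*} [CommRing R] (ρ α β x : R) (h : ρ ^ 2 = -1 - ρ) (t r l b :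
    ℕ)
    (ht : t < 3) (hr : r < 3) (hl : l < 3) (hb : b < 3) (hice : t + r = l + b + 1) :
    lowerCoeff ρ α t * symWeight 3 ρ α β x (t - 1) r l b +
        α * ρ ^ t * (lowerCoeff ρ β r * symWeight 3 ρ α β x t (r - 1) l b) =
      lowerCoeff ρ β (l + 1) * symWeight 3 ρ α β x t r (l + 1) b +
        β * ρ ^ l * (lowerCoeff ρ α (b + 1) * symWeight 3 ρ α β x t r l (b + 1)) := by
  have h3 : ρ ^ 3 = 1 := by linear_combination (ρ - 1) * h
  interval_cases t <;> interval_cases r <;> interval_cases l <;> first | omega |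
    (interval_cases b <;> first | omega |
      (simp only [symWeight, coreWeight, coreWeight3, raiseFactor, lowerCoeff, qInt,
        Finset.sum_range_succ, Finset.sum_range_zero,
        Finset.prod_range_succ, Finset.prod_range_zero, Nat.reduceSub, Nat.reduceAdd, h,
          h3]; grind))

theorem symWeight3_lower_zero {R : Type*} [CommRing R] (ρ α β x : R) (h : ρ ^ 2 = -1 - ρ) (t r l b
    : ℕ)
    (ht : t < 3) (hr : r < 3) (hl : l < 3) (hb : b < 3) (hice : t + r = l + b + 1) :
    β * ρ ^ r * (lowerCoeff ρ α t * symWeight 3 ρ α β x (t - 1) r l b) +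
        x * (lowerCoeff ρ β r * symWeight 3 ρ α β x t (r - 1) l b) =
      α * x * ρ ^ b * (lowerCoeff ρ β (l + 1) * symWeight 3 ρ α β x t r (l + 1) b) +
        lowerCoeff ρ α (b + 1) * symWeight 3 ρ α β x t r l (b + 1) := by
  have h3 : ρ ^ 3 = 1 := by linear_combination (ρ - 1) * h
  interval_cases t <;> interval_cases r <;> interval_cases l <;> first | omega |
    (interval_cases b <;> first | omega |
      (simp only [symWeight, coreWeight, coreWeight3, raiseFactor, lowerCoeff, qInt,
        Finset.sum_range_succ, Finset.sum_range_zero,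
        Finset.prod_range_succ, Finset.prod_range_zero, Nat.reduceSub, Nat.reduceAdd, h,
          h3]; grind))

theorem symWeight3_corner_exchange {R : Type*} [CommRing R] (ρ α₁ α₂ β x y : R) (h : ρ ^ 2 = -1 -
    ρ) (b : ℕ)
    (hb : b < 3) :
    ∑ k ∈ Finset.range (b + 1), symWeight 3 ρ α₁ α₂ x 0 b (b - k) k *
        symWeight 3 ρ α₁ β (x * y) k 0 k 0 * symWeight 3 ρ α₂ β y (b - k) k 0 b =
      ∑ k ∈ Finset.range (b + 1), symWeight 3 ρ α₂ β y b 0 k (b - k) *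
        symWeight 3 ρ α₁ β (x * y) 0 k 0 k * symWeight 3 ρ α₁ α₂ x k (b - k) b 0 := by
  have h3 : ρ ^ 3 = 1 := by linear_combination (ρ - 1) * h
  interval_cases b <;>
    (simp only [symWeight, coreWeight, coreWeight3, raiseFactor, Finset.sum_range_succ,
      Finset.sum_range_zero,
        Finset.prod_range_succ, Finset.prod_range_zero, Nat.reduceSub, Nat.reduceAdd, h, h3]; grind)

theorem symWeight4_raise_one {R : Type*} [CommRing R] (ρ α β x : R) (h : ρ ^ 2 = -1) (t r l b : ℕ)
    (ht : t < 4) (hr : r < 4) (hl : l < 4) (hb : b < 4) (hice : t + r + 1 = l + b) :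
    symWeight 4 ρ α β x (t + 1) r l b + α * ρ ^ t * symWeight 4 ρ α β x t (r + 1) l b =
      (if l = 0 then 0 else symWeight 4 ρ α β x t r (l - 1) b) +
        β * ρ ^ l * (if b = 0 then 0 else symWeight 4 ρ α β x t r l (b - 1)) := by
  have h3 : ρ ^ 3 = -ρ := by linear_combination ρ * h
  interval_cases t <;> interval_cases r <;> interval_cases l <;> first | omega |
    (interval_cases b <;> first | omega |
      (simp only [symWeight, coreWeight, coreWeight4, coreWeight4Top0, coreWeight4Top1,
        coreWeight4Top2,
        coreWeight4Top3, raiseFactor, lowerCoeff, qInt, Finset.sum_range_succ,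
          Finset.sum_range_zero,
        Finset.prod_range_succ, Finset.prod_range_zero, Nat.reduceSub, Nat.reduceAdd, h,
          h3]; grind))

theorem symWeight4_raise_zero {R : Type*} [CommRing R] (ρ α β x : R) (h : ρ ^ 2 = -1) (t r l b : ℕ)
    (ht : t < 4) (hr : r < 4) (hl : l < 4) (hb : b < 4) (hice : t + r + 1 = l + b) :
    β * x * ρ ^ r * symWeight 4 ρ α β x (t + 1) r l b + symWeight 4 ρ α β x t (r + 1) l b =
      α * ρ ^ b * (if l = 0 then 0 else symWeight 4 ρ α β x t r (l - 1) b) +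
        x * (if b = 0 then 0 else symWeight 4 ρ α β x t r l (b - 1)) := by
  have h3 : ρ ^ 3 = -ρ := by linear_combination ρ * h
  interval_cases t <;> interval_cases r <;> interval_cases l <;> first | omega |
    (interval_cases b <;> first | omega |
      (simp only [symWeight, coreWeight, coreWeight4, coreWeight4Top0, coreWeight4Top1,
        coreWeight4Top2,
        coreWeight4Top3, raiseFactor, lowerCoeff, qInt, Finset.sum_range_succ,
          Finset.sum_range_zero,
        Finset.prod_range_succ, Finset.prod_range_zero, Nat.reduceSub, Nat.reduceAdd, h,
          h3]; grind))

theorem symWeight4_lower_one {R : Type*} [CommRing R] (ρ α β x : R) (h : ρ ^ 2 = -1) (t r l b : ℕ)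
    (ht : t < 4) (hr : r < 4) (hl : l < 4) (hb : b < 4) (hice : t + r = l + b + 1) :
    lowerCoeff ρ α t * symWeight 4 ρ α β x (t - 1) r l b +
        α * ρ ^ t * (lowerCoeff ρ β r * symWeight 4 ρ α β x t (r - 1) l b) =
      lowerCoeff ρ β (l + 1) * symWeight 4 ρ α β x t r (l + 1) b +
        β * ρ ^ l * (lowerCoeff ρ α (b + 1) * symWeight 4 ρ α β x t r l (b + 1)) := by
  have h3 : ρ ^ 3 = -ρ := by linear_combination ρ * h
  interval_cases t <;> interval_cases r <;> interval_cases l <;> first | omega |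
    (interval_cases b <;> first | omega |
      (simp only [symWeight, coreWeight, coreWeight4, coreWeight4Top0, coreWeight4Top1,
        coreWeight4Top2,
        coreWeight4Top3, raiseFactor, lowerCoeff, qInt, Finset.sum_range_succ,
          Finset.sum_range_zero,
        Finset.prod_range_succ, Finset.prod_range_zero, Nat.reduceSub, Nat.reduceAdd, h,
          h3]; grind))

theorem symWeight4_lower_zero {R : Type*} [CommRing R] (ρ α β x : R) (h : ρ ^ 2 = -1) (t r l b : ℕ)
    (ht : t < 4) (hr : r < 4) (hl : l < 4) (hb : b < 4) (hice : t + r = l + b + 1) :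
    β * ρ ^ r * (lowerCoeff ρ α t * symWeight 4 ρ α β x (t - 1) r l b) +
        x * (lowerCoeff ρ β r * symWeight 4 ρ α β x t (r - 1) l b) =
      α * x * ρ ^ b * (lowerCoeff ρ β (l + 1) * symWeight 4 ρ α β x t r (l + 1) b) +
        lowerCoeff ρ α (b + 1) * symWeight 4 ρ α β x t r l (b + 1) := by
  have h3 : ρ ^ 3 = -ρ := by linear_combination ρ * h
  interval_cases t <;> interval_cases r <;> interval_cases l <;> first | omega |
    (interval_cases b <;> first | omega |
      (simp only [symWeight, coreWeight, coreWeight4, coreWeight4Top0, coreWeight4Top1,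
        coreWeight4Top2,
        coreWeight4Top3, raiseFactor, lowerCoeff, qInt, Finset.sum_range_succ,
          Finset.sum_range_zero,
        Finset.prod_range_succ, Finset.prod_range_zero, Nat.reduceSub, Nat.reduceAdd, h,
          h3]; grind))

/-- For N = 4 the seed is a polynomial identity in ρ, so no relation for ρ has to be substituted. -/
theorem symWeight4_corner_exchange {R : Type*} [CommRing R] (ρ α₁ α₂ β x y : R) (b : ℕ)
    (hb : b < 4) :
    ∑ k ∈ Finset.range (b + 1), symWeight 4 ρ α₁ α₂ x 0 b (b - k) k *
        symWeight 4 ρ α₁ β (x * y) k 0 k 0 * symWeight 4 ρ α₂ β y (b - k) k 0 b =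
      ∑ k ∈ Finset.range (b + 1), symWeight 4 ρ α₂ β y b 0 k (b - k) *
        symWeight 4 ρ α₁ β (x * y) 0 k 0 k * symWeight 4 ρ α₁ α₂ x k (b - k) b 0 := by
  interval_cases b <;>
    (simp only [symWeight, coreWeight, coreWeight4, coreWeight4Top0, coreWeight4Top1,
      coreWeight4Top2,
        coreWeight4Top3, raiseFactor, Finset.sum_range_succ, Finset.sum_range_zero,
        Finset.prod_range_succ, Finset.prod_range_zero, Nat.reduceSub, Nat.reduceAdd]; ring)
end

/-! ### Intertwining properties of the Yang-Baxter defect. -/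

section
open scoped Kronecker
set_option linter.unusedSectionVars false

section Ring
variable {A : Type*} [Ring A]

theorem intertwine_add_right {U V P Q G M : A} (h : U * M = M * V) (hP : P * M = M * Q)
    (hG : G * M = M * G) : (U + P * G) * M = M * (V + Q * G) := by
  rw [add_mul, mul_assoc, hG, ← mul_assoc, hP, h]; noncomm_ring

theorem intertwine_add_left {U V B K M : A} (h : U * M = M * V) (hB : B * M = M * B)
    (hK : K * M = M * K) : (B + K * U) * M = M * (B + K * V) := by
  rw [add_mul, mul_assoc, h, ← mul_assoc, hK, hB]; noncomm_ring

/-- Two-site intertwining relations imply the intertwining property of both sides of the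
Yang-Baxter equation on three sites. -/
theorem three_site_intertwine {F₁ F₂ F₃ K₁ K₂ K₃ R X Y : A}
    (hR : (F₁ + K₁ * F₂) * R = R * (F₂ + K₂ * F₁))
    (hX : (F₁ + K₁ * F₃) * X = X * (F₃ + K₃ * F₁))
    (hY : (F₂ + K₂ * F₃) * Y = Y * (F₃ + K₃ * F₂))
    (hKR : K₁ * K₂ * R = R * (K₂ * K₁)) (hKX : K₁ * K₃ * X = X * (K₃ * K₁))
    (hKY : K₂ * K₃ * Y = Y * (K₃ * K₂))
    (hFR : F₃ * R = R * F₃) (hFX : F₂ * X = X * F₂) (hFY : F₁ * Y = Y * F₁)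
    (hkR : K₃ * R = R * K₃) (hkX : K₂ * X = X * K₂) (hkY : K₁ * Y = Y * K₁) :
    (F₁ + K₁ * F₂ + K₁ * K₂ * F₃) * (R * X * Y - Y * X * R) =
      (R * X * Y - Y * X * R) * (F₃ + K₃ * F₂ + K₃ * K₂ * F₁) := by
  -- Each two-site operator transposes two adjacent sites in the order used by the iterated
  -- coproduct. The words R X Y and Y X R are the two ways of reversing the order of three sites, so
  -- both carry the coproduct to its full reversal.
  have a1 := intertwine_add_right hR hKR hFR
  have a2 := intertwine_add_left hX hFX hkX
  have a3 := intertwine_add_right hY hKY hFY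
  have b1 := intertwine_add_left hY hFY hkY
  have b2 := intertwine_add_right hX hKX hFX
  have b3 := intertwine_add_left hR hFR hkR
  have a : (F₁ + K₁ * F₂ + K₁ * K₂ * F₃) * (R * X * Y) =
      (R * X * Y) * (F₃ + K₃ * F₂ + K₃ * K₂ * F₁) := by
    rw [← mul_assoc, ← mul_assoc, a1,
      show F₂ + K₂ * F₁ + K₂ * K₁ * F₃ = F₂ + K₂ * (F₁ + K₁ * F₃) by noncomm_ring, mul_assoc R, a2,
      show F₂ + K₂ * (F₃ + K₃ * F₁) = F₂ + K₂ * F₃ + K₂ * K₃ * F₁ by noncomm_ring, ← mul_assoc,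
      mul_assoc (R * X), a3]
    noncomm_ring
  have b : (F₁ + K₁ * F₂ + K₁ * K₂ * F₃) * (Y * X * R) =
      (Y * X * R) * (F₃ + K₃ * F₂ + K₃ * K₂ * F₁) := by
    rw [← mul_assoc, ← mul_assoc,
      show F₁ + K₁ * F₂ + K₁ * K₂ * F₃ = F₁ + K₁ * (F₂ + K₂ * F₃) by noncomm_ring, b1,
      show F₁ + K₁ * (F₃ + K₃ * F₂) = F₁ + K₁ * F₃ + K₁ * K₃ * F₂ by noncomm_ring, mul_assoc Y, b2,
      show F₃ + K₃ * F₁ + K₃ * K₁ * F₂ = F₃ + K₃ * (F₁ + K₁ * F₂) by noncomm_ring, ← mul_assoc,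
      mul_assoc (Y * X), b3]
    noncomm_ring
  rw [mul_sub, sub_mul, a, b]

end Ring

section ThreeSites
variable {S : Type*} [Fintype S] [DecidableEq S]

/-- A tensor product of three one-site operators. -/
def tri (A B C : Matrix S S ℂ) : Matrix (S × S × S) (S × S × S) ℂ := A ⊗ₖ (B ⊗ₖ C)

theorem tri_mul (A B C A' B' C' : Matrix S S ℂ) :
    tri A B C * tri A' B' C' = tri (A * A') (B * B') (C * C') := by
  simp only [tri, Matrix.mul_kronecker_mul]

/-- A two-site operator acting on the pair of sites selected by `e`. -/
def pairEmbed (e : S × S × S ≃ (S × S) × S) (M : Matrix (S × S) (S × S) ℂ) :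
    Matrix (S × S × S) (S × S × S) ℂ := (M ⊗ₖ (1 : Matrix S S ℂ)).submatrix e e

theorem pairEmbed_mul (e : S × S × S ≃ (S × S) × S) (M M' : Matrix (S × S) (S × S) ℂ) :
    pairEmbed e (M * M') = pairEmbed e M * pairEmbed e M' := by
  simp only [pairEmbed]
  rw [Matrix.submatrix_mul_equiv, ← Matrix.mul_kronecker_mul, one_mul]

theorem pairEmbed_add (e : S × S × S ≃ (S × S) × S) (M M' : Matrix (S × S) (S × S) ℂ) :
    pairEmbed e (M + M') = pairEmbed e M + pairEmbed e M' := by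
  simp only [pairEmbed, Matrix.add_kronecker]; rfl

theorem pairEmbed_comm (e : S × S × S ≃ (S × S) × S) (M : Matrix (S × S) (S × S) ℂ)
    (C : Matrix S S ℂ) : ((1 : Matrix (S × S) (S × S) ℂ) ⊗ₖ C).submatrix e e * pairEmbed e M =
      pairEmbed e M * ((1 : Matrix (S × S) (S × S) ℂ) ⊗ₖ C).submatrix e e := by
  simp only [pairEmbed]
  rw [Matrix.submatrix_mul_equiv, Matrix.submatrix_mul_equiv, ← Matrix.mul_kronecker_mul,
    ← Matrix.mul_kronecker_mul, one_mul, one_mul, mul_one, mul_one]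

variable (S) in
/-- The first and second site. -/
def sites12 : S × S × S ≃ (S × S) × S := (Equiv.prodAssoc S S S).symm

variable (S) in
/-- The first and third site. -/
def sites13 : S × S × S ≃ (S × S) × S where
  toFun i := ((i.1, i.2.2), i.2.1)
  invFun i := (i.1.1, i.2, i.1.2)
  left_inv _ := rfl
  right_inv _ := rfl

variable (S) in
/-- The second and third site. -/
def sites23 : S × S × S ≃ (S × S) × S := Equiv.prodComm S (S × S)

theorem pairEmbed12_kronecker (A B : Matrix S S ℂ) :
    pairEmbed (sites12 S) (A ⊗ₖ B) = tri A B 1 := by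
  ext ⟨a, b, c⟩ ⟨a', b', c'⟩
  exact mul_assoc _ _ _

theorem pairEmbed13_kronecker (A B : Matrix S S ℂ) :
    pairEmbed (sites13 S) (A ⊗ₖ B) = tri A 1 B := by
  ext ⟨a, b, c⟩ ⟨a', b', c'⟩
  show A a a' * B c c' * (1 : Matrix S S ℂ) b b' = A a a' * ((1 : Matrix S S ℂ) b b' * B c c')
  ring

theorem pairEmbed23_kronecker (A B : Matrix S S ℂ) :
    pairEmbed (sites23 S) (A ⊗ₖ B) = tri 1 A B := by
  ext ⟨a, b, c⟩ ⟨a', b', c'⟩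
  show A b b' * B c c' * (1 : Matrix S S ℂ) a a' = (1 : Matrix S S ℂ) a a' * (A b b' * B c c')
  ring

theorem tri_comm_pairEmbed12 (C : Matrix S S ℂ) (M : Matrix (S × S) (S × S) ℂ) :
    tri 1 1 C * pairEmbed (sites12 S) M = pairEmbed (sites12 S) M * tri 1 1 C := by
  have h := pairEmbed_comm (sites12 S) M C
  have : ((1 : Matrix (S × S) (S × S) ℂ) ⊗ₖ C).submatrix (sites12 S) (sites12 S) = tri 1 1 C := by
    rw [← Matrix.one_kronecker_one]
    ext ⟨a, b, c⟩ ⟨a', b', c'⟩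
    exact mul_assoc _ _ _
  rwa [this] at h

theorem tri_comm_pairEmbed13 (C : Matrix S S ℂ) (M : Matrix (S × S) (S × S) ℂ) :
    tri 1 C 1 * pairEmbed (sites13 S) M = pairEmbed (sites13 S) M * tri 1 C 1 := by
  have h := pairEmbed_comm (sites13 S) M C
  have : ((1 : Matrix (S × S) (S × S) ℂ) ⊗ₖ C).submatrix (sites13 S) (sites13 S) = tri 1 C 1 := by
    rw [← Matrix.one_kronecker_one]
    ext ⟨a, b, c⟩ ⟨a', b', c'⟩
    show (1 : Matrix S S ℂ) a a' * (1 : Matrix S S ℂ) c c' * C b b' =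
      (1 : Matrix S S ℂ) a a' * (C b b' * (1 : Matrix S S ℂ) c c')
    ring
  rwa [this] at h

theorem tri_comm_pairEmbed23 (C : Matrix S S ℂ) (M : Matrix (S × S) (S × S) ℂ) :
    tri C 1 1 * pairEmbed (sites23 S) M = pairEmbed (sites23 S) M * tri C 1 1 := by
  have h := pairEmbed_comm (sites23 S) M C
  have : ((1 : Matrix (S × S) (S × S) ℂ) ⊗ₖ C).submatrix (sites23 S) (sites23 S) = tri C 1 1 := by
    rw [← Matrix.one_kronecker_one]
    ext ⟨a, b, c⟩ ⟨a', b', c'⟩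
    show (1 : Matrix S S ℂ) b b' * (1 : Matrix S S ℂ) c c' * C a a' =
      C a a' * ((1 : Matrix S S ℂ) b b' * (1 : Matrix S S ℂ) c c')
    ring
  rwa [this] at h

/-- The defect of the Yang-Baxter equation. -/
def ybDefect (R X Y : Matrix (S × S) (S × S) ℂ) : Matrix (S × S × S) (S × S × S) ℂ :=
  pairEmbed (sites12 S) R * pairEmbed (sites13 S) X * pairEmbed (sites23 S) Y -
    pairEmbed (sites23 S) Y * pairEmbed (sites13 S) X * pairEmbed (sites12 S) R

theorem pairEmbed_congr {e : S × S × S ≃ (S × S) × S} {P Q M : Matrix (S × S) (S × S) ℂ}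
    (h : P * M = M * Q) : pairEmbed e P * pairEmbed e M = pairEmbed e M * pairEmbed e Q := by
  rw [← pairEmbed_mul, h, pairEmbed_mul]

/-- Coassociativity lifts the two-site relations to three sites. Operators on distinct sites
commute, which supplies the remaining hypotheses of `three_site_intertwine`. -/
theorem ybDefect_intertwine {F₁ F₂ F₃ K₁ K₂ K₃ : Matrix S S ℂ} {R X Y : Matrix (S × S) (S × S) ℂ}
    (hR : (F₁ ⊗ₖ 1 + K₁ ⊗ₖ F₂) * R = R * (1 ⊗ₖ F₂ + F₁ ⊗ₖ K₂))
    (hX : (F₁ ⊗ₖ 1 + K₁ ⊗ₖ F₃) * X = X * (1 ⊗ₖ F₃ + F₁ ⊗ₖ K₃))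
    (hY : (F₂ ⊗ₖ 1 + K₂ ⊗ₖ F₃) * Y = Y * (1 ⊗ₖ F₃ + F₂ ⊗ₖ K₃))
    (hKR : (K₁ ⊗ₖ K₂) * R = R * (K₁ ⊗ₖ K₂)) (hKX : (K₁ ⊗ₖ K₃) * X = X * (K₁ ⊗ₖ K₃))
    (hKY : (K₂ ⊗ₖ K₃) * Y = Y * (K₂ ⊗ₖ K₃)) :
    (tri F₁ 1 1 + tri K₁ F₂ 1 + tri K₁ K₂ F₃) * ybDefect R X Y =
      ybDefect R X Y * (tri 1 1 F₃ + tri 1 F₂ K₃ + tri F₁ K₂ K₃) := by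
  have e1 := pairEmbed_congr (e := sites12 S) hR
  have e2 := pairEmbed_congr (e := sites13 S) hX
  have e3 := pairEmbed_congr (e := sites23 S) hY
  have e4 := pairEmbed_congr (e := sites12 S) hKR
  have e5 := pairEmbed_congr (e := sites13 S) hKX
  have e6 := pairEmbed_congr (e := sites23 S) hKY
  simp only [pairEmbed_add, pairEmbed12_kronecker, pairEmbed13_kronecker, pairEmbed23_kronecker]
    at e1 e2 e3 e4 e5 e6
  have := three_site_intertwine (F₁ := tri F₁ 1 1) (F₂ := tri 1 F₂ 1) (F₃ := tri 1 1 F₃)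
    (K₁ := tri K₁ 1 1) (K₂ := tri 1 K₂ 1) (K₃ := tri 1 1 K₃)
    (R := pairEmbed (sites12 S) R) (X := pairEmbed (sites13 S) X) (Y := pairEmbed (sites23 S) Y)
    (by simpa only [tri_mul, one_mul, mul_one] using e1)
    (by simpa only [tri_mul, one_mul, mul_one] using e2)
    (by simpa only [tri_mul, one_mul, mul_one] using e3)
    (by simpa only [tri_mul, one_mul, mul_one] using e4)
    (by simpa only [tri_mul, one_mul, mul_one] using e5)
    (by simpa only [tri_mul, one_mul, mul_one] using e6)
    (tri_comm_pairEmbed12 _ _) (tri_comm_pairEmbed13 _ _) (tri_comm_pairEmbed23 _ _)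
    (tri_comm_pairEmbed12 _ _) (tri_comm_pairEmbed13 _ _) (tri_comm_pairEmbed23 _ _)
  simpa only [tri_mul, one_mul, mul_one, ybDefect] using this

/-- The variant for the opposite coproduct. -/
theorem ybDefect_intertwine_op {F₁ F₂ F₃ K₁ K₂ K₃ : Matrix S S ℂ}
    {R X Y : Matrix (S × S) (S × S) ℂ}
    (hR : (F₁ ⊗ₖ K₂ + 1 ⊗ₖ F₂) * R = R * (K₁ ⊗ₖ F₂ + F₁ ⊗ₖ 1))
    (hX : (F₁ ⊗ₖ K₃ + 1 ⊗ₖ F₃) * X = X * (K₁ ⊗ₖ F₃ + F₁ ⊗ₖ 1))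
    (hY : (F₂ ⊗ₖ K₃ + 1 ⊗ₖ F₃) * Y = Y * (K₂ ⊗ₖ F₃ + F₂ ⊗ₖ 1))
    (hKR : (K₁ ⊗ₖ K₂) * R = R * (K₁ ⊗ₖ K₂)) (hKX : (K₁ ⊗ₖ K₃) * X = X * (K₁ ⊗ₖ K₃))
    (hKY : (K₂ ⊗ₖ K₃) * Y = Y * (K₂ ⊗ₖ K₃)) :
    (tri F₁ K₂ K₃ + tri 1 F₂ K₃ + tri 1 1 F₃) * ybDefect R X Y =
      ybDefect R X Y * (tri K₁ K₂ F₃ + tri K₁ F₂ 1 + tri F₁ 1 1) := by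
  have e1 := pairEmbed_congr (e := sites12 S) hR
  have e2 := pairEmbed_congr (e := sites13 S) hX
  have e3 := pairEmbed_congr (e := sites23 S) hY
  have e4 := pairEmbed_congr (e := sites12 S) hKR
  have e5 := pairEmbed_congr (e := sites13 S) hKX
  have e6 := pairEmbed_congr (e := sites23 S) hKY
  simp only [pairEmbed_add, pairEmbed12_kronecker, pairEmbed13_kronecker, pairEmbed23_kronecker]
    at e1 e2 e3 e4 e5 e6
  -- The opposite coproduct is the ordinary one read with sites 1 and 3 interchanged. This swaps R
  -- with Y and changes the sign of the defect.
  have := three_site_intertwine (F₁ := tri 1 1 F₃) (F₂ := tri 1 F₂ 1) (F₃ := tri F₁ 1 1)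
    (K₁ := tri 1 1 K₃) (K₂ := tri 1 K₂ 1) (K₃ := tri K₁ 1 1)
    (R := pairEmbed (sites23 S) Y) (X := pairEmbed (sites13 S) X) (Y := pairEmbed (sites12 S) R)
    (by simpa only [tri_mul, one_mul, mul_one, add_comm] using e3)
    (by simpa only [tri_mul, one_mul, mul_one, add_comm] using e2)
    (by simpa only [tri_mul, one_mul, mul_one, add_comm] using e1)
    (by simpa only [tri_mul, one_mul, mul_one] using e6)
    (by simpa only [tri_mul, one_mul, mul_one] using e5)
    (by simpa only [tri_mul, one_mul, mul_one] using e4)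
    (tri_comm_pairEmbed23 _ _) (tri_comm_pairEmbed13 _ _) (tri_comm_pairEmbed12 _ _)
    (tri_comm_pairEmbed23 _ _) (tri_comm_pairEmbed13 _ _) (tri_comm_pairEmbed12 _ _)
  simp only [tri_mul, one_mul, mul_one] at this
  have hd : ybDefect R X Y = -(pairEmbed (sites23 S) Y * pairEmbed (sites13 S) X *
      pairEmbed (sites12 S) R - pairEmbed (sites12 S) R * pairEmbed (sites13 S) X *
      pairEmbed (sites23 S) Y) := by rw [ybDefect, neg_sub]
  rw [hd, mul_neg, neg_mul, neg_inj]
  rw [show tri F₁ K₂ K₃ + tri 1 F₂ K₃ + tri 1 1 F₃ = tri 1 1 F₃ + tri 1 F₂ K₃ + tri F₁ K₂ K₃ by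
    abel,
    show tri K₁ K₂ F₃ + tri K₁ F₂ 1 + tri F₁ 1 1 = tri F₁ 1 1 + tri K₁ F₂ 1 + tri K₁ K₂ F₃ by abel]
  exact this

end ThreeSites
end

/-! ### Vertex weights as matrices, and their intertwining relations for all N considered. -/

section
open scoped Kronecker
set_option linter.unusedSectionVars false

theorem coreWeight_ne_zero {R : Type*} [CommRing R] {N : ℕ} {ρ α β x : R} {t r l b : ℕ}
    (h : coreWeight N ρ α β x t r l b ≠ 0) :
    t + r = l + b ∧ t < N ∧ r < N ∧ l < N ∧ b < N := by
  unfold coreWeight at h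
  split at h
  · unfold coreWeight2 at h; split at h <;> simp_all
  · unfold coreWeight3 at h; split at h <;> simp_all
  · unfold coreWeight4 at h
    split at h
    · unfold coreWeight4Top0 at h; split at h <;> simp_all
    · unfold coreWeight4Top1 at h; split at h <;> simp_all
    · unfold coreWeight4Top2 at h; split at h <;> simp_all
    · unfold coreWeight4Top3 at h; split at h <;> simp_all
    · exact absurd rfl h
  · exact absurd rfl h

/-- The weights are total functions on natural numbers that vanish off the ice rule and outside the
state range. Shifted indices can therefore be used without separate boundary cases. -/
theorem symWeight_eq_zero {R : Type*} [CommRing R] {N : ℕ} {ρ α β x : R} {t r l b : ℕ}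
    (h : ¬ (t + r = l + b ∧ t < N ∧ r < N ∧ l < N ∧ b < N)) :
    symWeight N ρ α β x t r l b = 0 := by
  rw [symWeight, not_not.1 (mt coreWeight_ne_zero h), zero_mul, zero_mul]

theorem IsPrimitiveRoot.sq_of_three {ρ : ℂ} (h : IsPrimitiveRoot ρ 3) : ρ ^ 2 = -1 - ρ := by
  have := h.geom_sum_eq_zero (by norm_num)
  simp only [Finset.sum_range_succ, Finset.sum_range_zero] at this
  linear_combination this

theorem IsPrimitiveRoot.sq_of_four {ρ : ℂ} (h : IsPrimitiveRoot ρ 4) : ρ ^ 2 = -1 := by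
  have := h.pow (by norm_num) (show 4 = 2 * 2 by norm_num)
  exact this.eq_neg_one_of_two_right

theorem lowerCoeff_zero {R : Type*} [CommRing R] (ρ a : R) : lowerCoeff ρ a 0 = 0 := by
  simp [lowerCoeff, qInt]

theorem symWeight_raise_one {N : ℕ} (hN : N = 2 ∨ N = 3 ∨ N = 4) {ρ : ℂ} (hρ : IsPrimitiveRoot ρ N)
    (α β x : ℂ) {t r l b : ℕ} (ht : t < N) (hr : r < N) (hl : l < N) (hb : b < N) :
    symWeight N ρ α β x (t + 1) r l b + α * ρ ^ t * symWeight N ρ α β x t (r + 1) l b =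
      (if l = 0 then 0 else symWeight N ρ α β x t r (l - 1) b) +
        β * ρ ^ l * (if b = 0 then 0 else symWeight N ρ α β x t r l (b - 1)) := by
  by_cases hice : t + r + 1 = l + b
  · rcases hN with rfl | rfl | rfl
    · exact symWeight2_raise_one ρ α β x hρ.eq_neg_one_of_two_right t r l b ht hr hl hb hice
    · exact symWeight3_raise_one ρ α β x hρ.sq_of_three t r l b ht hr hl hb hice
    · exact symWeight4_raise_one ρ α β x hρ.sq_of_four t r l b ht hr hl hb hice
  · rw [symWeight_eq_zero (by omega), symWeight_eq_zero (by omega)]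
    have h1 : (if l = 0 then 0 else symWeight N ρ α β x t r (l - 1) b) = 0 := by
      split_ifs
      · rfl
      · exact symWeight_eq_zero (by omega)
    have h2 : (if b = 0 then 0 else symWeight N ρ α β x t r l (b - 1)) = 0 := by
      split_ifs
      · rfl
      · exact symWeight_eq_zero (by omega)
    rw [h1, h2]; ring

theorem symWeight_raise_zero {N : ℕ} (hN : N = 2 ∨ N = 3 ∨ N = 4) {ρ : ℂ} (hρ : IsPrimitiveRoot ρ N)
    (α β x : ℂ) {t r l b : ℕ} (ht : t < N) (hr : r < N) (hl : l < N) (hb : b < N) :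
    β * x * ρ ^ r * symWeight N ρ α β x (t + 1) r l b + symWeight N ρ α β x t (r + 1) l b =
      α * ρ ^ b * (if l = 0 then 0 else symWeight N ρ α β x t r (l - 1) b) +
        x * (if b = 0 then 0 else symWeight N ρ α β x t r l (b - 1)) := by
  by_cases hice : t + r + 1 = l + b
  · rcases hN with rfl | rfl | rfl
    · exact symWeight2_raise_zero ρ α β x hρ.eq_neg_one_of_two_right t r l b ht hr hl hb hice
    · exact symWeight3_raise_zero ρ α β x hρ.sq_of_three t r l b ht hr hl hb hice
    · exact symWeight4_raise_zero ρ α β x hρ.sq_of_four t r l b ht hr hl hb hice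
  · rw [symWeight_eq_zero (by omega), symWeight_eq_zero (by omega)]
    have h1 : (if l = 0 then 0 else symWeight N ρ α β x t r (l - 1) b) = 0 := by
      split_ifs
      · rfl
      · exact symWeight_eq_zero (by omega)
    have h2 : (if b = 0 then 0 else symWeight N ρ α β x t r l (b - 1)) = 0 := by
      split_ifs
      · rfl
      · exact symWeight_eq_zero (by omega)
    rw [h1, h2]; ring

theorem symWeight_lower_one {N : ℕ} (hN : N = 2 ∨ N = 3 ∨ N = 4) {ρ : ℂ} (hρ : IsPrimitiveRoot ρ N)
    (α β x : ℂ) {t r l b : ℕ} (ht : t < N) (hr : r < N) (hl : l < N) (hb : b < N) :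
    lowerCoeff ρ α t * symWeight N ρ α β x (t - 1) r l b +
        α * ρ ^ t * (lowerCoeff ρ β r * symWeight N ρ α β x t (r - 1) l b) =
      lowerCoeff ρ β (l + 1) * symWeight N ρ α β x t r (l + 1) b +
        β * ρ ^ l * (lowerCoeff ρ α (b + 1) * symWeight N ρ α β x t r l (b + 1)) := by
  by_cases hice : t + r = l + b + 1
  · rcases hN with rfl | rfl | rfl
    · exact symWeight2_lower_one ρ α β x hρ.eq_neg_one_of_two_right t r l b ht hr hl hb hice
    · exact symWeight3_lower_one ρ α β x hρ.sq_of_three t r l b ht hr hl hb hice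
    · exact symWeight4_lower_one ρ α β x hρ.sq_of_four t r l b ht hr hl hb hice
  · rw [symWeight_eq_zero (l := l + 1) (by omega), symWeight_eq_zero (b := b + 1) (by omega)]
    have h1 : lowerCoeff ρ α t * symWeight N ρ α β x (t - 1) r l b = 0 := by
      rcases Nat.eq_zero_or_pos t with rfl | h
      · rw [lowerCoeff_zero, zero_mul]
      · rw [symWeight_eq_zero (by omega), mul_zero]
    have h2 : lowerCoeff ρ β r * symWeight N ρ α β x t (r - 1) l b = 0 := by
      rcases Nat.eq_zero_or_pos r with rfl | h
      · rw [lowerCoeff_zero, zero_mul]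
      · rw [symWeight_eq_zero (by omega), mul_zero]
    rw [h1, h2]; ring

theorem symWeight_lower_zero {N : ℕ} (hN : N = 2 ∨ N = 3 ∨ N = 4) {ρ : ℂ} (hρ : IsPrimitiveRoot ρ N)
    (α β x : ℂ) {t r l b : ℕ} (ht : t < N) (hr : r < N) (hl : l < N) (hb : b < N) :
    β * ρ ^ r * (lowerCoeff ρ α t * symWeight N ρ α β x (t - 1) r l b) +
        x * (lowerCoeff ρ β r * symWeight N ρ α β x t (r - 1) l b) =
      α * x * ρ ^ b * (lowerCoeff ρ β (l + 1) * symWeight N ρ α β x t r (l + 1) b) +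
        lowerCoeff ρ α (b + 1) * symWeight N ρ α β x t r l (b + 1) := by
  by_cases hice : t + r = l + b + 1
  · rcases hN with rfl | rfl | rfl
    · exact symWeight2_lower_zero ρ α β x hρ.eq_neg_one_of_two_right t r l b ht hr hl hb hice
    · exact symWeight3_lower_zero ρ α β x hρ.sq_of_three t r l b ht hr hl hb hice
    · exact symWeight4_lower_zero ρ α β x hρ.sq_of_four t r l b ht hr hl hb hice
  · rw [symWeight_eq_zero (l := l + 1) (by omega), symWeight_eq_zero (b := b + 1) (by omega)]
    have h1 : lowerCoeff ρ α t * symWeight N ρ α β x (t - 1) r l b = 0 := by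
      rcases Nat.eq_zero_or_pos t with rfl | h
      · rw [lowerCoeff_zero, zero_mul]
      · rw [symWeight_eq_zero (by omega), mul_zero]
    have h2 : lowerCoeff ρ β r * symWeight N ρ α β x t (r - 1) l b = 0 := by
      rcases Nat.eq_zero_or_pos r with rfl | h
      · rw [lowerCoeff_zero, zero_mul]
      · rw [symWeight_eq_zero (by omega), mul_zero]
    rw [h1, h2]; ring

theorem symWeight_corner_exchange {N : ℕ} (hN : N = 2 ∨ N = 3 ∨ N = 4) {ρ : ℂ}
    (hρ : IsPrimitiveRoot ρ N) (α₁ α₂ β x y : ℂ) {b : ℕ} (hb : b < N) :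
    ∑ k ∈ Finset.range (b + 1), symWeight N ρ α₁ α₂ x 0 b (b - k) k *
        symWeight N ρ α₁ β (x * y) k 0 k 0 * symWeight N ρ α₂ β y (b - k) k 0 b =
      ∑ k ∈ Finset.range (b + 1), symWeight N ρ α₂ β y b 0 k (b - k) *
        symWeight N ρ α₁ β (x * y) 0 k 0 k * symWeight N ρ α₁ α₂ x k (b - k) b 0 := by
  rcases hN with rfl | rfl | rfl
  · exact symWeight2_corner_exchange ρ α₁ α₂ β x y hρ.eq_neg_one_of_two_right b hb
  · exact symWeight3_corner_exchange ρ α₁ α₂ β x y hρ.sq_of_three b hb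
  · exact symWeight4_corner_exchange ρ α₁ α₂ β x y b hb

section OneSite
variable (N : ℕ)

/-- The raising operator. -/
def shiftMat : Matrix (Fin N) (Fin N) ℂ := Matrix.of fun i j => if (j : ℕ) = i + 1 then 1 else 0

/-- The lowering operator. -/
def lowerMat (ρ a : ℂ) : Matrix (Fin N) (Fin N) ℂ :=
  Matrix.of fun i j => if (i : ℕ) = j + 1 then lowerCoeff ρ a i else 0

/-- The Cartan operator. -/
def chargeMat (ρ a : ℂ) : Matrix (Fin N) (Fin N) ℂ := Matrix.diagonal fun i => a * ρ ^ (i : ℕ)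

/-- The vertex weights as an operator from (top, right) to (bottom, left). -/
def vertexMat (ρ α β x : ℂ) : Matrix (Fin N × Fin N) (Fin N × Fin N) ℂ :=
  Matrix.of fun i o => symWeight N ρ α β x i.1 i.2 o.2 o.1

variable {N}

theorem sum_fin_ite_eq (g : ℕ → ℂ) (k : ℕ) :
    ∑ j : Fin N, (if (j : ℕ) = k then g j else 0) = if k < N then g k else 0 := by
  split_ifs with h
  · rw [Finset.sum_eq_single (⟨k, h⟩ : Fin N)]
    · simp
    · intro j _ hj
      rw [if_neg]
      exact fun h' => hj (Fin.ext h')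
    · simp
  · exact Finset.sum_eq_zero fun j _ => if_neg fun h' => h (by omega)

/-- The condition at N accounts for the top state, which the raising matrix annihilates. -/
theorem sum_shiftMat_mul {g : ℕ → ℂ} (hg : g N = 0) (i : Fin N) :
    ∑ j, shiftMat N i j * g j = g (i + 1) := by
  simp only [shiftMat, Matrix.of_apply, ite_mul, one_mul, zero_mul]
  rw [sum_fin_ite_eq]
  split_ifs with h
  · rfl
  · rw [show (i : ℕ) + 1 = N by omega, hg]

theorem sum_mul_shiftMat (g : ℕ → ℂ) (j : Fin N) :
    ∑ i : Fin N, g i * shiftMat N i j = if (j : ℕ) = 0 then 0 else g (j - 1) := by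
  simp only [shiftMat, Matrix.of_apply, mul_ite, mul_one, mul_zero]
  split_ifs with h
  · exact Finset.sum_eq_zero fun i _ => if_neg (by omega)
  · rw [show (∑ i : Fin N, if (j : ℕ) = i + 1 then g i else 0) =
      ∑ i : Fin N, if (i : ℕ) = j - 1 then g i else 0 from
        Finset.sum_congr rfl fun i _ => if_congr (by omega) rfl rfl, sum_fin_ite_eq,
          if_pos (by omega)]

theorem sum_lowerMat_mul (ρ a : ℂ) (g : ℕ → ℂ) (i : Fin N) :
    ∑ j, lowerMat N ρ a i j * g j = lowerCoeff ρ a i * g (i - 1) := by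
  simp only [lowerMat, Matrix.of_apply, ite_mul, zero_mul]
  rcases Nat.eq_zero_or_pos (i : ℕ) with h | h
  · rw [h, lowerCoeff_zero, zero_mul]
    exact Finset.sum_eq_zero fun j _ => if_neg (by omega)
  · rw [show (∑ j : Fin N, if (i : ℕ) = j + 1 then lowerCoeff ρ a i * g j else 0) =
      ∑ j : Fin N, if (j : ℕ) = i - 1 then lowerCoeff ρ a i * g j else 0 from
        Finset.sum_congr rfl fun j _ => if_congr (by omega) rfl rfl,
      sum_fin_ite_eq (fun j => lowerCoeff ρ a i * g j), if_pos (by omega)]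

theorem sum_mul_lowerMat (ρ a : ℂ) {g : ℕ → ℂ} (hg : g N = 0) (j : Fin N) :
    ∑ i : Fin N, g i * lowerMat N ρ a i j = lowerCoeff ρ a (j + 1) * g (j + 1) := by
  simp only [lowerMat, Matrix.of_apply, mul_ite, mul_zero]
  rw [sum_fin_ite_eq (fun i => g i * lowerCoeff ρ a i)]
  split_ifs with h
  · ring
  · rw [show (j : ℕ) + 1 = N by omega, hg, mul_zero]

theorem sum_chargeMat_mul (ρ a : ℂ) (g : Fin N → ℂ) (i : Fin N) :
    ∑ j, chargeMat N ρ a i j * g j = a * ρ ^ (i : ℕ) * g i := by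
  simp [chargeMat, Matrix.diagonal_apply]

theorem sum_mul_chargeMat (ρ a : ℂ) (g : Fin N → ℂ) (j : Fin N) :
    ∑ i, g i * chargeMat N ρ a i j = a * ρ ^ (j : ℕ) * g j := by
  simp [chargeMat, Matrix.diagonal_apply, mul_comm]

theorem sum_one_mul (g : Fin N → ℂ) (i : Fin N) :
    ∑ j, (1 : Matrix (Fin N) (Fin N) ℂ) i j * g j = g i := by
  simp [Matrix.one_apply]

theorem sum_mul_one (g : Fin N → ℂ) (j : Fin N) :
    ∑ i, g i * (1 : Matrix (Fin N) (Fin N) ℂ) i j = g j := by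
  simp [Matrix.one_apply]

end OneSite

section TwoSites
variable {S : Type*} [Fintype S] [DecidableEq S]

theorem kronecker_mul_apply (A B : Matrix S S ℂ) (M : Matrix (S × S) (S × S) ℂ) (i o : S × S) :
    ((A ⊗ₖ B) * M) i o = ∑ a, A i.1 a * ∑ b, B i.2 b * M (a, b) o := by
  simp only [Matrix.mul_apply, Fintype.sum_prod_type, Finset.mul_sum, Matrix.kroneckerMap_apply,
    mul_assoc]

theorem mul_kronecker_apply (A B : Matrix S S ℂ) (M : Matrix (S × S) (S × S) ℂ) (i o : S × S) :
    (M * (A ⊗ₖ B)) i o = ∑ a, (∑ b, M i (a, b) * B b o.2) * A a o.1 := by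
  simp only [Matrix.mul_apply, Fintype.sum_prod_type, Finset.sum_mul, Matrix.kroneckerMap_apply]
  exact Finset.sum_congr rfl fun a _ => Finset.sum_congr rfl fun b _ => by ring

end TwoSites

section VertexRelations
variable {N : ℕ}

section Entries
variable (ρ a : ℂ) (A : Matrix (Fin N) (Fin N) ℂ)
  (M : Matrix (Fin N × Fin N) (Fin N × Fin N) ℂ) (i o : Fin N × Fin N)

theorem chargeMat_kronecker_mul_apply : ((chargeMat N ρ a ⊗ₖ A) * M) i o =
    a * ρ ^ (i.1 : ℕ) * ∑ b, A i.2 b * M (i.1, b) o := by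
  rw [kronecker_mul_apply, sum_chargeMat_mul]

theorem one_kronecker_mul_apply : (((1 : Matrix (Fin N) (Fin N) ℂ) ⊗ₖ A) * M) i o =
    ∑ b, A i.2 b * M (i.1, b) o := by
  rw [kronecker_mul_apply, sum_one_mul]

theorem kronecker_chargeMat_mul_apply : ((A ⊗ₖ chargeMat N ρ a) * M) i o =
    a * ρ ^ (i.2 : ℕ) * ∑ b, A i.1 b * M (b, i.2) o := by
  rw [kronecker_mul_apply, Finset.mul_sum]
  simp only [sum_chargeMat_mul]
  exact Finset.sum_congr rfl fun b _ => by ring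

theorem kronecker_one_mul_apply : ((A ⊗ₖ (1 : Matrix (Fin N) (Fin N) ℂ)) * M) i o =
    ∑ b, A i.1 b * M (b, i.2) o := by
  rw [kronecker_mul_apply]
  simp only [sum_one_mul]

theorem mul_chargeMat_kronecker_apply : (M * (chargeMat N ρ a ⊗ₖ A)) i o =
    a * ρ ^ (o.1 : ℕ) * ∑ b, M i (o.1, b) * A b o.2 := by
  rw [mul_kronecker_apply, sum_mul_chargeMat]

theorem mul_one_kronecker_apply : (M * ((1 : Matrix (Fin N) (Fin N) ℂ) ⊗ₖ A)) i o =
    ∑ b, M i (o.1, b) * A b o.2 := by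
  rw [mul_kronecker_apply, sum_mul_one]

theorem mul_kronecker_chargeMat_apply : (M * (A ⊗ₖ chargeMat N ρ a)) i o =
    a * ρ ^ (o.2 : ℕ) * ∑ b, M i (b, o.2) * A b o.1 := by
  rw [mul_kronecker_apply, Finset.mul_sum]
  simp only [sum_mul_chargeMat, mul_assoc]

theorem mul_kronecker_one_apply : (M * (A ⊗ₖ (1 : Matrix (Fin N) (Fin N) ℂ))) i o =
    ∑ b, M i (b, o.2) * A b o.1 := by
  rw [mul_kronecker_apply]
  simp only [sum_mul_one]

end Entries

section VertexEntries
variable (ρ a α β x : ℂ)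

theorem sum_shiftMat_mul_vertexMat_left (t r : Fin N) (o : Fin N × Fin N) :
    ∑ j, shiftMat N t j * vertexMat N ρ α β x (j, r) o =
      symWeight N ρ α β x (t + 1) r o.2 o.1 :=
  sum_shiftMat_mul (g := fun j => symWeight N ρ α β x j r o.2 o.1) (symWeight_eq_zero (by omega)) t

theorem sum_shiftMat_mul_vertexMat_right (t r : Fin N) (o : Fin N × Fin N) :
    ∑ j, shiftMat N r j * vertexMat N ρ α β x (t, j) o =
      symWeight N ρ α β x t (r + 1) o.2 o.1 :=
  sum_shiftMat_mul (g := fun j => symWeight N ρ α β x t j o.2 o.1) (symWeight_eq_zero (by omega)) r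

theorem sum_vertexMat_mul_shiftMat_left (b l : Fin N) (i : Fin N × Fin N) :
    ∑ j, vertexMat N ρ α β x i (j, l) * shiftMat N j b =
      if (b : ℕ) = 0 then 0 else symWeight N ρ α β x i.1 i.2 l (b - 1) :=
  sum_mul_shiftMat (fun j => symWeight N ρ α β x i.1 i.2 l j) b

theorem sum_vertexMat_mul_shiftMat_right (b l : Fin N) (i : Fin N × Fin N) :
    ∑ j, vertexMat N ρ α β x i (b, j) * shiftMat N j l =
      if (l : ℕ) = 0 then 0 else symWeight N ρ α β x i.1 i.2 (l - 1) b :=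
  sum_mul_shiftMat (fun j => symWeight N ρ α β x i.1 i.2 j b) l

theorem sum_lowerMat_mul_vertexMat_left (t r : Fin N) (o : Fin N × Fin N) :
    ∑ j, lowerMat N ρ a t j * vertexMat N ρ α β x (j, r) o =
      lowerCoeff ρ a t * symWeight N ρ α β x (t - 1) r o.2 o.1 :=
  sum_lowerMat_mul ρ a (fun j => symWeight N ρ α β x j r o.2 o.1) t

theorem sum_lowerMat_mul_vertexMat_right (t r : Fin N) (o : Fin N × Fin N) :
    ∑ j, lowerMat N ρ a r j * vertexMat N ρ α β x (t, j) o =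
      lowerCoeff ρ a r * symWeight N ρ α β x t (r - 1) o.2 o.1 :=
  sum_lowerMat_mul ρ a (fun j => symWeight N ρ α β x t j o.2 o.1) r

theorem sum_vertexMat_mul_lowerMat_left (b l : Fin N) (i : Fin N × Fin N) :
    ∑ j, vertexMat N ρ α β x i (j, l) * lowerMat N ρ a j b =
      lowerCoeff ρ a (b + 1) * symWeight N ρ α β x i.1 i.2 l (b + 1) :=
  sum_mul_lowerMat ρ a (g := fun j => symWeight N ρ α β x i.1 i.2 l j)
    (symWeight_eq_zero (by omega)) b

theorem sum_vertexMat_mul_lowerMat_right (b l : Fin N) (i : Fin N × Fin N) :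
    ∑ j, vertexMat N ρ α β x i (b, j) * lowerMat N ρ a j l =
      lowerCoeff ρ a (l + 1) * symWeight N ρ α β x i.1 i.2 (l + 1) b :=
  sum_mul_lowerMat ρ a (g := fun j => symWeight N ρ α β x i.1 i.2 j b)
    (symWeight_eq_zero (by omega)) l

end VertexEntries

variable {ρ : ℂ}

theorem vertexMat_raise_one (hN : N = 2 ∨ N = 3 ∨ N = 4) (hρ : IsPrimitiveRoot ρ N) (α β x : ℂ) :
    (shiftMat N ⊗ₖ 1 + chargeMat N ρ α ⊗ₖ shiftMat N) * vertexMat N ρ α β x =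
      vertexMat N ρ α β x * (1 ⊗ₖ shiftMat N + shiftMat N ⊗ₖ chargeMat N ρ β) := by
  ext ⟨t, r⟩ ⟨b, l⟩
  rw [add_mul, mul_add, Matrix.add_apply, Matrix.add_apply, kronecker_one_mul_apply,
    chargeMat_kronecker_mul_apply, mul_one_kronecker_apply, mul_kronecker_chargeMat_apply,
    sum_shiftMat_mul_vertexMat_left, sum_shiftMat_mul_vertexMat_right,
    sum_vertexMat_mul_shiftMat_left, sum_vertexMat_mul_shiftMat_right]
  exact symWeight_raise_one hN hρ α β x t.2 r.2 l.2 b.2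

theorem vertexMat_raise_zero (hN : N = 2 ∨ N = 3 ∨ N = 4) (hρ : IsPrimitiveRoot ρ N) (α β x : ℂ) :
    (x • shiftMat N ⊗ₖ chargeMat N ρ β + 1 ⊗ₖ shiftMat N) * vertexMat N ρ α β x =
      vertexMat N ρ α β x * (chargeMat N ρ α ⊗ₖ shiftMat N + x • shiftMat N ⊗ₖ 1) := by
  ext ⟨t, r⟩ ⟨b, l⟩
  rw [add_mul, mul_add, Matrix.add_apply, Matrix.add_apply, Matrix.smul_mul, Matrix.mul_smul,
    Matrix.smul_apply, Matrix.smul_apply, one_kronecker_mul_apply,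
    kronecker_chargeMat_mul_apply, mul_kronecker_one_apply, mul_chargeMat_kronecker_apply,
    sum_shiftMat_mul_vertexMat_left, sum_shiftMat_mul_vertexMat_right,
    sum_vertexMat_mul_shiftMat_left, sum_vertexMat_mul_shiftMat_right, smul_eq_mul, smul_eq_mul]
  rw [← symWeight_raise_zero hN hρ α β x t.2 r.2 l.2 b.2]
  ring

theorem vertexMat_lower_one (hN : N = 2 ∨ N = 3 ∨ N = 4) (hρ : IsPrimitiveRoot ρ N) (α β x : ℂ) :
    (lowerMat N ρ α ⊗ₖ 1 + chargeMat N ρ α ⊗ₖ lowerMat N ρ β) * vertexMat N ρ α β x =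
      vertexMat N ρ α β x * (1 ⊗ₖ lowerMat N ρ β + lowerMat N ρ α ⊗ₖ chargeMat N ρ β) := by
  ext ⟨t, r⟩ ⟨b, l⟩
  rw [add_mul, mul_add, Matrix.add_apply, Matrix.add_apply, kronecker_one_mul_apply,
    chargeMat_kronecker_mul_apply, mul_one_kronecker_apply, mul_kronecker_chargeMat_apply,
    sum_lowerMat_mul_vertexMat_left, sum_lowerMat_mul_vertexMat_right,
    sum_vertexMat_mul_lowerMat_left, sum_vertexMat_mul_lowerMat_right]
  exact symWeight_lower_one hN hρ α β x t.2 r.2 l.2 b.2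

theorem vertexMat_lower_zero (hN : N = 2 ∨ N = 3 ∨ N = 4) (hρ : IsPrimitiveRoot ρ N) (α β x : ℂ) :
    (lowerMat N ρ α ⊗ₖ chargeMat N ρ β + x • 1 ⊗ₖ lowerMat N ρ β) * vertexMat N ρ α β x =
      vertexMat N ρ α β x * (x • chargeMat N ρ α ⊗ₖ lowerMat N ρ β + lowerMat N ρ α ⊗ₖ 1) := by
  ext ⟨t, r⟩ ⟨b, l⟩
  rw [add_mul, mul_add, Matrix.add_apply, Matrix.add_apply, Matrix.smul_mul, Matrix.mul_smul,
    Matrix.smul_apply, Matrix.smul_apply, one_kronecker_mul_apply,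
    kronecker_chargeMat_mul_apply, mul_kronecker_one_apply, mul_chargeMat_kronecker_apply,
    sum_lowerMat_mul_vertexMat_left, sum_lowerMat_mul_vertexMat_right,
    sum_vertexMat_mul_lowerMat_left, sum_vertexMat_mul_lowerMat_right, smul_eq_mul, smul_eq_mul]
  rw [symWeight_lower_zero hN hρ α β x t.2 r.2 l.2 b.2]
  ring

/-- This is the ice rule in operator form: the charges of the two lines multiply to a power of ρ
that depends only on the sum of the states. -/
theorem vertexMat_charge (ρ α β x : ℂ) (a b : ℂ) :
    (chargeMat N ρ a ⊗ₖ chargeMat N ρ b) * vertexMat N ρ α β x =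
      vertexMat N ρ α β x * (chargeMat N ρ a ⊗ₖ chargeMat N ρ b) := by
  ext ⟨t, r⟩ ⟨b', l⟩
  rw [chargeMat_kronecker_mul_apply, mul_chargeMat_kronecker_apply, sum_chargeMat_mul,
    sum_mul_chargeMat]
  simp only [vertexMat, Matrix.of_apply]
  by_cases h : (t : ℕ) + r = l + b'
  · linear_combination a * b * symWeight N ρ α β x t r l b' *
      (congrArg (ρ ^ ·) h + pow_add ρ (l : ℕ) b' - pow_add ρ (t : ℕ) r)
  · rw [symWeight_eq_zero (by omega)]; ring

end VertexRelations
end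

/-! ### Entries of the defect: the elimination scheme and the seed. -/

section
open scoped Kronecker
set_option linter.unusedSectionVars false
set_option linter.unusedSimpArgs false

section ThreeSiteEntries
variable {S : Type*} [Fintype S] [DecidableEq S]

theorem tri_mul_apply (A B C : Matrix S S ℂ) (M : Matrix (S × S × S) (S × S × S) ℂ)
    (i o : S × S × S) : (tri A B C * M) i o =
      ∑ a, A i.1 a * ∑ b, B i.2.1 b * ∑ c, C i.2.2 c * M (a, b, c) o := by
  simp only [tri, Matrix.mul_apply, Fintype.sum_prod_type, Finset.mul_sum,
    Matrix.kroneckerMap_apply, mul_assoc]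

theorem mul_tri_apply (A B C : Matrix S S ℂ) (M : Matrix (S × S × S) (S × S × S) ℂ)
    (i o : S × S × S) : (M * tri A B C) i o =
      ∑ a, (∑ b, (∑ c, M i (a, b, c) * C c o.2.2) * B b o.2.1) * A a o.1 := by
  simp only [tri, Matrix.mul_apply, Fintype.sum_prod_type, Finset.sum_mul,
    Matrix.kroneckerMap_apply]
  exact Finset.sum_congr rfl fun a _ => Finset.sum_congr rfl fun b _ =>
    Finset.sum_congr rfl fun c _ => by ring

theorem pairEmbed12_apply (M : Matrix (S × S) (S × S) ℂ) (a b c a' b' c' : S) :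
    pairEmbed (sites12 S) M (a, b, c) (a', b', c') = if c = c' then M (a, b) (a', b') else 0 := by
  change M (a, b) (a', b') * (1 : Matrix S S ℂ) c c' = _
  rw [Matrix.one_apply, mul_ite, mul_one, mul_zero]

theorem pairEmbed13_apply (M : Matrix (S × S) (S × S) ℂ) (a b c a' b' c' : S) :
    pairEmbed (sites13 S) M (a, b, c) (a', b', c') = if b = b' then M (a, c) (a', c') else 0 := by
  change M (a, c) (a', c') * (1 : Matrix S S ℂ) b b' = _
  rw [Matrix.one_apply, mul_ite, mul_one, mul_zero]

theorem pairEmbed23_apply (M : Matrix (S × S) (S × S) ℂ) (a b c a' b' c' : S) :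
    pairEmbed (sites23 S) M (a, b, c) (a', b', c') = if a = a' then M (b, c) (b', c') else 0 := by
  change M (b, c) (b', c') * (1 : Matrix S S ℂ) a a' = _
  rw [Matrix.one_apply, mul_ite, mul_one, mul_zero]

theorem pairEmbed_123_apply (R X Y : Matrix (S × S) (S × S) ℂ) (a b c a' b' c' : S) :
    (pairEmbed (sites12 S) R * pairEmbed (sites13 S) X * pairEmbed (sites23 S) Y)
        (a, b, c) (a', b', c') =
      ∑ p, ∑ q, ∑ m, R (a, b) (p, q) * X (p, c) (a', m) * Y (q, m) (b', c') := by
  simp only [Matrix.mul_apply, Fintype.sum_prod_type, pairEmbed12_apply, pairEmbed13_apply,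
    pairEmbed23_apply, ite_mul, mul_ite, mul_zero, zero_mul, Finset.sum_ite_eq,
    Finset.sum_ite_eq', Finset.mem_univ, if_true, Finset.sum_mul, Finset.sum_const_zero]
  simp only [Finset.sum_ite_irrel, Finset.sum_const_zero, Finset.sum_ite_eq, Finset.sum_ite_eq',
    Finset.mem_univ, if_true]
  rw [Finset.sum_congr rfl fun q _ => Finset.sum_comm, Finset.sum_comm]

theorem pairEmbed_321_apply (R X Y : Matrix (S × S) (S × S) ℂ) (a b c a' b' c' : S) :
    (pairEmbed (sites23 S) Y * pairEmbed (sites13 S) X * pairEmbed (sites12 S) R)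
        (a, b, c) (a', b', c') =
      ∑ p, ∑ q, ∑ m, Y (b, c) (q, m) * X (a, m) (p, c') * R (p, q) (a', b') := by
  simp only [Matrix.mul_apply, Fintype.sum_prod_type, pairEmbed12_apply, pairEmbed13_apply,
    pairEmbed23_apply, ite_mul, mul_ite, mul_zero, zero_mul, Finset.sum_ite_eq,
    Finset.sum_ite_eq', Finset.mem_univ, if_true, Finset.sum_mul, Finset.sum_const_zero]
  simp only [Finset.sum_ite_irrel, Finset.sum_const_zero, Finset.sum_ite_eq, Finset.sum_ite_eq',
    Finset.mem_univ, if_true]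

end ThreeSiteEntries

/-- A family vanishing on the states `(0, b, 0)` vanishes if vanishing propagates along raising of
the first and third sites. -/
theorem three_site_elimination {M : Type*} [Zero M] {N : ℕ} {κ : ℕ → ℕ → ℕ → M}
    (hout : ∀ a b r, ¬ (a < N ∧ b < N ∧ r < N) → κ a b r = 0) (h0 : ∀ b, κ 0 b 0 = 0)
    (hstep : ∀ a b r, a < N → b < N → r < N → κ a b r = 0 → κ a (b + 1) r = 0 →
      κ (a + 1) b r = 0 ∧ κ a b (r + 1) = 0) (a b r : ℕ) : κ a b r = 0 := by
  suffices h : ∀ n a b r, a + r = n → κ a b r = 0 from h _ a b r rfl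
  intro n
  induction n with
  | zero =>
    intro a b r h
    obtain ⟨rfl, rfl⟩ : a = 0 ∧ r = 0 := by omega
    exact h0 b
  | succ n ih =>
    intro a b r h
    by_cases hlt : a < N ∧ b < N ∧ r < N
    · rcases a with _ | a
      · rcases r with _ | r
        · omega
        · exact (hstep 0 b r hlt.1 hlt.2.1 (by omega) (ih _ _ _ (by omega)) (ih _ _ _ (by omega))).2
      · exact (hstep a b r (by omega) hlt.2.1 hlt.2.2 (ih _ _ _ (by omega)) (ih _ _ _ (by omega))).1
    · exact hout a b r hlt

section Extension
variable {N : ℕ}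

/-- Extension by zero of a function on three-site states. -/
def extendStates {M : Type*} [Zero M] (f : Fin N × Fin N × Fin N → M) (a b r : ℕ) : M :=
  if h : a < N ∧ b < N ∧ r < N then f (⟨a, h.1⟩, ⟨b, h.2.1⟩, ⟨r, h.2.2⟩) else 0

theorem extendStates_fin {M : Type*} [Zero M] (f : Fin N × Fin N × Fin N → M) (a b r : Fin N) :
    extendStates f a b r = f (a, b, r) := by
  rw [extendStates, dif_pos ⟨a.2, b.2, r.2⟩]

theorem extendStates_out {M : Type*} [Zero M] (f : Fin N × Fin N × Fin N → M) (a b r : ℕ)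
    (h : ¬ (a < N ∧ b < N ∧ r < N)) : extendStates f a b r = 0 := dif_neg h

variable (f : Fin N × Fin N × Fin N → ℂ) (a b r : Fin N)

theorem sum_shiftMat_extend_fst :
    ∑ j, shiftMat N a j * f (j, b, r) = extendStates f (a + 1) b r := by
  rw [← sum_shiftMat_mul (g := fun j => extendStates f j b r) (extendStates_out _ _ _ _ (by omega))]
  simp only [extendStates_fin]

theorem sum_shiftMat_extend_snd :
    ∑ j, shiftMat N b j * f (a, j, r) = extendStates f a (b + 1) r := by
  rw [← sum_shiftMat_mul (g := fun j => extendStates f a j r) (extendStates_out _ _ _ _ (by omega))]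
  simp only [extendStates_fin]

theorem sum_shiftMat_extend_thd :
    ∑ j, shiftMat N r j * f (a, b, j) = extendStates f a b (r + 1) := by
  rw [← sum_shiftMat_mul (g := fun j => extendStates f a b j) (extendStates_out _ _ _ _ (by omega))]
  simp only [extendStates_fin]

variable (ρ c : ℂ)

theorem sum_lowerMat_extend_fst :
    ∑ j, f (j, b, r) * lowerMat N ρ c j a =
      lowerCoeff ρ c (a + 1) * extendStates f (a + 1) b r := by
  rw [← sum_mul_lowerMat (g := fun j => extendStates f j b r) _ _ (extendStates_out _ _ _ _ (by
    omega))]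
  simp only [extendStates_fin]

theorem sum_lowerMat_extend_snd :
    ∑ j, f (a, j, r) * lowerMat N ρ c j b =
      lowerCoeff ρ c (b + 1) * extendStates f a (b + 1) r := by
  rw [← sum_mul_lowerMat (g := fun j => extendStates f a j r) _ _ (extendStates_out _ _ _ _ (by
    omega))]
  simp only [extendStates_fin]

theorem sum_lowerMat_extend_thd :
    ∑ j, f (a, b, j) * lowerMat N ρ c j r =
      lowerCoeff ρ c (r + 1) * extendStates f a b (r + 1) := by
  rw [← sum_mul_lowerMat (g := fun j => extendStates f a b j) _ _ (extendStates_out _ _ _ _ (by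
    omega))]
  simp only [extendStates_fin]

end Extension

section YangBaxter
variable {N : ℕ} {ρ : ℂ}

/-- Splitting x as z / w attaches one spectral parameter to each line. Only then do the three pairs
of lines use the same one-site operators, as `ybDefect_intertwine_op` requires. Lowering operators
scale with the inverse parameter. -/
theorem vertexMat_raise_zero_smul (hN : N = 2 ∨ N = 3 ∨ N = 4) (hρ : IsPrimitiveRoot ρ N)
    (α β : ℂ) {z w : ℂ} (hw : w ≠ 0) :
    ((z • shiftMat N) ⊗ₖ chargeMat N ρ β + 1 ⊗ₖ (w • shiftMat N)) * vertexMat N ρ α β (z / w) =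
      vertexMat N ρ α β (z / w) *
        (chargeMat N ρ α ⊗ₖ (w • shiftMat N) + (z • shiftMat N) ⊗ₖ 1) := by
  have e₁ : (z • shiftMat N) ⊗ₖ chargeMat N ρ β + 1 ⊗ₖ (w • shiftMat N) =
      w • ((z / w) • shiftMat N ⊗ₖ chargeMat N ρ β + 1 ⊗ₖ shiftMat N) := by
    simp only [Matrix.smul_kronecker, Matrix.kronecker_smul, smul_add, smul_smul,
      mul_div_cancel₀ _ hw]
  have e₂ : chargeMat N ρ α ⊗ₖ (w • shiftMat N) + (z • shiftMat N) ⊗ₖ 1 =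
      w • (chargeMat N ρ α ⊗ₖ shiftMat N + (z / w) • shiftMat N ⊗ₖ 1) := by
    simp only [Matrix.smul_kronecker, Matrix.kronecker_smul, smul_add, smul_smul,
      mul_div_cancel₀ _ hw]
  rw [e₁, e₂, Matrix.smul_mul, Matrix.mul_smul, vertexMat_raise_zero hN hρ]

theorem vertexMat_lower_zero_smul (hN : N = 2 ∨ N = 3 ∨ N = 4) (hρ : IsPrimitiveRoot ρ N)
    (α β : ℂ) {z w : ℂ} (hz : z ≠ 0) :
    ((z⁻¹ • lowerMat N ρ α) ⊗ₖ chargeMat N ρ β + 1 ⊗ₖ (w⁻¹ • lowerMat N ρ β)) *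
        vertexMat N ρ α β (z / w) =
      vertexMat N ρ α β (z / w) *
        (chargeMat N ρ α ⊗ₖ (w⁻¹ • lowerMat N ρ β) + (z⁻¹ • lowerMat N ρ α) ⊗ₖ 1) := by
  have hzw : z⁻¹ * (z / w) = w⁻¹ := by field_simp
  have e₁ : (z⁻¹ • lowerMat N ρ α) ⊗ₖ chargeMat N ρ β + 1 ⊗ₖ (w⁻¹ • lowerMat N ρ β) =
      z⁻¹ • (lowerMat N ρ α ⊗ₖ chargeMat N ρ β + (z / w) • 1 ⊗ₖ lowerMat N ρ β) := by
    simp only [Matrix.smul_kronecker, Matrix.kronecker_smul, smul_add, smul_smul, hzw]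
  have e₂ : chargeMat N ρ α ⊗ₖ (w⁻¹ • lowerMat N ρ β) + (z⁻¹ • lowerMat N ρ α) ⊗ₖ 1 =
      z⁻¹ • ((z / w) • chargeMat N ρ α ⊗ₖ lowerMat N ρ β + lowerMat N ρ α ⊗ₖ 1) := by
    simp only [Matrix.smul_kronecker, Matrix.kronecker_smul, smul_add, smul_smul, hzw]
  rw [e₁, e₂, Matrix.smul_mul, Matrix.mul_smul, vertexMat_lower_zero hN hρ]

theorem qInt_ne_zero (hρ : IsPrimitiveRoot ρ N) {k : ℕ} (hk : 0 < k) (hkN : k < N) :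
    qInt ρ k ≠ 0 := by
  intro h
  have h1 := geom_sum_mul ρ k
  rw [← qInt, h, zero_mul] at h1
  exact absurd (Nat.le_of_dvd hk ((hρ.pow_eq_one_iff_dvd k).1 (by linear_combination -h1))) (by
    omega)

/-- For b = c the ice rule fixes two of the three internal states and `symWeight_corner_exchange`
remains. For b ≠ c every term violates the ice rule at some vertex. -/
theorem ybDefect_middle (hN : N = 2 ∨ N = 3 ∨ N = 4) (hρ : IsPrimitiveRoot ρ N)
    (α₁ α₂ β x y : ℂ) (z b c : Fin N) (hz : (z : ℕ) = 0) :
    ybDefect (vertexMat N ρ α₁ α₂ x) (vertexMat N ρ α₁ β (x * y)) (vertexMat N ρ α₂ β y)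
      (z, b, z) (z, c, z) = 0 := by
  rw [ybDefect, Matrix.sub_apply, pairEmbed_123_apply, pairEmbed_321_apply, sub_eq_zero]
  simp only [vertexMat, Matrix.of_apply, hz]
  by_cases hbc : b = c
  · subst hbc
    have h1 : ∀ p : Fin N, (∑ q : Fin N, ∑ m : Fin N, symWeight N ρ α₁ α₂ x 0 b q p *
        symWeight N ρ α₁ β (x * y) p 0 m 0 * symWeight N ρ α₂ β y q m 0 b) =
        if (p : ℕ) ∈ Finset.range (b + 1) then symWeight N ρ α₁ α₂ x 0 b (b - p) p *
        symWeight N ρ α₁ β (x * y) p 0 p 0 * symWeight N ρ α₂ β y (b - p) p 0 b else 0 := by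
      intro p
      split_ifs with hp
      · rw [Finset.mem_range] at hp
        rw [Finset.sum_eq_single (⟨b - p, by omega⟩ : Fin N), Finset.sum_eq_single p]
        · intro m _ hm
          rw [symWeight_eq_zero (t := p) (l := m)]
          · ring
          · intro h; exact hm (Fin.ext (by omega))
        · simp
        · intro q _ hq
          refine Finset.sum_eq_zero fun m _ => ?_
          rw [symWeight_eq_zero (t := 0)]
          · ring
          · intro h; exact hq (Fin.ext (by simp only; omega))
        · simp
      · rw [Finset.mem_range] at hp
        refine Finset.sum_eq_zero fun q _ => Finset.sum_eq_zero fun m _ => ?_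
        rw [symWeight_eq_zero (t := 0) (by omega)]; ring
    have h2 : ∀ p : Fin N, (∑ q : Fin N, ∑ m : Fin N, symWeight N ρ α₂ β y b 0 m q *
        symWeight N ρ α₁ β (x * y) 0 m 0 p * symWeight N ρ α₁ α₂ x p q b 0) =
        if (p : ℕ) ∈ Finset.range (b + 1) then symWeight N ρ α₂ β y b 0 p (b - p) *
        symWeight N ρ α₁ β (x * y) 0 p 0 p * symWeight N ρ α₁ α₂ x p (b - p) b 0 else 0 := by
      intro p
      split_ifs with hp
      · rw [Finset.mem_range] at hp
        rw [Finset.sum_eq_single (⟨b - p, by omega⟩ : Fin N), Finset.sum_eq_single p]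
        · intro m _ hm
          rw [symWeight_eq_zero (t := 0) (r := m)]
          · ring
          · intro h; exact hm (Fin.ext (by omega))
        · simp
        · intro q _ hq
          refine Finset.sum_eq_zero fun m _ => ?_
          rw [symWeight_eq_zero (t := p)]
          · ring
          · intro h; exact hq (Fin.ext (by simp only; omega))
        · simp
      · rw [Finset.mem_range] at hp
        refine Finset.sum_eq_zero fun q _ => Finset.sum_eq_zero fun m _ => ?_
        rw [symWeight_eq_zero (t := p) (by omega)]; ring
    have h3 : ∀ g : ℕ → ℂ, (∑ p : Fin N, if (p : ℕ) ∈ Finset.range (b + 1) then g p else 0) =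
        ∑ p ∈ Finset.range (b + 1), g p := by
      intro g
      rw [Fin.sum_univ_eq_sum_range (fun p => if p ∈ Finset.range (b + 1) then g p else 0) N,
        ← Finset.sum_filter]
      refine Finset.sum_congr ?_ fun _ _ => rfl
      ext p; simp only [Finset.mem_filter, Finset.mem_range]; omega
    simp only [h1, h2]
    rw [h3 fun p => symWeight N ρ α₁ α₂ x 0 b (b - p) p *
        symWeight N ρ α₁ β (x * y) p 0 p 0 * symWeight N ρ α₂ β y (b - p) p 0 b,
      h3 fun p => symWeight N ρ α₂ β y b 0 p (b - p) *
        symWeight N ρ α₁ β (x * y) 0 p 0 p * symWeight N ρ α₁ α₂ x p (b - p) b 0]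
    exact symWeight_corner_exchange hN hρ α₁ α₂ β x y b.2
  · have hbc' : (b : ℕ) ≠ c := fun h => hbc (Fin.ext h)
    trans (0 : ℂ)
    · refine Finset.sum_eq_zero fun p _ => Finset.sum_eq_zero fun q _ =>
        Finset.sum_eq_zero fun m _ => ?_
      by_cases h1 : (b : ℕ) = q + p
      · by_cases h2 : (p : ℕ) = m
        · rw [symWeight_eq_zero (t := q) (by omega)]; ring
        · rw [symWeight_eq_zero (t := p) (by omega)]; ring
      · rw [symWeight_eq_zero (t := 0) (by omega)]; ring
    · symm
      refine Finset.sum_eq_zero fun p _ => Finset.sum_eq_zero fun q _ =>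
        Finset.sum_eq_zero fun m _ => ?_
      by_cases h1 : (b : ℕ) = m + q
      · by_cases h2 : (p : ℕ) = m
        · rw [symWeight_eq_zero (t := p) (by omega)]; ring
        · rw [symWeight_eq_zero (t := 0) (by omega)]; ring
      · rw [symWeight_eq_zero (t := b) (by omega)]; ring

end YangBaxter
end

/-! ### The Yang-Baxter equation for generic parameters. -/

section
open scoped Kronecker

section YangBaxter
variable {N : ℕ} {ρ : ℂ}

theorem smul_matrix_row_sum (z : ℂ) (A : Matrix (Fin N) (Fin N) ℂ) (g : Fin N → ℂ) (i : Fin N) :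
    ∑ j, (z • A) i j * g j = z * ∑ j, A i j * g j := by
  simp only [Matrix.smul_apply, smul_eq_mul, Finset.mul_sum, mul_assoc]

theorem smul_matrix_col_sum (z : ℂ) (A : Matrix (Fin N) (Fin N) ℂ) (g : Fin N → ℂ) (j : Fin N) :
    ∑ i, g i * (z • A) i j = z * ∑ i, g i * A i j := by
  simp only [Matrix.smul_apply, smul_eq_mul, Finset.mul_sum]
  exact Finset.sum_congr rfl fun i _ => by ring

theorem sum_mul_lowerMat_row_zero (a : ℂ) (g : Fin N → ℂ) {i : Fin N} (hi : (i : ℕ) = 0) :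
    ∑ j, lowerMat N ρ a i j * g j = 0 :=
  Finset.sum_eq_zero fun j _ => by
    rw [lowerMat, Matrix.of_apply, if_neg (by omega), zero_mul]

theorem lowerCoeff_ne_zero (hρ : IsPrimitiveRoot ρ N) {a : ℂ}
    (ha : ∀ k, k + 1 < N → 1 - ρ ^ k * a ^ 2 ≠ 0) {k : ℕ} (hk : k + 1 < N) :
    lowerCoeff ρ a (k + 1) ≠ 0 :=
  mul_ne_zero (qInt_ne_zero hρ (Nat.succ_pos k) hk) (ha k hk)

theorem extendStates_apply {O : Type*} (f : Fin N × Fin N × Fin N → O → ℂ) (a b r : ℕ) (o : O) :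
    extendStates f a b r o = extendStates (fun i => f i o) a b r := by
  simp only [extendStates]
  split_ifs <;> rfl

theorem mul_row_eq_zero {ι : Type*} [Fintype ι] {D : Matrix ι ι ℂ} {i : ι} (h : ∀ o, D i o = 0)
    (G : Matrix ι ι ℂ) (o : ι) : (D * G) i o = 0 := by
  rw [Matrix.mul_apply]
  exact Finset.sum_eq_zero fun j _ => by rw [h, zero_mul]

/-- The defect D is eliminated in two stages. Lowering operators show that the rows with outer
states 0 vanish, starting from their entries in `ybDefect_middle`; raising operators then reach all
rows. At each step two intertwining relations form a 2 × 2 linear system for two unknown entries or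
rows, and `hdet` says that its determinant is nonzero. The conditions `hα` and `hβ` keep the
lowering coefficients of the outer lines from vanishing; nothing is divided by those of the middle
line. -/
theorem vertexMat_yangBaxter (hN : N = 2 ∨ N = 3 ∨ N = 4) (hρ : IsPrimitiveRoot ρ N)
    {α₁ α₂ β z₁ z₂ z₃ : ℂ} (h₁ : z₁ ≠ 0) (h₂ : z₂ ≠ 0) (h₃ : z₃ ≠ 0)
    (hα : ∀ k, k + 1 < N → 1 - ρ ^ k * α₁ ^ 2 ≠ 0) (hβ : ∀ k, k + 1 < N → 1 - ρ ^ k * β ^ 2 ≠ 0)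
    (hdet : ∀ s : ℕ, z₃ - ρ ^ s * (α₁ * α₂ ^ 2 * β) * z₁ ≠ 0) :
    ybDefect (vertexMat N ρ α₁ α₂ (z₁ / z₂)) (vertexMat N ρ α₁ β (z₁ / z₃))
      (vertexMat N ρ α₂ β (z₂ / z₃)) = 0 := by
  set D := ybDefect (vertexMat N ρ α₁ α₂ (z₁ / z₂)) (vertexMat N ρ α₁ β (z₁ / z₃))
      (vertexMat N ρ α₂ β (z₂ / z₃)) with hD
  have hf₁ := ybDefect_intertwine (vertexMat_raise_one hN hρ α₁ α₂ (z₁ / z₂))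
    (vertexMat_raise_one hN hρ α₁ β (z₁ / z₃)) (vertexMat_raise_one hN hρ α₂ β (z₂ / z₃))
    (vertexMat_charge _ _ _ _ _ _) (vertexMat_charge _ _ _ _ _ _) (vertexMat_charge _ _ _ _ _ _)
  have hf₀ := ybDefect_intertwine_op (vertexMat_raise_zero_smul hN hρ α₁ α₂ h₂ (z := z₁))
    (vertexMat_raise_zero_smul hN hρ α₁ β h₃ (z := z₁))
    (vertexMat_raise_zero_smul hN hρ α₂ β h₃ (z := z₂))
    (vertexMat_charge _ _ _ _ _ _) (vertexMat_charge _ _ _ _ _ _) (vertexMat_charge _ _ _ _ _ _)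
  have he₁ := ybDefect_intertwine (vertexMat_lower_one hN hρ α₁ α₂ (z₁ / z₂))
    (vertexMat_lower_one hN hρ α₁ β (z₁ / z₃)) (vertexMat_lower_one hN hρ α₂ β (z₂ / z₃))
    (vertexMat_charge _ _ _ _ _ _) (vertexMat_charge _ _ _ _ _ _) (vertexMat_charge _ _ _ _ _ _)
  have he₀ := ybDefect_intertwine_op (vertexMat_lower_zero_smul hN hρ α₁ α₂ h₁ (w := z₂))
    (vertexMat_lower_zero_smul hN hρ α₁ β h₁ (w := z₃))
    (vertexMat_lower_zero_smul hN hρ α₂ β h₂ (w := z₃))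
    (vertexMat_charge _ _ _ _ _ _) (vertexMat_charge _ _ _ _ _ _) (vertexMat_charge _ _ _ _ _ _)
  rw [← hD] at hf₁ hf₀ he₁ he₀
  have hmid : ∀ z b : Fin N, (z : ℕ) = 0 → ∀ c, D (z, b, z) (z, c, z) = 0 := by
    intro z b hz c
    have := ybDefect_middle hN hρ α₁ α₂ β (z₁ / z₂) (z₂ / z₃) z b c hz
    rwa [show z₁ / z₂ * (z₂ / z₃) = z₁ / z₃ by field_simp] at this
  -- Lowering kills the outer sites, which are in state 0, and sends the middle site to a smaller
  -- state, where the row is zero by induction. Hence this row of D is annihilated from the right by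
  -- both three-site lowering operators.
  have hrow : ∀ b : ℕ, ∀ z b' : Fin N, (z : ℕ) = 0 → (b' : ℕ) = b → ∀ o, D (z, b', z) o = 0 := by
    intro b
    induction b using Nat.strong_induction_on with
    | _ b ih =>
    intro z b' hz hb
    have hlow : ∀ o, ∑ j, lowerMat N ρ α₂ b' j * D (z, j, z) o = 0 := fun o =>
      Finset.sum_eq_zero fun j _ => by
        rw [lowerMat, Matrix.of_apply]
        split_ifs with h
        · rw [ih j (by omega) z j hz rfl, mul_zero]
        · rw [zero_mul]
    have hg₁ : ∀ o, ((tri (lowerMat N ρ α₁) 1 1 + tri (chargeMat N ρ α₁) (lowerMat N ρ α₂) 1 +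
        tri (chargeMat N ρ α₁) (chargeMat N ρ α₂) (lowerMat N ρ β)) * D) (z, b', z) o = 0 := by
      intro o
      simp only [add_mul, Matrix.add_apply, tri_mul_apply, sum_one_mul, sum_chargeMat_mul,
        sum_mul_lowerMat_row_zero _ _ hz, hlow, mul_zero, add_zero, Finset.sum_const_zero]
    have hg₀ : ∀ o, ((tri (z₁⁻¹ • lowerMat N ρ α₁) (chargeMat N ρ α₂) (chargeMat N ρ β) +
        tri 1 (z₂⁻¹ • lowerMat N ρ α₂) (chargeMat N ρ β) +
        tri 1 1 (z₃⁻¹ • lowerMat N ρ β)) * D) (z, b', z) o = 0 := by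
      intro o
      simp only [add_mul, Matrix.add_apply, tri_mul_apply, sum_one_mul, sum_chargeMat_mul,
        smul_matrix_row_sum, sum_mul_lowerMat_row_zero _ _ hz, mul_zero, add_zero, zero_add,
        Finset.sum_const_zero]
      have : ∀ j, lowerMat N ρ α₂ b' j * (β * ρ ^ (z : ℕ) * D (z, j, z) o) =
          β * ρ ^ (z : ℕ) * (lowerMat N ρ α₂ b' j * D (z, j, z) o) := fun j => by ring
      simp only [this, ← Finset.mul_sum, hlow, mul_zero]
    rw [he₁] at hg₁
    rw [he₀] at hg₀
    suffices h : ∀ d c l, extendStates (fun o => D (z, b', z) o) d c l = 0 by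
      rintro ⟨d, c, l⟩
      rw [← h d c l, extendStates_fin]
    refine three_site_elimination (N := N) (extendStates_out _) (fun c => ?_) fun d c l hd hc hl h0
      h1 => ?_
    · by_cases hc : c < N
      · have := extendStates_fin (fun o => D (z, b', z) o) z ⟨c, hc⟩ z
        rw [hz] at this
        rw [this, hmid z b' hz]
      · exact extendStates_out _ _ _ _ (by omega)
    · have e₁ := hg₁ (⟨d, hd⟩, ⟨c, hc⟩, ⟨l, hl⟩)
      have e₀ := hg₀ (⟨d, hd⟩, ⟨c, hc⟩, ⟨l, hl⟩)
      have l₁ := sum_lowerMat_extend_fst (fun o => D (z, b', z) o) ⟨d, hd⟩ ⟨c, hc⟩ ⟨l, hl⟩ ρ α₁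
      have l₂ := sum_lowerMat_extend_snd (fun o => D (z, b', z) o) ⟨d, hd⟩ ⟨c, hc⟩ ⟨l, hl⟩ ρ α₂
      have l₃ := sum_lowerMat_extend_thd (fun o => D (z, b', z) o) ⟨d, hd⟩ ⟨c, hc⟩ ⟨l, hl⟩ ρ β
      simp only at l₁ l₂ l₃
      simp only [mul_add, Matrix.add_apply, mul_tri_apply, sum_mul_one, sum_mul_chargeMat,
        smul_matrix_col_sum, mul_assoc, ← Finset.mul_sum, l₁, l₂, l₃] at e₁ e₀
      simp only [h1, mul_zero, add_zero] at e₁ e₀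
      set P := lowerCoeff ρ α₁ (d + 1) * extendStates (fun o => D (z, b', z) o) (d + 1) c l with hP
      set Q := lowerCoeff ρ β (l + 1) * extendStates (fun o => D (z, b', z) o) d c (l + 1) with hQ
      have hP0 : P = 0 := by
        have := hdet (d + c + (l + c))
        field_simp at e₀
        -- Cramer's rule: Q is eliminated between the two relations, the term raising the middle
        -- index being zero already. The middle charge occurs in both, hence α₂ ^ 2 and c twice.
        have key : (z₃ - ρ ^ (d + c + (l + c)) * (α₁ * α₂ ^ 2 * β) * z₁) * P = 0 := by
          linear_combination e₀ - z₁ * α₁ * ρ ^ d * α₂ * ρ ^ c * e₁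
        exact (mul_eq_zero.1 key).resolve_left this
      have hQ0 : Q = 0 := by
        rw [hP0] at e₁
        linear_combination e₁
      constructor
      · by_cases hd' : d + 1 < N
        · exact (mul_eq_zero.1 hP0).resolve_left (lowerCoeff_ne_zero hρ hα hd')
        · exact extendStates_out _ _ _ _ (by omega)
      · by_cases hl' : l + 1 < N
        · exact (mul_eq_zero.1 hQ0).resolve_left (lowerCoeff_ne_zero hρ hβ hl')
        · exact extendStates_out _ _ _ _ (by omega)
  let rows : Fin N × Fin N × Fin N → Fin N × Fin N × Fin N → ℂ := fun i o => D i o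
  -- The same elimination runs on whole rows with the raising operators. Their coefficients are 1 in
  -- this gauge, so the determinant is the only thing to divide by.
  have hall : ∀ a b r, extendStates rows a b r = 0 := by
    refine fun a b r => three_site_elimination (N := N) (extendStates_out _) (fun b => ?_)
      (fun a b r ha hb hr h0 h1 => ?_) a b r
    · by_cases hb : b < N
      · have := extendStates_fin rows (⟨0, by omega⟩ : Fin N) ⟨b, hb⟩ ⟨0, by omega⟩
        simp only at this
        rw [this]
        exact funext fun o => hrow b _ _ rfl rfl o
      · exact extendStates_out _ _ _ _ (by omega)
    · have h0' : ∀ o, D (⟨a, ha⟩, ⟨b, hb⟩, ⟨r, hr⟩) o = 0 := by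
        intro o
        have := congrFun (extendStates_fin rows ⟨a, ha⟩ ⟨b, hb⟩ ⟨r, hr⟩) o
        simp only [h0] at this
        exact this.symm
      suffices h : ∀ o, extendStates rows (a + 1) b r o = 0 ∧ extendStates rows a b (r + 1) o = 0
        from
        ⟨funext fun o => (h o).1, funext fun o => (h o).2⟩
      intro o
      have hb1 := congrFun h1 o
      rw [extendStates_apply, Pi.zero_apply] at hb1
      rw [extendStates_apply, extendStates_apply]
      have e₁ := congrFun (congrFun hf₁ (⟨a, ha⟩, ⟨b, hb⟩, ⟨r, hr⟩)) o
      have e₀ := congrFun (congrFun hf₀ (⟨a, ha⟩, ⟨b, hb⟩, ⟨r, hr⟩)) o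
      rw [mul_row_eq_zero h0'] at e₁ e₀
      have l₁ := sum_shiftMat_extend_fst (fun i => D i o) ⟨a, ha⟩ ⟨b, hb⟩ ⟨r, hr⟩
      have l₂ := sum_shiftMat_extend_snd (fun i => D i o) ⟨a, ha⟩ ⟨b, hb⟩ ⟨r, hr⟩
      have l₃ := sum_shiftMat_extend_thd (fun i => D i o) ⟨a, ha⟩ ⟨b, hb⟩ ⟨r, hr⟩
      simp only at l₁ l₂ l₃
      have pull : ∀ (v : Fin N → ℂ) (k : ℂ) (g : Fin N → ℂ),
          ∑ j, v j * (k * g j) = k * ∑ j, v j * g j := fun v k g => by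
        rw [Finset.mul_sum]; exact Finset.sum_congr rfl fun j _ => by ring
      simp only [add_mul, Matrix.add_apply, tri_mul_apply, sum_one_mul, sum_chargeMat_mul,
        smul_matrix_row_sum, pull, l₁, l₂, l₃] at e₁ e₀
      simp only [rows, hb1] at e₁ e₀ ⊢
      set P := extendStates (fun i => D i o) (a + 1) b r
      set Q := extendStates (fun i => D i o) a b (r + 1)
      have hQ0 : Q = 0 := by
        have key : (z₃ - ρ ^ (a + b + (b + r)) * (α₁ * α₂ ^ 2 * β) * z₁) * Q = 0 := by
          linear_combination e₀ - z₁ * α₂ * ρ ^ b * β * ρ ^ r * e₁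
        exact (mul_eq_zero.1 key).resolve_left (hdet _)
      refine ⟨?_, hQ0⟩
      rw [hQ0] at e₁
      linear_combination e₁
  ext ⟨a, b, r⟩ o
  have := congrFun (extendStates_fin rows a b r) o
  rw [hall] at this
  exact this.symm

end YangBaxter
end

/-! ### Exchange relation for vertical lines. -/

section
open scoped Kronecker

section ListProducts

theorem prod_ofFn_sum_kronecker {R S K : Type*} [CommRing R] [Fintype S] [DecidableEq S] [Fintype K]
    {n : ℕ} (A B : Fin n → K → Matrix S S R) :
    (List.ofFn fun j => ∑ s, A j s ⊗ₖ B j s).prod =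
      ∑ m : Fin n → K, (List.ofFn fun j => A j (m j)).prod ⊗ₖ (List.ofFn fun j => B j (m j)).prod
        := by
  induction n with
  | zero => simp
  | succ n ih =>
    rw [List.ofFn_succ, List.prod_cons, ih, ← (Fin.consEquiv fun _ => K).sum_comp,
      Fintype.sum_prod_type, Finset.sum_mul_sum]
    refine Finset.sum_congr rfl fun s _ => Finset.sum_congr rfl fun m _ => ?_
    rw [← Matrix.mul_kronecker_mul]
    simp [Fin.consEquiv, List.ofFn_succ]

theorem mul_prod_ofFn_comm {A : Type*} [Monoid A] {n : ℕ} {R : A} {f g : Fin n → A}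
    (h : ∀ i, R * f i = g i * R) : R * (List.ofFn f).prod = (List.ofFn g).prod * R := by
  induction n with
  | zero => simp
  | succ n ih =>
    rw [List.ofFn_succ, List.ofFn_succ, List.prod_cons, List.prod_cons, ← mul_assoc, h, mul_assoc,
      ih fun i => h i.succ, mul_assoc]

theorem smul_mul_prod_ofFn {R A : Type*} [CommRing R] [Ring A] [Algebra R A] {n : ℕ} {T₀ : A}
    {T : Fin n → A} {c d : Fin n → R} (h : ∀ j, c j • (T j * T₀) = d j • (T₀ * T j)) :
    (∏ j, d j) • (T₀ * (List.ofFn T).prod) = (∏ j, c j) • ((List.ofFn T).prod * T₀) := by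
  induction n with
  | zero => simp
  | succ n ih =>
    rw [List.ofFn_succ, List.prod_cons, Fin.prod_univ_succ, Fin.prod_univ_succ, ← mul_assoc,
      mul_comm (d 0), mul_smul, ← smul_mul_assoc (d 0), ← h 0, smul_mul_assoc, smul_comm, mul_assoc,
      ← mul_smul_comm, ih fun j => h j.succ, mul_smul_comm, mul_smul, mul_assoc]

end ListProducts

section Columns
variable {R : Type*} [CommRing R] {M n : ℕ}

/-- The weights of a vertex with given left and right states, as a matrix from top to bottom. -/
def siteMat (M : ℕ) (ρ α β z : R) (l r : Fin (M + 1)) : Matrix (Fin (M + 1)) (Fin (M + 1)) R :=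
  Matrix.of fun t b => symWeight (M + 1) ρ α β z t r l b

/-- The transfer matrix of a vertical line with lowest state on top and highest state at the
bottom, crossing `n` horizontal lines. -/
def columnMat (M : ℕ) (ρ α : R) (β z : Fin n → R) :
    Matrix (Fin n → Fin (M + 1)) (Fin n → Fin (M + 1)) R :=
  Matrix.of fun l r =>
    (List.ofFn fun j => siteMat M ρ α (β j) (z j) (l j) (r j)).prod 0 (Fin.last M)

end Columns

section Exchange
variable {M n : ℕ} {ρ : ℂ}

theorem vertexMat_zero_row (α β x : ℂ) (i : Fin (M + 1) × Fin (M + 1)) (hi : i ≠ (0, 0)) :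
    vertexMat (M + 1) ρ α β x (0, 0) i = 0 := by
  rw [vertexMat, Matrix.of_apply]
  refine symWeight_eq_zero fun h => hi ?_
  simp only [Fin.val_zero] at h
  exact Prod.ext (Fin.ext (show (i.1 : ℕ) = 0 by omega)) (Fin.ext (show (i.2 : ℕ) = 0 by omega))

theorem vertexMat_last_col (α β x : ℂ) (i : Fin (M + 1) × Fin (M + 1))
    (hi : i ≠ (Fin.last M, Fin.last M)) :
    vertexMat (M + 1) ρ α β x i (Fin.last M, Fin.last M) = 0 := by
  rw [vertexMat, Matrix.of_apply]
  refine symWeight_eq_zero fun h => hi (Prod.ext (Fin.ext ?_) (Fin.ext ?_)) <;> simp at h ⊢ <;>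
    omega

/-- This is the Yang-Baxter equation read as a relation on two vertical lines crossing one
horizontal line whose end states are fixed. On the left side the line with α₂ stands to the left of
the one with α₁. -/
theorem vertexMat_site_exchange (hN : M + 1 = 2 ∨ M + 1 = 3 ∨ M + 1 = 4)
    (hρ : IsPrimitiveRoot ρ (M + 1))
    {α₁ α₂ β z₁ z₂ z₃ : ℂ} (h₁ : z₁ ≠ 0) (h₂ : z₂ ≠ 0) (h₃ : z₃ ≠ 0)
    (hα : ∀ k, k + 1 < M + 1 → 1 - ρ ^ k * α₁ ^ 2 ≠ 0)
    (hβ : ∀ k, k + 1 < M + 1 → 1 - ρ ^ k * β ^ 2 ≠ 0)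
    (hdet : ∀ s : ℕ, z₃ - ρ ^ s * (α₁ * α₂ ^ 2 * β) * z₁ ≠ 0) (l r : Fin (M + 1)) :
    vertexMat (M + 1) ρ α₁ α₂ (z₁ / z₂) *
        ∑ m, siteMat M ρ α₁ β (z₁ / z₃) m r ⊗ₖ siteMat M ρ α₂ β (z₂ / z₃) l m =
      (∑ m, siteMat M ρ α₁ β (z₁ / z₃) l m ⊗ₖ siteMat M ρ α₂ β (z₂ / z₃) m r) *
        vertexMat (M + 1) ρ α₁ α₂ (z₁ / z₂) := by
  ext ⟨a, b⟩ ⟨a', b'⟩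
  have h := congrFun (congrFun (vertexMat_yangBaxter hN hρ h₁ h₂ h₃ hα hβ hdet) (a, b, r)) (a',
    b', l)
  rw [ybDefect, Matrix.sub_apply, pairEmbed_123_apply, pairEmbed_321_apply] at h
  have h := sub_eq_zero.1 h
  simp only [Matrix.mul_apply, Fintype.sum_prod_type, Matrix.sum_apply, Matrix.kroneckerMap_apply,
    Finset.mul_sum, Finset.sum_mul, siteMat, Matrix.of_apply]
  simp only [vertexMat, Matrix.of_apply] at h ⊢
  refine Eq.trans ?_ (h.trans ?_)
  · exact Finset.sum_congr rfl fun p _ => Finset.sum_congr rfl fun q _ =>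
      Finset.sum_congr rfl fun m _ => by ring
  · exact Finset.sum_congr rfl fun p _ => Finset.sum_congr rfl fun q _ =>
      Finset.sum_congr rfl fun m _ => by ring

theorem columnMat_exchange (hN : M + 1 = 2 ∨ M + 1 = 3 ∨ M + 1 = 4)
    (hρ : IsPrimitiveRoot ρ (M + 1)) {α₁ α₂ z₁ z₂ : ℂ} {β y : Fin n → ℂ}
    (h₁ : z₁ ≠ 0) (h₂ : z₂ ≠ 0) (hy : ∀ j, y j ≠ 0)
    (hα : ∀ k, k + 1 < M + 1 → 1 - ρ ^ k * α₁ ^ 2 ≠ 0)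
    (hβ : ∀ j k, k + 1 < M + 1 → 1 - ρ ^ k * β j ^ 2 ≠ 0)
    (hdet : ∀ j, ∀ s : ℕ, y j - ρ ^ s * (α₁ * α₂ ^ 2 * β j) * z₁ ≠ 0) :
    symWeight (M + 1) ρ α₁ α₂ (z₁ / z₂) 0 0 0 0 •
        (columnMat M ρ α₂ β (fun j => z₂ / y j) * columnMat M ρ α₁ β (fun j => z₁ / y j)) =
      symWeight (M + 1) ρ α₁ α₂ (z₁ / z₂) M M M M •
        (columnMat M ρ α₁ β (fun j => z₁ / y j) * columnMat M ρ α₂ β (fun j => z₂ / y j)) := by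
  ext l r
  have h := mul_prod_ofFn_comm fun j => vertexMat_site_exchange hN hρ h₁ h₂ (hy j) hα (hβ j)
    (hdet j) (l j) (r j)
  rw [prod_ofFn_sum_kronecker, prod_ofFn_sum_kronecker] at h
  have h := congrFun (congrFun h (0, 0)) (Fin.last M, Fin.last M)
  rw [Matrix.mul_apply, Finset.sum_eq_single (0, 0)
      (fun i _ hi => by rw [vertexMat_zero_row _ _ _ i hi, zero_mul]) (by simp),
    Matrix.mul_apply, Finset.sum_eq_single (Fin.last M, Fin.last M)
      (fun i _ hi => by rw [vertexMat_last_col _ _ _ i hi, mul_zero]) (by simp),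
    Matrix.sum_apply, Matrix.sum_apply] at h
  simp only [Matrix.kroneckerMap_apply] at h
  simp only [Matrix.smul_apply, Matrix.mul_apply, smul_eq_mul, columnMat, Matrix.of_apply]
  simp only [vertexMat, Matrix.of_apply, Fin.val_zero, Fin.val_last] at h
  rw [mul_comm] at h ⊢
  rw [Finset.sum_congr rfl fun m _ => mul_comm _ _, h, mul_comm]

end Exchange
end

/-! ### Closed forms of special weights, and degree bounds. -/

section
set_option linter.unusedSimpArgs false

section ClosedForms
variable {R : Type*} [CommRing R]

/-- All vertices of the first column have left state 0, and for them the weights factor completely.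
The factorization gives the power of z, the degree M and the zeros that freeze the corner. It is
stated over any commutative ring so that z can be a polynomial. -/
theorem symWeight_left_zero {M : ℕ} (hN : M + 1 = 2 ∨ M + 1 = 3 ∨ M + 1 = 4) (ρ α β z : R)
    {t r : ℕ} (h : t + r ≤ M) :
    symWeight (M + 1) ρ α β z t r 0 (t + r) =
      z ^ r * (∏ k ∈ Finset.range t, (β - ρ ^ k * α * z)) *
        (∏ k ∈ Finset.Ico (t + r) M, (1 - ρ ^ k * α * β * z)) * raiseFactor ρ β 0 r := by
  have e : raiseFactor ρ α (t + r) t = 1 := by simp [raiseFactor]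
  rw [symWeight, e, mul_one]
  congr 1
  rcases hN with hN | hN | hN
  · obtain rfl : M = 1 := by omega
    obtain ⟨ht, hr⟩ : t ≤ 1 ∧ r ≤ 1 := by omega
    interval_cases t <;> interval_cases r <;> first | omega |
      simp [coreWeight, coreWeight2, Finset.prod_Ico_succ_top, Finset.prod_range_succ]
  · obtain rfl : M = 2 := by omega
    obtain ⟨ht, hr⟩ : t ≤ 2 ∧ r ≤ 2 := by omega
    interval_cases t <;> interval_cases r <;> first | omega |
      simp [coreWeight, coreWeight3, Finset.prod_Ico_succ_top, Finset.prod_range_succ]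
  · obtain rfl : M = 3 := by omega
    obtain ⟨ht, hr⟩ : t ≤ 3 ∧ r ≤ 3 := by omega
    interval_cases t <;> interval_cases r <;> first | omega |
      simp [coreWeight, coreWeight4, coreWeight4Top0, coreWeight4Top1, coreWeight4Top2,
        coreWeight4Top3, Finset.prod_Ico_succ_top, Finset.prod_range_succ, mul_assoc]

theorem symWeight_last {M : ℕ} (hN : M + 1 = 2 ∨ M + 1 = 3 ∨ M + 1 = 4) (ρ α β z : R) :
    symWeight (M + 1) ρ α β z M M M M = ∏ k ∈ Finset.range M, (z - ρ ^ k * α * β) := by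
  rw [symWeight]
  rcases hN with hN | hN | hN
  · obtain rfl : M = 1 := by omega
    simp [coreWeight, coreWeight2, raiseFactor, Finset.prod_range_succ]
  · obtain rfl : M = 2 := by omega
    simp [coreWeight, coreWeight3, raiseFactor, Finset.prod_range_succ]
  · obtain rfl : M = 3 := by omega
    simp [coreWeight, coreWeight4, coreWeight4Top3, raiseFactor, Finset.prod_range_succ]

theorem symWeight_top_right {M : ℕ} (hN : M + 1 = 2 ∨ M + 1 = 3 ∨ M + 1 = 4) (ρ α β z : R) :
    symWeight (M + 1) ρ α β z 0 M M 0 = ∏ k ∈ Finset.range M, (α - ρ ^ k * β * z) := by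
  rw [symWeight]
  rcases hN with hN | hN | hN
  · obtain rfl : M = 1 := by omega
    simp [coreWeight, coreWeight2, raiseFactor, Finset.prod_range_succ]
  · obtain rfl : M = 2 := by omega
    simp [coreWeight, coreWeight3, raiseFactor, Finset.prod_range_succ]
  · obtain rfl : M = 3 := by omega
    simp [coreWeight, coreWeight4, coreWeight4Top0, raiseFactor, Finset.prod_range_succ]

/-- Naturality in the ring makes the polynomial version of the wall sum evaluate to the complex one.
-/
theorem map_coreWeight {R' : Type*} [CommRing R'] (f : R →+* R') (N : ℕ) (ρ α β z : R)
    (t r l b : ℕ) : f (coreWeight N ρ α β z t r l b) =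
      coreWeight N (f ρ) (f α) (f β) (f z) t r l b := by
  unfold coreWeight
  split
  · unfold coreWeight2; split <;> simp
  · unfold coreWeight3; split <;> simp
  · unfold coreWeight4
    split
    · unfold coreWeight4Top0; split <;> simp
    · unfold coreWeight4Top1; split <;> simp
    · unfold coreWeight4Top2; split <;> simp
    · unfold coreWeight4Top3; split <;> simp
    · simp
  · simp

theorem map_raiseFactor {R' : Type*} [CommRing R'] (f : R →+* R') (ρ a : R) (m n : ℕ) :
    f (raiseFactor ρ a m n) = raiseFactor (f ρ) (f a) m n := by
  simp [raiseFactor, map_prod]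

theorem map_symWeight {R' : Type*} [CommRing R'] (f : R →+* R') (N : ℕ) (ρ α β z : R)
    (t r l b : ℕ) : f (symWeight N ρ α β z t r l b) =
      symWeight N (f ρ) (f α) (f β) (f z) t r l b := by
  simp only [symWeight, map_mul, map_coreWeight, map_raiseFactor]

variable {M n : ℕ}

theorem map_siteMat {R' : Type*} [CommRing R'] (f : R →+* R') (ρ α β z : R)
    (l r : Fin (M + 1)) :
    f.mapMatrix (siteMat M ρ α β z l r) = siteMat M (f ρ) (f α) (f β) (f z) l r := by
  ext t b
  exact map_symWeight f _ _ _ _ _ _ _ _ _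

theorem map_columnMat {R' : Type*} [CommRing R'] (f : R →+* R') (ρ α : R) (β z : Fin n → R) :
    f.mapMatrix (columnMat M ρ α β z) =
      columnMat M (f ρ) (f α) (fun j => f (β j)) (fun j => f (z j)) := by
  ext l r
  have := congrFun (congrFun (map_list_prod f.mapMatrix
    (List.ofFn fun j => siteMat M ρ α (β j) (z j) (l j) (r j))) 0) (Fin.last M)
  simp only [List.map_ofFn, Function.comp_def, map_siteMat] at this
  exact this

end ClosedForms

section Degrees
open Polynomial

/-- The exponents telescope along a path of states: every increase of the state costs a power of X,
and truncated subtraction obeys the triangle inequality. -/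
theorem X_pow_dvd_prod_apply {K : Type*} [CommRing K] {M : ℕ} (l : List (Matrix (Fin M) (Fin M)
    K[X]))
    (h : ∀ A ∈ l, ∀ t b : Fin M, X ^ ((b : ℕ) - t) ∣ A t b) (t b : Fin M) :
    (X : K[X]) ^ ((b : ℕ) - t) ∣ l.prod t b := by
  induction l generalizing t with
  | nil =>
    rw [List.prod_nil, Matrix.one_apply]
    split_ifs with e
    · simp [e]
    · exact dvd_zero _
  | cons A l ih =>
    rw [List.prod_cons, Matrix.mul_apply]
    refine Finset.dvd_sum fun m _ => ?_
    refine dvd_trans (pow_dvd_pow X (show (b : ℕ) - t ≤ (m - t) + (b - m) by omega)) ?_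
    rw [pow_add]
    exact mul_dvd_mul (h A (by simp) t m) (ih (fun A hA => h A (by simp [hA])) m)

theorem natDegree_prod_apply_le {K ι : Type*} [CommRing K] [Fintype ι] [DecidableEq ι] {d : ℕ}
    (l : List (Matrix ι ι K[X])) (h : ∀ A ∈ l, ∀ t b, (A t b).natDegree ≤ d) (t b : ι) :
    (l.prod t b).natDegree ≤ l.length * d := by
  induction l generalizing t with
  | nil =>
    rw [List.prod_nil, Matrix.one_apply]
    split_ifs <;> simp
  | cons A l ih =>
    rw [List.prod_cons, Matrix.mul_apply]
    refine natDegree_sum_le_of_forall_le _ _ fun m _ => ?_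
    refine natDegree_mul_le.trans ?_
    have h1 := h A (by simp) t m
    have h2 := ih (fun A hA => h A (by simp [hA])) m
    rw [List.length_cons]
    linarith

theorem natDegree_one_sub_C_mul_X_le {K : Type*} [CommRing K] (a b : K) :
    (C a - C b * X).natDegree ≤ 1 := by
  refine (natDegree_sub_le _ _).trans (max_le (by simp) ((natDegree_C_mul_le _ _).trans
    natDegree_X_le))

variable {K : Type*} [CommRing K] {M n : ℕ}

theorem siteMat_left_zero_dvd (hN : M + 1 = 2 ∨ M + 1 = 3 ∨ M + 1 = 4) (ρ α β y : K)
    (t r b : Fin (M + 1)) :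
    X ^ ((b : ℕ) - t) ∣ siteMat M (C ρ) (C α) (C β) (C y * X) 0 r t b := by
  rw [siteMat, Matrix.of_apply]
  by_cases h : (t : ℕ) + r = b
  · rw [Fin.val_zero, ← h, symWeight_left_zero hN _ _ _ _ (by omega), add_tsub_cancel_left, mul_pow,
      mul_comm (C y ^ _)]
    simp only [mul_assoc]
    exact dvd_mul_right _ _
  · rw [symWeight_eq_zero (by simp only [Fin.val_zero]; omega)]; exact dvd_zero _

theorem natDegree_siteMat_left_zero_le (hN : M + 1 = 2 ∨ M + 1 = 3 ∨ M + 1 = 4) (ρ α β y : K)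
    (t r b : Fin (M + 1)) :
    (siteMat M (C ρ) (C α) (C β) (C y * X) 0 r t b).natDegree ≤ M := by
  rw [siteMat, Matrix.of_apply]
  by_cases h : (t : ℕ) + r = b
  · rw [Fin.val_zero, ← h, symWeight_left_zero hN _ _ _ _ (by omega), ← map_raiseFactor C]
    refine (natDegree_mul_C_le _ _).trans ?_
    refine natDegree_mul_le.trans ?_
    have h1 : ((C y * X) ^ (r : ℕ) : K[X]).natDegree ≤ r :=
      natDegree_pow_le.trans ((Nat.mul_le_mul_left _ ((natDegree_C_mul_le _ _).trans
        natDegree_X_le)).trans (by simp))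
    have h2 : (∏ k ∈ Finset.range t, (C β - C ρ ^ k * C α * (C y * X)) : K[X]).natDegree ≤ t := by
      refine (natDegree_prod_le _ _).trans ((Finset.sum_le_card_nsmul _ _ 1 fun k _ => ?_).trans
        (by simp))
      simpa only [C_mul, C_pow, mul_assoc] using natDegree_one_sub_C_mul_X_le β (ρ ^ k * α * y)
    have h3 : (∏ k ∈ Finset.Ico (t + r : ℕ) M,
      (1 - C ρ ^ k * C α * C β * (C y * X)) : K[X]).natDegree
        ≤ M - (t + r) := by
      refine (natDegree_prod_le _ _).trans ((Finset.sum_le_card_nsmul _ _ 1 fun k _ => ?_).trans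
        (by simp))
      simpa only [C_mul, C_pow, mul_assoc,
        C_1] using natDegree_one_sub_C_mul_X_le 1 (ρ ^ k * α * β * y)
    have := (natDegree_mul_le (p := (C y * X) ^ (r : ℕ))
      (q := ∏ k ∈ Finset.range t, (C β - C ρ ^ k * C α * (C y * X))))
    omega
  · rw [symWeight_eq_zero (by simp only [Fin.val_zero]; omega)]; simp

theorem columnMat_left_zero_dvd (hN : M + 1 = 2 ∨ M + 1 = 3 ∨ M + 1 = 4) (ρ α : K)
    (β y : Fin n → K) (r : Fin n → Fin (M + 1)) :
    X ^ M ∣ columnMat M (C ρ) (C α) (fun j => C (β j)) (fun j => C (y j) * X) (fun _ => 0) r := by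
  have := X_pow_dvd_prod_apply (K := K) (List.ofFn fun j =>
    siteMat M (C ρ) (C α) (C (β j)) (C (y j) * X) 0 (r j)) (by
      intro A hA t b
      obtain ⟨j, rfl⟩ := (List.mem_ofFn' _ _).1 hA
      exact siteMat_left_zero_dvd hN _ _ _ _ _ _ _) 0 (Fin.last M)
  rw [columnMat, Matrix.of_apply]
  simpa using this

theorem natDegree_columnMat_left_zero_le (hN : M + 1 = 2 ∨ M + 1 = 3 ∨ M + 1 = 4) (ρ α : K)
    (β y : Fin n → K) (r : Fin n → Fin (M + 1)) :
    (columnMat M (C ρ) (C α) (fun j => C (β j)) (fun j => C (y j) * X) (fun _ => 0) r).natDegree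
      ≤ n * M := by
  have := natDegree_prod_apply_le (d := M) (List.ofFn fun j =>
    siteMat M (C ρ) (C α) (C (β j)) (C (y j) * X) 0 (r j)) (by
      intro A hA t b
      obtain ⟨j, rfl⟩ := (List.mem_ofFn' _ _).1 hA
      exact natDegree_siteMat_left_zero_le hN _ _ _ _ _ _ _) 0 (Fin.last M)
  rw [columnMat, Matrix.of_apply]
  simpa using this

end Degrees
end

/-! ### The frozen corner and the recursion for the closed form. -/

section

section Corner
variable {R : Type*} [CommRing R] {M : ℕ}

theorem mul_apply_of_row {ι : Type*} [Fintype ι] [DecidableEq ι] {A : Matrix ι ι R} {i k : ι} {a :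
    R}
    (h : ∀ m, A i m = if m = k then a else 0) (B : Matrix ι ι R) (j : ι) :
    (A * B) i j = a * B k j := by
  simp [Matrix.mul_apply, h]

/-- The transfer matrix of `m` vertical lines. -/
def wallMat {m n : ℕ} (M : ℕ) (ρ : R) (α : Fin m → R) (β : Fin n → R) (z : Fin m → Fin n → R) :
    Matrix (Fin n → Fin (M + 1)) (Fin n → Fin (M + 1)) R :=
  (List.ofFn fun i => columnMat M ρ (α i) β (z i)).prod

/-- The domain wall partition function in the symmetric gauge. -/
def wallSum {m n : ℕ} (M : ℕ) (ρ : R) (α : Fin m → R) (β : Fin n → R) (z : Fin m → Fin n → R) : R :=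
  wallMat M ρ α β z (fun _ => 0) (fun _ => Fin.last M)

/-- With left state 0 and top state M the ice rule allows only right state 0 and bottom state M, so
the line stays in its highest state and is completely forced. -/
theorem prod_siteMat_last_row (hN : M + 1 = 2 ∨ M + 1 = 3 ∨ M + 1 = 4) (ρ α : R) {n : ℕ}
    (β z : Fin n → R) (r : Fin n → Fin (M + 1)) :
    (List.ofFn fun j => siteMat M ρ α (β j) (z j) 0 (r j)).prod (Fin.last M) (Fin.last M) =
      if r = fun _ => 0 then ∏ j, ∏ k ∈ Finset.range M, (β j - ρ ^ k * α * z j) else 0 := by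
  induction n with
  | zero => simp [Subsingleton.elim r fun _ => 0]
  | succ n ih =>
    rw [List.ofFn_succ, List.prod_cons, mul_apply_of_row (k := Fin.last M)
      (a := if r 0 = 0 then ∏ k ∈ Finset.range M, (β 0 - ρ ^ k * α * z 0) else 0), ih,
      Fin.prod_univ_succ]
    · have : (r = fun _ => 0) ↔ r 0 = 0 ∧ (fun j : Fin n => r j.succ) = fun _ => 0 := by
        simp only [funext_iff, Fin.forall_fin_succ]
      simp only [this]
      split_ifs <;> simp_all
    · intro m
      rw [siteMat, Matrix.of_apply, Fin.val_last, Fin.val_zero]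
      by_cases hr : r 0 = 0
      · by_cases hm : m = Fin.last M
        · have := symWeight_left_zero hN ρ α (β 0) (z 0) (t := M) (r := 0) le_rfl
          rw [if_pos hm, if_pos hr, hr, hm, Fin.val_last, Fin.val_zero]
          simpa [raiseFactor] using this
        · rw [if_neg hm, symWeight_eq_zero]
          rw [Fin.ext_iff, Fin.val_last] at hm
          omega
      · rw [if_neg hr, ite_self, symWeight_eq_zero]
        rw [Fin.ext_iff, Fin.val_zero] at hr
        omega

/-- Under `h` the upper left vertex must jump from 0 to M on both lines. The rest of the column is
then forced by `prod_siteMat_last_row`. -/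
theorem columnMat_corner (hN : M + 1 = 2 ∨ M + 1 = 3 ∨ M + 1 = 4) (ρ α : R) {n : ℕ}
    (β z : Fin (n + 1) → R) (h : 1 - ρ ^ (M - 1) * α * β 0 * z 0 = 0)
    (r₀ : Fin (M + 1)) (r : Fin n → Fin (M + 1)) :
    columnMat M ρ α β z (fun _ => 0) (Fin.cons r₀ r) =
      if r₀ = Fin.last M then if r = fun _ => 0 then z 0 ^ M * raiseFactor ρ (β 0) 0 M *
        ∏ j : Fin n, ∏ k ∈ Finset.range M, (β j.succ - ρ ^ k * α * z j.succ) else 0 else 0 := by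
  rw [columnMat, Matrix.of_apply, List.ofFn_succ, List.prod_cons, mul_apply_of_row (k := Fin.last M)
      (a := if r₀ = Fin.last M then z 0 ^ M * raiseFactor ρ (β 0) 0 M else 0)]
  · simp only [Fin.cons_succ]
    rw [prod_siteMat_last_row hN]
    split_ifs <;> simp
  · intro m
    rw [siteMat, Matrix.of_apply, Fin.val_zero, Fin.cons_zero]
    by_cases hm : (m : ℕ) = r₀
    · have := symWeight_left_zero hN ρ α (β 0) (z 0) (t := 0) (r := r₀) (by omega)
      rw [zero_add] at this
      rw [hm, this]
      by_cases hr : r₀ = Fin.last M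
      · have hm' : m = Fin.last M := by rw [← hr]; exact Fin.ext hm
        rw [if_pos hm', if_pos hr, hr]
        simp
      · have hm' : m ≠ Fin.last M := fun h => hr (by rw [← h]; exact Fin.ext hm.symm)
        rw [if_neg hm']
        have hlt : (r₀ : ℕ) < M := by
          rw [Fin.ext_iff, Fin.val_last] at hr; omega
        -- The index M - 1 occurs in the product for every right state below M, so this one factor
        -- kills all of them at once.
        rw [Finset.prod_eq_zero (i := M - 1) (Finset.mem_Ico.2 ⟨by omega, by omega⟩) h]
        ring
    · rw [symWeight_eq_zero (by omega)]
      split_ifs with h1 h2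
      · exact absurd (by rw [h1, h2]) hm
      · rfl
      · rfl

/-- Once the first horizontal line is in its highest state and meets a lowest top state, the ice
rule keeps both unchanged. The first row therefore splits off as a scalar. -/
theorem columnMat_cons_last (hN : M + 1 = 2 ∨ M + 1 = 3 ∨ M + 1 = 4) (ρ α : R) {n : ℕ}
    (β z : Fin (n + 1) → R) (r₀ : Fin (M + 1)) (l r : Fin n → Fin (M + 1)) :
    columnMat M ρ α β z (Fin.cons (Fin.last M) l) (Fin.cons r₀ r) =
      if r₀ = Fin.last M then (∏ k ∈ Finset.range M, (α - ρ ^ k * β 0 * z 0)) *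
        columnMat M ρ α (fun j => β j.succ) (fun j => z j.succ) l r else 0 := by
  rw [columnMat, Matrix.of_apply, List.ofFn_succ, List.prod_cons, mul_apply_of_row (k := 0)
      (a := if r₀ = Fin.last M then ∏ k ∈ Finset.range M, (α - ρ ^ k * β 0 * z 0) else 0)]
  · simp only [Fin.cons_succ]
    rw [columnMat, Matrix.of_apply]
    split_ifs <;> simp
  · intro m
    rw [siteMat, Matrix.of_apply, Fin.val_zero, Fin.cons_zero, Fin.cons_zero, Fin.val_last]
    by_cases hr : r₀ = Fin.last M
    · by_cases hm : m = 0
      · rw [if_pos hm, if_pos hr, hr, hm, Fin.val_last, Fin.val_zero, symWeight_top_right hN]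
      · rw [if_neg hm, symWeight_eq_zero]
        rw [Fin.ext_iff, Fin.val_zero] at hm
        omega
    · rw [if_neg hr, ite_self, symWeight_eq_zero]
      rw [Fin.ext_iff, Fin.val_last] at hr
      omega

theorem prod_ofFn_cons_last {S : Type*} [Fintype S] [DecidableEq S] {m n : ℕ} (s : S)
    (T : Fin m → Matrix (Fin (n + 1) → S) (Fin (n + 1) → S) R) (T' : Fin m → Matrix (Fin n → S)
      (Fin n → S) R)
    (c : Fin m → R) (h : ∀ i r₀ l r, T i (Fin.cons s l) (Fin.cons r₀ r) =
      if r₀ = s then c i * T' i l r else 0) (l r : Fin n → S) :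
    (List.ofFn T).prod (Fin.cons s l) (Fin.cons s r) = (∏ i, c i) * (List.ofFn T').prod l r := by
  induction m generalizing l with
  | zero => simp [Matrix.one_apply]
  | succ m ih =>
    rw [List.ofFn_succ, List.prod_cons, Matrix.mul_apply, ← (Fin.consEquiv fun _ => S).sum_comp,
      Fintype.sum_prod_type, Finset.sum_eq_single s]
    · simp only [Fin.consEquiv, Equiv.coe_fn_mk, h, if_true]
      rw [List.ofFn_succ, List.prod_cons, Matrix.mul_apply, Fin.prod_univ_succ, Finset.mul_sum]
      refine Finset.sum_congr rfl fun x _ => ?_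
      rw [ih _ _ _ fun i => h i.succ]
      ring
    · intro r₀ _ hr
      simp [Fin.consEquiv, h, hr]
    · simp

/-- The frozen first row and first column leave domain wall boundary conditions on the remaining
lattice. -/
theorem wallSum_corner (hN : M + 1 = 2 ∨ M + 1 = 3 ∨ M + 1 = 4) (ρ : R) {m n : ℕ}
    (α : Fin (m + 1) → R) (β : Fin (n + 1) → R) (z : Fin (m + 1) → Fin (n + 1) → R)
    (h : 1 - ρ ^ (M - 1) * α 0 * β 0 * z 0 0 = 0) :
    wallSum M ρ α β z = z 0 0 ^ M * raiseFactor ρ (β 0) 0 M *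
      (∏ j : Fin n, ∏ k ∈ Finset.range M, (β j.succ - ρ ^ k * α 0 * z 0 j.succ)) *
      (∏ i : Fin m, ∏ k ∈ Finset.range M, (α i.succ - ρ ^ k * β 0 * z i.succ 0)) *
      wallSum M ρ (fun i => α i.succ) (fun j => β j.succ) (fun i j => z i.succ j.succ) := by
  rw [wallSum, wallMat, List.ofFn_succ, List.prod_cons, Matrix.mul_apply,
    ← (Fin.consEquiv fun _ => Fin (M + 1)).sum_comp, Fintype.sum_prod_type]
  simp only [Fin.consEquiv, Equiv.coe_fn_mk, columnMat_corner hN ρ (α 0) β (z 0) h]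
  simp only [ite_mul, zero_mul, Finset.sum_ite_irrel, Finset.sum_const_zero, Finset.sum_ite_eq',
    Finset.mem_univ, if_true]
  have hl : (fun _ : Fin (n + 1) => Fin.last M) = Fin.cons (Fin.last M) fun _ => Fin.last M := by
    funext j; refine Fin.cases ?_ (fun j => ?_) j <;> simp
  rw [hl, prod_ofFn_cons_last (Fin.last M) _ _ _ fun i r₀ l r =>
    columnMat_cons_last hN ρ (α i.succ) β (z i.succ) r₀ l r, ← mul_assoc]
  rfl

end Corner

section ClosedForm

/-- The freezing condition `h` exchanges A X with Y / B up to powers of ρ. Reversing k to M - 1 - k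
turns the frozen weights of the first row and column into the factors of the closed form. -/
theorem corner_factor {M : ℕ} {ρ A B X Y a b x y : ℂ} (hρ : ρ ≠ 0) (hx : x ≠ 0)
    (hy : y ≠ 0) (hY : Y ≠ 0) (h : ρ ^ (M - 1) * A * B * X = Y) :
    (∏ k ∈ Finset.range M, (b - ρ ^ k * A * (X / y))) *
        ∏ k ∈ Finset.range M, (a - ρ ^ k * B * (x / Y)) =
      (x / y) ^ M * ∏ k ∈ Finset.range M,
        ((1 - ρ ^ k * A * a * (X / x)) * (1 - ρ ^ k * b * B * (y / Y))) := by
  have hne : ρ ^ (M - 1) * A * B * X ≠ 0 := h ▸ hY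
  have hX : X ≠ 0 := right_ne_zero_of_mul hne
  have hB : B ≠ 0 := right_ne_zero_of_mul (left_ne_zero_of_mul hne)
  have hA : A ≠ 0 := right_ne_zero_of_mul (left_ne_zero_of_mul (left_ne_zero_of_mul hne))
  rw [← Finset.prod_mul_distrib, ← Finset.prod_range_reflect]
  -- The powers of ρ left over after the reversal cancel in the full product, by the same reversal.
  have h1 : ∏ k ∈ Finset.range M, (ρ ^ (M - 1 - k) / ρ ^ k) = 1 := by
    rw [Finset.prod_div_distrib, Finset.prod_range_reflect (fun k => ρ ^ k) M]
    exact div_self (Finset.prod_ne_zero_iff.2 fun k _ => pow_ne_zero _ hρ)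
  trans ∏ k ∈ Finset.range M, (ρ ^ (M - 1 - k) / ρ ^ k * (x / y) *
    ((1 - ρ ^ k * A * a * (X / x)) * (1 - ρ ^ k * b * B * (y / Y))))
  · refine Finset.prod_congr rfl fun k hk => ?_
    have hk' := Finset.mem_range.1 hk
    have h2 : ρ ^ (M - 1) = ρ ^ (M - 1 - k) * ρ ^ k := by rw [← pow_add]; congr 1; omega
    rw [h2] at h
    have hpk := pow_ne_zero k hρ
    have hpl := pow_ne_zero (M - 1 - k) hρ
    rw [← h]
    field_simp
    ring
  · rw [Finset.prod_mul_distrib, Finset.prod_mul_distrib, h1, one_mul, Finset.prod_const,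
      Finset.card_range]

/-- The closed form of the domain wall partition function in the symmetric gauge. -/
noncomputable def wallProduct {L : ℕ} (M : ℕ) (ρ : ℂ) (α β x y : Fin L → ℂ) : ℂ :=
  (∏ j, (x j / y j) ^ (M * (j + 1))) * (∏ j, raiseFactor ρ (β j) 0 M) *
    ∏ i, ∏ j ∈ Finset.Ioi i, ∏ k ∈ Finset.range M,
      ((1 - ρ ^ k * α i * α j * (x i / x j)) * (1 - ρ ^ k * β j * β i * (y j / y i)))

/-- Removing the first pair of lines lowers every later index by one, which releases one factor (x /
y) ^ M for each of them. This is the origin of the weight j + 1 in the exponent. -/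
theorem wallProduct_succ {L M : ℕ} (ρ : ℂ) (α β x y : Fin (L + 1) → ℂ) :
    wallProduct M ρ α β x y = (x 0 / y 0) ^ M * raiseFactor ρ (β 0) 0 M *
      (∏ j : Fin L, ((x j.succ / y j.succ) ^ M * ∏ k ∈ Finset.range M,
        ((1 - ρ ^ k * α 0 * α j.succ * (x 0 / x j.succ)) *
          (1 - ρ ^ k * β j.succ * β 0 * (y j.succ / y 0))))) *
      wallProduct M ρ (fun j => α j.succ) (fun j => β j.succ) (fun j => x j.succ)
        (fun j => y j.succ) := by
  simp only [wallProduct, Fin.prod_univ_succ, Fin.prod_Ioi_zero, Fin.prod_Ioi_succ, Fin.val_zero,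
    Fin.val_succ, Finset.prod_mul_distrib, mul_one, mul_add, pow_add]
  ring

end ClosedForm
end

/-! ### Dependence on the first vertical rapidity. -/

section
open Polynomial Filter Topology

section FirstColumn
variable {M : ℕ} {ρ : ℂ}

theorem Polynomial.eq_of_eventually_eval_eq {p q : ℂ[X]} {a : ℂ}
    (h : ∀ᶠ t in 𝓝[≠] a, p.eval t = q.eval t) : p = q := by
  refine Polynomial.eq_of_infinite_eval_eq p q fun hfin => ?_
  have h1 : {t | p.eval t = q.eval t}ᶜ ∈ 𝓝[≠] a := by
    have : ({t | p.eval t = q.eval t} \ {a})ᶜ ∈ 𝓝 a :=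
      (hfin.subset Set.sdiff_subset).isClosed.isOpen_compl.mem_nhds (by simp)
    filter_upwards [mem_nhdsWithin_of_mem_nhds this, self_mem_nhdsWithin] with t ht ha h'
    exact ht ⟨h', ha⟩
  obtain ⟨t, ht, ht'⟩ := (h.and h1).exists
  exact ht' ht

theorem Polynomial.eventually_eval_ne_zero {p : ℂ[X]} (hp : p ≠ 0) (a : ℂ) :
    ∀ᶠ t in 𝓝[≠] a, p.eval t ≠ 0 := by
  have : ({t | p.eval t = 0} \ {a})ᶜ ∈ 𝓝 a :=
    (((Polynomial.finite_setOfPred_isRoot hp).subset fun t ht => ht).subset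
      Set.sdiff_subset).isClosed.isOpen_compl.mem_nhds (by simp)
  filter_upwards [mem_nhdsWithin_of_mem_nhds this, self_mem_nhdsWithin] with t ht ha h'
  exact ht ⟨h', ha⟩

theorem isCoprime_linear {a b e : ℂ} (h : b - a * e ≠ 0) :
    IsCoprime (1 - C a * X : ℂ[X]) (C b * X - C e) := by
  refine ⟨C ((b - a * e)⁻¹ * b), C ((b - a * e)⁻¹ * a), ?_⟩
  have : C ((b - a * e)⁻¹) * (C b - C a * C e) = (1 : ℂ[X]) := by
    rw [← C_mul, ← C_sub, ← C_mul, inv_mul_cancel₀ h, C_1]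
  simp only [C_mul]
  linear_combination this

/-- Only finitely many powers of ρ are distinct, so the quantifier over s commutes with the filter.
-/
theorem IsPrimitiveRoot.eventually_forall_pow {K : ℕ} (hρ : IsPrimitiveRoot ρ K) (hK : 0 < K)
    {l : Filter ℂ} {P : ℂ → ℂ → Prop} (h : ∀ s, ∀ᶠ t in l, P (ρ ^ s) t) :
    ∀ᶠ t in l, ∀ s : ℕ, P (ρ ^ s) t := by
  filter_upwards [(Finset.range K).eventually_all.2 fun s _ => h s] with t ht s
  rw [pow_eq_pow_mod s hρ.pow_eq_one]
  exact ht _ (Finset.mem_range.2 (Nat.mod_lt _ hK))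

/-- The exchange relation with every other column forces the factors 1 - ρ ^ k α₀ α j t / x j, and
the left boundary forces t ^ M. Together they exhaust the degree, so only a constant is
undetermined. `hsep` makes the scalars from the two sides of the exchange coprime. -/
theorem columnMat_mul_wallMat_eq (hN : M + 1 = 2 ∨ M + 1 = 3 ∨ M + 1 = 4)
    (hρ : IsPrimitiveRoot ρ (M + 1)) {L : ℕ} {α₀ : ℂ} {α x : Fin L → ℂ} {β y : Fin (L + 1) → ℂ}
    (hx : ∀ i, x i ≠ 0) (hy : ∀ j, y j ≠ 0) (hα₀ : α₀ ≠ 0) (hα : ∀ i, α i ≠ 0)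
    (hα₀' : ∀ k, k + 1 < M + 1 → 1 - ρ ^ k * α₀ ^ 2 ≠ 0)
    (hβ : ∀ j k, k + 1 < M + 1 → 1 - ρ ^ k * β j ^ 2 ≠ 0)
    (hsep : ∀ i j, ∀ s : ℕ, x j - ρ ^ s * (α₀ ^ 2 * α i * α j) * x i ≠ 0) :
    ∃ c : ℂ, ∀ t, (columnMat M ρ α₀ β (fun j => t / y j) *
        wallMat M ρ α β fun i j => x i / y j) (fun _ => 0) (fun _ => Fin.last M) =
      c * t ^ M * ∏ j, ∏ k ∈ Finset.range M, (1 - ρ ^ k * α₀ * α j * (t / x j)) := by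
  have hρ0 : ρ ≠ 0 := hρ.ne_zero (by omega)
  set V := wallMat M ρ α β fun i j => x i / y j with hV
  set T := columnMat M (C ρ) (C α₀) (fun j => C (β j)) (fun j => C (y j)⁻¹ * X) with hT
  have hTe : ∀ t l r, (T l r).eval t = columnMat M ρ α₀ β (fun j => t / y j) l r := by
    intro t l r
    have := congrFun (congrFun (map_columnMat (M := M) (evalRingHom t) (C ρ) (C α₀) (fun j => C (β
      j))
      (fun j => C (y j)⁻¹ * X)) l) r
    simp only [coe_evalRingHom, eval_C, eval_mul, eval_X] at this
    simp only [div_eq_mul_inv, mul_comm t]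
    exact this
  set q : ℂ[X] := ∑ m, T (fun _ => 0) m * C (V m fun _ => Fin.last M) with hq
  set q' : ℂ[X] := ∑ m, C (V (fun _ => 0) m) * T m fun _ => Fin.last M with hq'
  have hqe : ∀ t, q.eval t = (columnMat M ρ α₀ β (fun j => t / y j) * V) (fun _ => 0)
      (fun _ => Fin.last M) := by
    intro t
    simp only [hq, eval_finsetSum, eval_mul, eval_C, hTe, Matrix.mul_apply]
  have hqe' : ∀ t, q'.eval t = (V * columnMat M ρ α₀ β (fun j => t / y j)) (fun _ => 0)
      (fun _ => Fin.last M) := by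
    intro t
    simp only [hq', eval_finsetSum, eval_mul, eval_C, hTe, Matrix.mul_apply]
  -- The factors of the crossing weights at (0, 0) and at (M, M), as polynomials in t.
  let f : Fin L → ℕ → ℂ[X] := fun j k => 1 - C (ρ ^ k * α₀ * α j * (x j)⁻¹) * X
  let g : Fin L → ℕ → ℂ[X] := fun j k => C (x j)⁻¹ * X - C (ρ ^ k * α₀ * α j)
  set F := ∏ j, ∏ k ∈ Finset.range M, f j k with hF
  set G := ∏ j, ∏ k ∈ Finset.range M, g j k with hG
  have hGq : G * q = F * q' := by
    refine Polynomial.eq_of_eventually_eval_eq (a := 0) ?_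
    -- Near t = 0 the determinant condition of the Yang-Baxter equation reduces to y j ≠ 0. A
    -- punctured neighbourhood is enough to identify polynomials.
    have hdet : ∀ᶠ t in 𝓝[≠] (0 : ℂ), ∀ i j, ∀ s : ℕ,
        y j - ρ ^ s * (α₀ * α i ^ 2 * β j) * t ≠ 0 := by
      refine eventually_all.2 fun i => eventually_all.2 fun j =>
        IsPrimitiveRoot.eventually_forall_pow (P := fun r t => y j - r * (α₀ * α i ^ 2 * β j) * t ≠
          0)
          hρ (by omega) fun s => ?_
      refine ((Continuous.tendsto (by fun_prop) 0).eventually_ne ?_).filter_mono nhdsWithin_le_nhds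
      simpa using hy j
    filter_upwards [hdet, self_mem_nhdsWithin] with t ht ht0
    have := smul_mul_prod_ofFn (R := ℂ) (T₀ := columnMat M ρ α₀ β fun j => t / y j)
      (T := fun i => columnMat M ρ (α i) β fun j => x i / y j) fun i =>
        columnMat_exchange hN hρ ht0 (hx i) hy hα₀' hβ (ht i)
    have := congrFun (congrFun this fun _ => 0) fun _ => Fin.last M
    rw [Matrix.smul_apply, Matrix.smul_apply, ← wallMat, smul_eq_mul, smul_eq_mul, ← hV, ← hqe,
      ← hqe'] at this
    rw [eval_mul, eval_mul]
    convert this using 2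
    · simp only [hG, g, eval_prod, eval_sub, eval_mul, eval_C, eval_X, symWeight_last hN]
      refine Finset.prod_congr rfl fun j _ => Finset.prod_congr rfl fun k _ => ?_
      ring
    · simp only [hF, f, eval_prod, eval_sub, eval_mul, eval_C, eval_X, eval_one]
      refine Finset.prod_congr rfl fun j _ => ?_
      have := symWeight_left_zero hN ρ α₀ (α j) (t / x j) (t := 0) (r := 0) (by omega)
      simp only [raiseFactor, zero_add, pow_zero, Finset.range_zero, Finset.prod_empty, one_mul,
        tsub_self, mul_one, Nat.Ico_zero_eq_range] at this
      rw [this]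
      refine Finset.prod_congr rfl fun k _ => ?_
      ring
  have hcop : IsCoprime F G := by
    refine IsCoprime.prod_left fun j _ => IsCoprime.prod_left fun k hk => IsCoprime.prod_right fun
      i _ =>
      IsCoprime.prod_right fun k' _ => isCoprime_linear ?_
    have := hsep i j (k + k')
    intro h
    apply this
    have h2 := hx i
    have h3 := hx j
    field_simp at h
    rw [pow_add]
    linear_combination h
  have hFq : F ∣ q := hcop.dvd_of_dvd_mul_left (by rw [hGq]; exact dvd_mul_right _ _)
  have hXq : X ^ M ∣ q := Finset.dvd_sum fun m _ =>
    dvd_mul_of_dvd_left (columnMat_left_zero_dvd hN ρ α₀ β _ m) _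
  have hXF : IsCoprime (X ^ M) F := by
    refine IsCoprime.pow_left (IsCoprime.prod_right fun j _ => IsCoprime.prod_right fun k _ => ?_)
    exact ⟨C (ρ ^ k * α₀ * α j * (x j)⁻¹), 1, by simp only [f]; ring⟩
  obtain ⟨s, hs⟩ := hXF.mul_dvd hXq hFq
  -- The degree must be exactly 1 for the count below, hence the assumptions that α₀ and all α j are
  -- nonzero.
  have hfd : ∀ j k, (f j k).natDegree = 1 := fun j k => by
    have : ρ ^ k * α₀ * α j * (x j)⁻¹ ≠ 0 := by
      simp [hρ0, hα₀, hα j, hx j]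
    simp only [f]
    rw [natDegree_sub_eq_right_of_natDegree_lt] <;> rw [natDegree_C_mul_X _ this]
    simp
  have hf0 : ∀ j k, f j k ≠ 0 := fun j k h => by
    have := hfd j k
    rw [h, natDegree_zero] at this
    exact absurd this (by norm_num)
  have hFd : F.natDegree = L * M := by
    rw [hF, natDegree_prod _ _ fun j _ => Finset.prod_ne_zero_iff.2 fun k _ => hf0 j k]
    simp [natDegree_prod _ _ fun k _ => hf0 _ k, hfd]
  have hF0 : F ≠ 0 := Finset.prod_ne_zero_iff.2 fun j _ => Finset.prod_ne_zero_iff.2 fun k _ => hf0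
    j k
  have hqd : q.natDegree ≤ (L + 1) * M :=
    natDegree_sum_le_of_forall_le _ _ fun m _ => (natDegree_mul_C_le _ _).trans
      (natDegree_columnMat_left_zero_le hN ρ α₀ β _ m)
  have hsd : s.natDegree = 0 := by
    by_cases hs0 : s = 0
    · simp [hs0]
    · rw [hs, natDegree_mul (mul_ne_zero (pow_ne_zero _ X_ne_zero) hF0) hs0,
        natDegree_mul (pow_ne_zero _ X_ne_zero) hF0, natDegree_X_pow, hFd] at hqd
      have : (L + 1) * M = M + L * M := by ring
      omega
  refine ⟨s.coeff 0, fun t => ?_⟩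
  rw [← hqe, hs, eq_C_of_natDegree_eq_zero hsd]
  simp only [hF, f, eval_mul, eval_pow, eval_X, eval_C, eval_prod, eval_sub, eval_one, coeff_C_zero]
  rw [mul_comm, ← mul_assoc]
  congr 1
  refine Finset.prod_congr rfl fun j _ => Finset.prod_congr rfl fun k _ => ?_
  ring

end FirstColumn
end

/-! ### Evaluation by induction on the size, and removal of genericity. -/

section
open Polynomial Filter Topology

section Evaluation
variable {M : ℕ} {ρ : ℂ}

/-- Both sides are the same function of the first rapidity up to a constant factor, so one
evaluation point suffices. At the freezing point the induction hypothesis gives the value. -/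
theorem wallSum_eq_of_generic (hN : M + 1 = 2 ∨ M + 1 = 3 ∨ M + 1 = 4)
    (hρ : IsPrimitiveRoot ρ (M + 1)) {L : ℕ} {α x β y : Fin (L + 1) → ℂ}
    (hx : ∀ i, x i ≠ 0) (hy : ∀ j, y j ≠ 0) (hα : ∀ i, α i ≠ 0) (hβ₀ : β 0 ≠ 0)
    (hα₀ : ∀ s : ℕ, 1 - ρ ^ s * α 0 ^ 2 ≠ 0) (hβ : ∀ j, ∀ s : ℕ, 1 - ρ ^ s * β j ^ 2 ≠ 0)
    (hsep : ∀ i j, ∀ s : ℕ, x j - ρ ^ s * (α 0 ^ 2 * α i * α j) * x i ≠ 0)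
    (hcor : ∀ j, ∀ s : ℕ, β 0 * x j - ρ ^ s * α j * y 0 ≠ 0)
    (ih : wallSum M ρ (fun i : Fin L => α i.succ) (fun j : Fin L => β j.succ)
        (fun i j => x i.succ / y j.succ) =
      wallProduct M ρ (fun i : Fin L => α i.succ) (fun j => β j.succ) (fun i => x i.succ)
        (fun j => y j.succ)) :
    wallSum M ρ α β (fun i j => x i / y j) = wallProduct M ρ α β x y := by
  have hρ0 : ρ ≠ 0 := hρ.ne_zero (by omega)
  have hρ2 : ρ ^ (M - 1) * ρ ^ 2 = 1 := by
    rw [← pow_add, show M - 1 + 2 = M + 1 by omega, hρ.pow_eq_one]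
  obtain ⟨c, hc⟩ := columnMat_mul_wallMat_eq hN hρ (fun i : Fin L => hx i.succ) hy (hα 0)
    (fun i : Fin L => hα i.succ) (fun k _ => hα₀ k) (fun j k _ => hβ j k)
    (fun i j s => hsep i.succ j.succ s)
  have hsplit : ∀ x' : Fin (L + 1) → ℂ, (∀ i : Fin L, x' i.succ = x i.succ) →
      wallSum M ρ α β (fun i j => x' i / y j) = c * x' 0 ^ M *
        ∏ j : Fin L, ∏ k ∈ Finset.range M, (1 - ρ ^ k * α 0 * α j.succ * (x' 0 / x j.succ)) := by
    intro x' h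
    rw [← hc (x' 0), wallSum, wallMat, List.ofFn_succ, List.prod_cons, wallMat]
    simp only [h]
  set κ := (y 0)⁻¹ ^ M * raiseFactor ρ (β 0) 0 M *
      (∏ j : Fin L, ((x j.succ / y j.succ) ^ M * ∏ k ∈ Finset.range M,
          (1 - ρ ^ k * β j.succ * β 0 * (y j.succ / y 0)))) *
      wallProduct M ρ (fun j : Fin L => α j.succ) (fun j => β j.succ) (fun j => x j.succ)
        (fun j => y j.succ) with hκ
  have hprod : ∀ t : ℂ, (t / y 0) ^ M * raiseFactor ρ (β 0) 0 M *
      (∏ j : Fin L, ((x j.succ / y j.succ) ^ M * ∏ k ∈ Finset.range M,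
        ((1 - ρ ^ k * α 0 * α j.succ * (t / x j.succ)) *
          (1 - ρ ^ k * β j.succ * β 0 * (y j.succ / y 0))))) *
      wallProduct M ρ (fun j => α j.succ) (fun j => β j.succ) (fun j => x j.succ)
        (fun j => y j.succ) = κ * t ^ M *
        ∏ j : Fin L, ∏ k ∈ Finset.range M, (1 - ρ ^ k * α 0 * α j.succ * (t / x j.succ)) := by
    intro t
    simp only [hκ, Finset.prod_mul_distrib, div_eq_mul_inv, mul_pow]
    ring
  suffices h : c = κ by
    rw [hsplit x fun _ => rfl, wallProduct_succ, hprod, h]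
  -- This solves ρ ^ (M - 1) α₀ β₀ t = y₀, because ρ ^ (M - 1) ρ ^ 2 = 1. It is the point where the
  -- corner freezes.
  set t := ρ ^ 2 * y 0 / (α 0 * β 0) with ht
  have hα0 := hα 0
  have hy0 := hy 0
  have ht0 : t ≠ 0 := div_ne_zero (mul_ne_zero (pow_ne_zero _ hρ0) hy0) (mul_ne_zero hα0 hβ₀)
  have htY : ρ ^ (M - 1) * α 0 * β 0 * t = y 0 := by
    rw [ht]
    field_simp
    linear_combination hρ2
  -- The common factor must not vanish at the evaluation point; `hcor` is this condition, with
  -- exponent k + 2 coming from the ρ ^ 2 in t.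
  have hE : t ^ M * ∏ j : Fin L, ∏ k ∈ Finset.range M,
      (1 - ρ ^ k * α 0 * α j.succ * (t / x j.succ)) ≠ 0 := by
    refine mul_ne_zero (pow_ne_zero _ ht0) (Finset.prod_ne_zero_iff.2 fun j _ =>
      Finset.prod_ne_zero_iff.2 fun k _ h => hcor j.succ (k + 2) ?_)
    have := hx j.succ
    rw [ht] at h
    field_simp at h
    rw [pow_add]
    linear_combination h
  have h₁ := hsplit (Fin.cons t fun i => x i.succ) fun i => Fin.cons_succ _ _ _
  rw [wallSum_corner hN] at h₁
  · simp only [Fin.cons_zero, Fin.cons_succ] at h₁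
    rw [ih, mul_assoc ((t / y 0) ^ M * _), ← Finset.prod_mul_distrib,
      Finset.prod_congr rfl fun j _ => corner_factor (a := α (Fin.succ j)) (b := β (Fin.succ j))
        hρ0 (hx _) (hy _) hy0 htY,
      hprod, mul_assoc κ, mul_assoc c] at h₁
    exact (mul_right_cancel₀ hE h₁).symm
  · simp only [Fin.cons_zero]
    field_simp
    linear_combination -htY

theorem eventually_ne_zero_of_polynomial {f : ℂ → ℂ} (p : ℂ[X]) (hp : ∀ t, f t = p.eval t)
    (h : ∃ t, f t ≠ 0) (a : ℂ) : ∀ᶠ t in 𝓝[≠] a, f t ≠ 0 := by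
  obtain ⟨t₀, h⟩ := h
  have : p ≠ 0 := fun h0 => h (by rw [hp, h0, eval_zero])
  simpa only [hp] using Polynomial.eventually_eval_ne_zero this a

theorem map_wallSum {R R' : Type*} [CommRing R] [CommRing R'] (f : R →+* R') {m n : ℕ} (ρ : R)
    (α : Fin m → R) (β : Fin n → R) (z : Fin m → Fin n → R) :
    f (wallSum M ρ α β z) =
      wallSum M (f ρ) (fun i => f (α i)) (fun j => f (β j)) (fun i j => f (z i j)) := by
  have := congrFun (congrFun (map_list_prod f.mapMatrix
    (List.ofFn fun i => columnMat M ρ (α i) β (z i))) fun _ => 0) fun _ => Fin.last M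
  simp only [List.map_ofFn, Function.comp_def, map_columnMat] at this
  exact this

theorem wallSum_eq_wallProduct (hN : M + 1 = 2 ∨ M + 1 = 3 ∨ M + 1 = 4)
    (hρ : IsPrimitiveRoot ρ (M + 1)) {L : ℕ} (α β x y : Fin L → ℂ)
    (hx : ∀ i, x i ≠ 0) (hy : ∀ j, y j ≠ 0) :
    wallSum M ρ α β (fun i j => x i / y j) = wallProduct M ρ α β x y := by
  induction L with
  | zero => simp [wallSum, wallMat, wallProduct,
      Subsingleton.elim (fun _ : Fin 0 => (0 : Fin (M + 1))) fun _ => Fin.last M]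
  | succ L ih =>
    have hsq : ∀ w : ℂ, ∃ t : ℂ, t ^ 2 = w := fun w => IsAlgClosed.exists_pow_nat_eq w two_pos
    -- The α are shifted by t but the β by t ^ 2. With equal shifts the difference in `g₆` could
    -- vanish identically in t; with these its coefficient of t ^ 2 is x j ≠ 0.
    have hgen : ∀ᶠ t in 𝓝[≠] (0 : ℂ),
        wallSum M ρ (fun i => α i + t) (fun j => β j + t ^ 2) (fun i j => x i / y j) =
          wallProduct M ρ (fun i => α i + t) (fun j => β j + t ^ 2) x y := by
      have g₁ : ∀ᶠ t in 𝓝[≠] (0 : ℂ), ∀ i, α i + t ≠ 0 := eventually_all.2 fun i =>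
        eventually_ne_zero_of_polynomial (C (α i) + X) (fun t => by simp) ⟨1 - α i, by simp⟩ 0
      have g₂ : ∀ᶠ t in 𝓝[≠] (0 : ℂ), β 0 + t ^ 2 ≠ 0 :=
        eventually_ne_zero_of_polynomial (C (β 0) + X ^ 2) (fun t => by simp)
          ((hsq (1 - β 0)).imp fun t h => by simp [h]) 0
      have g₃ : ∀ᶠ t in 𝓝[≠] (0 : ℂ), ∀ s : ℕ, 1 - ρ ^ s * (α 0 + t) ^ 2 ≠ 0 :=
        IsPrimitiveRoot.eventually_forall_pow (P := fun r t => 1 - r * (α 0 + t) ^ 2 ≠ 0) hρ (by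
          omega)
          fun s => eventually_ne_zero_of_polynomial (1 - C (ρ ^ s) * (C (α 0) + X) ^ 2)
            (fun t => by simp) ⟨-α 0, by simp⟩ 0
      have g₄ : ∀ᶠ t in 𝓝[≠] (0 : ℂ), ∀ j, ∀ s : ℕ, 1 - ρ ^ s * (β j + t ^ 2) ^ 2 ≠ 0 :=
        eventually_all.2 fun j =>
        IsPrimitiveRoot.eventually_forall_pow (P := fun r t => 1 - r * (β j + t ^ 2) ^ 2 ≠ 0) hρ
          (by omega)
          fun s => eventually_ne_zero_of_polynomial (1 - C (ρ ^ s) * (C (β j) + X ^ 2) ^ 2)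
            (fun t => by simp) ((hsq (-β j)).imp fun t h => by simp [h]) 0
      -- The witness -α 0 kills the factor (α 0 + t) ^ 2 and leaves x j ≠ 0.
      have g₅ : ∀ᶠ t in 𝓝[≠] (0 : ℂ), ∀ i j, ∀ s : ℕ,
          x j - ρ ^ s * ((α 0 + t) ^ 2 * (α i + t) * (α j + t)) * x i ≠ 0 :=
        eventually_all.2 fun i => eventually_all.2 fun j =>
        IsPrimitiveRoot.eventually_forall_pow
          (P := fun r t => x j - r * ((α 0 + t) ^ 2 * (α i + t) * (α j + t)) * x i ≠ 0) hρ (by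
            omega)
          fun s => eventually_ne_zero_of_polynomial
            (C (x j) - C (ρ ^ s) * ((C (α 0) + X) ^ 2 * (C (α i) + X) * (C (α j) + X)) * C (x i))
            (fun t => by simp) ⟨-α 0, by simpa using hx j⟩ 0
      have g₆ : ∀ᶠ t in 𝓝[≠] (0 : ℂ), ∀ j, ∀ s : ℕ,
          (β 0 + t ^ 2) * x j - ρ ^ s * (α j + t) * y 0 ≠ 0 :=
        eventually_all.2 fun j =>
        IsPrimitiveRoot.eventually_forall_pow
          (P := fun r t => (β 0 + t ^ 2) * x j - r * (α j + t) * y 0 ≠ 0) hρ (by omega)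
          fun s => eventually_ne_zero_of_polynomial
            ((C (β 0) + X ^ 2) * C (x j) - C (ρ ^ s) * (C (α j) + X) * C (y 0))
            (fun t => by simp) (by
              -- If the quadratic in t vanished identically, its second difference at 1, 0, -1,
              -- which is 2 x j, would vanish too.
              by_contra! h
              refine hx j ?_
              linear_combination (h 1 + h (-1) - 2 * h 0) / 2) 0
      filter_upwards [g₁, g₂, g₃, g₄, g₅, g₆] with t h₁ h₂ h₃ h₄ h₅ h₆
      exact wallSum_eq_of_generic hN hρ hx hy h₁ h₂ h₃ h₄ h₅ h₆
        (ih _ _ _ _ (fun i => hx i.succ) (fun j => hy j.succ))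
    -- Continuity in the perturbation is obtained by recognizing the wall sum as a polynomial in t.
    have hl : ∀ t : ℂ, wallSum M ρ (fun i => α i + t) (fun j => β j + t ^ 2) (fun i j => x i / y j)
      =
        (wallSum M (C ρ) (fun i => C (α i) + X) (fun j => C (β j) + X ^ 2)
          (fun i j => C (x i / y j))).eval t := by
      intro t
      rw [← coe_evalRingHom, map_wallSum]
      simp
    have hlc : Continuous fun t : ℂ =>
        wallSum M ρ (fun i => α i + t) (fun j => β j + t ^ 2) (fun i j => x i / y j) := by
      simp only [hl]
      fun_prop
    have hrc : Continuous fun t : ℂ =>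
        wallProduct M ρ (fun i => α i + t) (fun j => β j + t ^ 2) x y := by
      unfold wallProduct raiseFactor
      fun_prop
    have := tendsto_nhds_unique_of_eventuallyEq (hlc.continuousAt.mono_left nhdsWithin_le_nhds)
      (hrc.continuousAt.mono_left nhdsWithin_le_nhds) hgen
    simpa using this

end Evaluation
end

/-! ### Gauge transformations of domain wall sums. -/

section
open Polynomial Filter Topology

section Walls
variable {R : Type*} [CommRing R] {M m n : ℕ}

theorem smul_mul_prod_ofFn_comm {A : Type*} [Ring A] [Algebra R A] {D : A} {c d : Fin n → R}
    {f g : Fin n → A} (h : ∀ j, c j • (D * f j) = d j • (g j * D)) :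
    (∏ j, c j) • (D * (List.ofFn f).prod) = (∏ j, d j) • ((List.ofFn g).prod * D) := by
  induction n with
  | zero => simp
  | succ n ih =>
    rw [List.ofFn_succ, List.ofFn_succ, List.prod_cons, List.prod_cons, Fin.prod_univ_succ,
      Fin.prod_univ_succ, ← mul_assoc, mul_comm (c 0), mul_smul, ← smul_mul_assoc (c 0), h 0,
      smul_mul_assoc, smul_comm, mul_assoc, ← mul_smul_comm, ih fun j => h j.succ, mul_smul_comm,
      mul_smul, mul_assoc]

/-- Transfer matrix of a vertical line for vertex weights `w j t r l b` (arguments after the row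
index: top, right, left, bottom) with lowest state on top and highest state at the bottom. -/
def columnOf (w : Fin n → Fin (M + 1) → Fin (M + 1) → Fin (M + 1) → Fin (M + 1) → R) :
    Matrix (Fin n → Fin (M + 1)) (Fin n → Fin (M + 1)) R :=
  Matrix.of fun l r =>
    (List.ofFn fun j => Matrix.of fun t b => w j t (r j) (l j) b).prod 0 (Fin.last M)

/-- The domain wall partition function with vertex weights `w i j t r l b`. -/
def wallOf (w : Fin m → Fin n → Fin (M + 1) → Fin (M + 1) → Fin (M + 1) → Fin (M + 1) → R) : R :=
  (List.ofFn fun i => columnOf (w i)).prod (fun _ => 0) fun _ => Fin.last M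

/-- Change of a domain wall partition function under a gauge transformation. -/
theorem wallOf_gauge
    {w w' : Fin m → Fin n → Fin (M + 1) → Fin (M + 1) → Fin (M + 1) → Fin (M + 1) → R}
    {P : Fin m → Fin (M + 1) → R} {Q : Fin n → Fin (M + 1) → R}
    (h : ∀ i j t r l b, w i j t r l b * (P i t * Q j l) = w' i j t r l b * (P i b * Q j r)) :
    wallOf w * ((∏ i, P i 0) * ∏ j, Q j 0) =
      wallOf w' * ((∏ i, P i (Fin.last M)) * ∏ j, Q j (Fin.last M)) := by
  -- The diagonal matrix of P is moved down the column and then the diagonal matrix of Q across the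
  -- columns. Interior bond factors are never cancelled, so P and Q may vanish.
  have hcol : ∀ i l r, P i 0 * (∏ j, Q j (l j)) * columnOf (w i) l r =
      P i (Fin.last M) * (∏ j, Q j (r j)) * columnOf (w' i) l r := by
    intro i l r
    have := smul_mul_prod_ofFn_comm (R := R) (D := Matrix.diagonal (P i))
      (c := fun j => Q j (l j)) (d := fun j => Q j (r j))
      (f := fun j => Matrix.of fun t b => w i j t (r j) (l j) b)
      (g := fun j => Matrix.of fun t b => w' i j t (r j) (l j) b) (by
        intro j
        ext t b
        simp only [Matrix.smul_apply, Matrix.diagonal_mul, Matrix.mul_diagonal, Matrix.of_apply,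
          smul_eq_mul]
        linear_combination h i j t (r j) (l j) b)
    have := congrFun (congrFun this 0) (Fin.last M)
    simp only [Matrix.smul_apply, Matrix.diagonal_mul, Matrix.mul_diagonal, smul_eq_mul] at this
    simp only [columnOf, Matrix.of_apply]
    linear_combination this
  have := smul_mul_prod_ofFn_comm (R := R)
    (D := Matrix.diagonal fun l : Fin n → Fin (M + 1) => ∏ j, Q j (l j))
    (c := fun i => P i 0) (d := fun i => P i (Fin.last M)) (f := fun i => columnOf (w i))
    (g := fun i => columnOf (w' i)) (by
      intro i
      ext l r
      simp only [Matrix.smul_apply, Matrix.diagonal_mul, Matrix.mul_diagonal, smul_eq_mul]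
      linear_combination hcol i l r)
  have := congrFun (congrFun this fun _ => 0) fun _ => Fin.last M
  simp only [Matrix.smul_apply, Matrix.diagonal_mul, Matrix.mul_diagonal, smul_eq_mul] at this
  simp only [wallOf]
  linear_combination this

theorem map_wallOf {R' : Type*} [CommRing R'] (f : R →+* R')
    (w : Fin m → Fin n → Fin (M + 1) → Fin (M + 1) → Fin (M + 1) → Fin (M + 1) → R) :
    f (wallOf w) = wallOf fun i j t r l b => f (w i j t r l b) := by
  have hc : ∀ i, f.mapMatrix (columnOf (w i)) = columnOf fun j t r l b => f (w i j t r l b) := by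
    intro i
    ext l r
    have := congrFun (congrFun (map_list_prod f.mapMatrix
      (List.ofFn fun j => Matrix.of fun t b => w i j t (r j) (l j) b)) 0) (Fin.last M)
    rw [List.map_ofFn] at this
    exact this
  have := congrFun (congrFun (map_list_prod f.mapMatrix
    (List.ofFn fun i => columnOf (w i))) fun _ => 0) fun _ => Fin.last M
  simp only [List.map_ofFn, Function.comp_def, hc] at this
  exact this

/-- The weight in the gauge where vertical lines are raised and horizontal lines are lowered with
unit coefficient. -/
def mixedWeight (N : ℕ) (ρ α β x : R) (t r l b : ℕ) : R :=
  coreWeight N ρ α β x t r l b * raiseFactor ρ α b t * raiseFactor ρ β r l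

theorem raiseFactor_mul (ρ a : R) (l r : ℕ) :
    raiseFactor ρ a l r * raiseFactor ρ a 0 l = raiseFactor ρ a r l * raiseFactor ρ a 0 r := by
  have key : ∀ l r : ℕ, l ≤ r →
      raiseFactor ρ a l r * raiseFactor ρ a 0 l = raiseFactor ρ a r l * raiseFactor ρ a 0 r := by
    intro l r h
    obtain ⟨d, rfl⟩ := Nat.exists_eq_add_of_le h
    simp only [raiseFactor, tsub_zero, zero_add, Nat.add_sub_cancel_left,
      show l - (l + d) = 0 by omega, Finset.range_zero, Finset.prod_empty, one_mul,
      Finset.prod_range_add]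
    ring
  rcases le_total l r with h | h
  · exact key l r h
  · exact (key r l h).symm

theorem symWeight_mul_raiseFactor (N : ℕ) (ρ α β x : R) (t r l b : ℕ) :
    symWeight N ρ α β x t r l b * raiseFactor ρ β 0 l =
      mixedWeight N ρ α β x t r l b * raiseFactor ρ β 0 r := by
  rw [symWeight, mixedWeight]
  linear_combination coreWeight N ρ α β x t r l b * raiseFactor ρ α b t * raiseFactor_mul ρ β l r

/-- Horizontal lines climb from 0 to M. Moving the coefficient of each climb from raising to
lowering therefore removes one full product of the factors 1 - ρ ^ k β ^ 2 per line. -/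
theorem wallSum_eq_mixed (ρ : R) (α : Fin m → R) (β : Fin n → R) (z : Fin m → Fin n → R) :
    wallSum M ρ α β z =
      wallOf (M := M) (fun i j t r l b => mixedWeight (M + 1) ρ (α i) (β j) (z i j) t r l b) *
        ∏ j, raiseFactor ρ (β j) 0 M := by
  have := wallOf_gauge (M := M)
    (w := fun i j t r l b => symWeight (M + 1) ρ (α i) (β j) (z i j) t r l b)
    (w' := fun i j t r l b => mixedWeight (M + 1) ρ (α i) (β j) (z i j) t r l b)
    (P := fun _ _ => 1) (Q := fun j k => raiseFactor ρ (β j) 0 k)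
    (fun i j t r l b => by
      simpa using symWeight_mul_raiseFactor (M + 1) ρ (α i) (β j) (z i j) t r l b)
  rw [show wallSum M ρ α β z = wallOf (M := M)
    fun i j t r l b => symWeight (M + 1) ρ (α i) (β j) (z i j) t r l b from rfl]
  simpa [raiseFactor] using this

theorem map_mixedWeight {R' : Type*} [CommRing R'] (f : R →+* R') (N : ℕ) (ρ α β z : R)
    (t r l b : ℕ) : f (mixedWeight N ρ α β z t r l b) =
      mixedWeight N (f ρ) (f α) (f β) (f z) t r l b := by
  simp only [mixedWeight, map_mul, map_coreWeight, map_raiseFactor]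

end Walls

/-- The factors relating the two gauges can vanish, so they are cancelled only after a small shift
of the β. Both sides are continuous in the shift. -/
theorem wallOf_mixedWeight {M L : ℕ} {ρ : ℂ} (hN : M + 1 = 2 ∨ M + 1 = 3 ∨ M + 1 = 4)
    (hρ : IsPrimitiveRoot ρ (M + 1)) (α β x y : Fin L → ℂ) (hx : ∀ i, x i ≠ 0) (hy : ∀ j, y j ≠ 0) :
    wallOf (M := M) (fun i j t r l b => mixedWeight (M + 1) ρ (α i) (β j) (x i / y j) t r l b) =
      (∏ j, (x j / y j) ^ (M * (j + 1))) *
        ∏ i, ∏ j ∈ Finset.Ioi i, ∏ k ∈ Finset.range M,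
          ((1 - ρ ^ k * α i * α j * (x i / x j)) * (1 - ρ ^ k * β j * β i * (y j / y i))) := by
  have hne : ∀ᶠ t in 𝓝[≠] (0 : ℂ), ∀ j, ∀ s : ℕ, 1 - ρ ^ s * (β j + t) ^ 2 ≠ 0 :=
    eventually_all.2 fun j =>
    IsPrimitiveRoot.eventually_forall_pow (P := fun r t => 1 - r * (β j + t) ^ 2 ≠ 0) hρ (by omega)
      fun s => eventually_ne_zero_of_polynomial (1 - C (ρ ^ s) * (C (β j) + X) ^ 2)
        (fun t => by simp) ⟨-β j, by simp⟩ 0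
  have hgen : ∀ᶠ t in 𝓝[≠] (0 : ℂ),
      wallOf (M := M) (fun i j t' r l b =>
        mixedWeight (M + 1) ρ (α i) (β j + t) (x i / y j) t' r l b) =
      (∏ j, (x j / y j) ^ (M * (j + 1))) *
        ∏ i, ∏ j ∈ Finset.Ioi i, ∏ k ∈ Finset.range M,
          ((1 - ρ ^ k * α i * α j * (x i / x j)) *
            (1 - ρ ^ k * (β j + t) * (β i + t) * (y j / y i))) := by
    filter_upwards [hne] with t ht
    have h0 : ∏ j, raiseFactor ρ (β j + t) 0 M ≠ 0 :=
      Finset.prod_ne_zero_iff.2 fun j _ => Finset.prod_ne_zero_iff.2 fun k _ => by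
        simpa using ht j (0 + k)
    refine mul_right_cancel₀ h0 ?_
    rw [← wallSum_eq_mixed ρ α (fun j => β j + t) fun i j => x i / y j,
      wallSum_eq_wallProduct hN hρ α _ x y hx hy, wallProduct]
    ring
  have hl : ∀ t : ℂ, wallOf (M := M) (fun i j t' r l b =>
      mixedWeight (M + 1) ρ (α i) (β j + t) (x i / y j) t' r l b) =
      (wallOf (M := M) (fun i j t r l b => mixedWeight (M + 1) (C ρ) (C (α i)) (C (β j) + X)
          (C (x i / y j)) t r l b)).eval t := by
    intro t
    rw [← coe_evalRingHom, map_wallOf]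
    simp only [map_mixedWeight]
    simp
  have hlc : Continuous fun t : ℂ => wallOf (M := M) (fun i j t' r l b =>
      mixedWeight (M + 1) ρ (α i) (β j + t) (x i / y j) t' r l b) := by
    simp only [hl]
    fun_prop
  have hrc : Continuous fun t : ℂ => (∏ j, (x j / y j) ^ (M * ((j : ℕ) + 1))) *
        ∏ i, ∏ j ∈ Finset.Ioi i, ∏ k ∈ Finset.range M,
          ((1 - ρ ^ k * α i * α j * (x i / x j)) *
            (1 - ρ ^ k * (β j + t) * (β i + t) * (y j / y i))) := by
    fun_prop
  have := tendsto_nhds_unique_of_eventuallyEq (hlc.continuousAt.mono_left nhdsWithin_le_nhds)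
    (hrc.continuousAt.mono_left nhdsWithin_le_nhds) hgen
  simpa using this
end

/-! ### Restoring the square roots. -/

section
set_option linter.unusedSimpArgs false

section Gauge

/-- Gauge factor of a vertical bond. -/
noncomputable def gaugeTop (sq : ℂ → ℂ) (ρ α : ℂ) (k : ℕ) : ℂ :=
  ∏ j ∈ Finset.range k, (sq (1 - α ^ 2 * ρ ^ j) * sq (1 - ρ ^ (j + 1)))

/-- Gauge factor of a horizontal bond, up to a constant. -/
noncomputable def gaugeLeft (sq : ℂ → ℂ) (M : ℕ) (ρ β : ℂ) (k : ℕ) : ℂ :=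
  (∏ j ∈ Finset.range k, sq (1 - β ^ 2 * ρ ^ j)) * ∏ j ∈ Finset.Ico k M, sq (1 - ρ ^ (j + 1))

theorem weightDA_eq_zero {N : ℕ} {sq : ℂ → ℂ} {ρ α β w : ℂ} {t r l b : ℕ} (h : t + r ≠ l + b) :
    weightDA N sq ρ α β w (t + 1) (r + 1) (l + 1) (b + 1) = 0 := by
  by_contra h0
  apply h
  unfold weightDA at h0
  split at h0
  · unfold weightDA2 at h0; split at h0 <;> first | exact absurd rfl h0 | omega
  · unfold weightDA3 at h0; split at h0 <;> first | exact absurd rfl h0 | omega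
  · unfold weightDA4 at h0
    split at h0
    · unfold weightDA4Top1 at h0; split at h0 <;> first | exact absurd rfl h0 | omega
    · unfold weightDA4Top2 at h0; split at h0 <;> first | exact absurd rfl h0 | omega
    · unfold weightDA4Top3 at h0; split at h0 <;> first | exact absurd rfl h0 | omega
    · unfold weightDA4Top4 at h0; split at h0 <;> first | exact absurd rfl h0 | omega
    · exact absurd rfl h0
  · exact absurd rfl h0

variable {sq : ℂ → ℂ} {ρ : ℂ}

theorem raiseFactor_eq_prod_sq (hsq : ∀ z, sq z ^ 2 = z) (ρ a : ℂ) (m n : ℕ) :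
    raiseFactor ρ a m n = ∏ j ∈ Finset.range (n - m), sq (1 - a ^ 2 * ρ ^ (m + j)) ^ 2 := by
  simp only [raiseFactor, hsq, mul_comm]

/-- The relation is multiplied out so that no root of 1 - ρ ^ k α ^ 2 or 1 - ρ ^ k β ^ 2 is
inverted. For the same reason `gaugeLeft` carries the complementary product of the roots of 1 - ρ ^
k in place of an inverse. -/
theorem weightDA2_gauge (hsq : ∀ z, sq z ^ 2 = z) (α β x : ℂ) {t r l b : ℕ}
    (ht : t < 2) (hr : r < 2) (hl : l < 2) (hb : b < 2) (h : t + r = l + b) :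
    weightDA2 sq α β x (t + 1) (r + 1) (l + 1) (b + 1) *
        (gaugeTop sq ρ α t * gaugeLeft sq 1 ρ β l) =
      mixedWeight 2 ρ α β x t r l b * (gaugeTop sq ρ α b * gaugeLeft sq 1 ρ β r) := by
  obtain rfl : b = t + r - l := by omega
  interval_cases t <;> interval_cases r <;> interval_cases l <;> try omega
  all_goals
    simp only [weightDA2, mixedWeight, coreWeight,
      coreWeight2, gaugeTop, gaugeLeft,
      raiseFactor_eq_prod_sq hsq, Finset.prod_range_succ, Finset.prod_range_zero,
      Finset.prod_Ico_succ_top, Finset.Ico_self, Finset.prod_empty, Nat.reduceSub, Nat.reduceAdd,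
      one_mul, mul_one, pow_zero, pow_one, zero_add, add_zero, Nat.reduceLeDiff, Nat.zero_le,
        le_refl]
    try ring

theorem weightDA3_gauge (hsq : ∀ z, sq z ^ 2 = z) (h1 : 1 - ρ ≠ 0) (α β x : ℂ) {t r l b : ℕ}
    (ht : t < 3) (hr : r < 3) (hl : l < 3) (hb : b < 3) (h : t + r = l + b) :
    weightDA3 sq ρ α β x (t + 1) (r + 1) (l + 1) (b + 1) *
        (gaugeTop sq ρ α t * gaugeLeft sq 2 ρ β l) =
      mixedWeight 3 ρ α β x t r l b * (gaugeTop sq ρ α b * gaugeLeft sq 2 ρ β r) := by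
  have h0 : sq (1 - ρ) ≠ 0 := fun h0 => h1 (by rw [← hsq (1 - ρ), h0]; ring)
  -- The quotient of the two roots is a square root of 1 + ρ. Expressing everything through it
  -- leaves an identity free of division.
  obtain ⟨p₂, hp₂⟩ : ∃ p, sq (1 - ρ ^ 2) = sq (1 - ρ) * p := ⟨_, (mul_div_cancel₀ _ h0).symm⟩
  have hd₂ : sq (1 - ρ ^ 2) / sq (1 - ρ) = p₂ := by rw [hp₂, mul_div_cancel_left₀ _ h0]
  have hq₂ : 1 + ρ = p₂ ^ 2 := by
    rw [← hd₂, div_pow, hsq, hsq]; field_simp; ring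
  obtain rfl : b = t + r - l := by omega
  interval_cases t <;> interval_cases r <;> interval_cases l <;> try omega
  all_goals
    simp only [weightDA3, mixedWeight, coreWeight,
      coreWeight3, gaugeTop, gaugeLeft,
      raiseFactor_eq_prod_sq hsq, Finset.prod_range_succ, Finset.prod_range_zero,
      Finset.prod_Ico_succ_top, Finset.Ico_self, Finset.prod_empty, Nat.reduceSub, Nat.reduceAdd,
      one_mul, mul_one, pow_zero, pow_one, zero_add, add_zero, Nat.reduceLeDiff, Nat.zero_le,
        le_refl]
    try simp only [hd₂, hq₂]
    try rw [hp₂]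
    try ring

set_option maxHeartbeats 1000000 in
theorem weightDA4_gauge (hsq : ∀ z, sq z ^ 2 = z) (h1 : 1 - ρ ≠ 0) (α β x : ℂ) {t r l b : ℕ}
    (ht : t < 4) (hr : r < 4) (hl : l < 4) (hb : b < 4) (h : t + r = l + b) :
    weightDA4 sq ρ α β x (t + 1) (r + 1) (l + 1) (b + 1) *
        (gaugeTop sq ρ α t * gaugeLeft sq 3 ρ β l) =
      mixedWeight 4 ρ α β x t r l b * (gaugeTop sq ρ α b * gaugeLeft sq 3 ρ β r) := by
  have h0 : sq (1 - ρ) ≠ 0 := fun h0 => h1 (by rw [← hsq (1 - ρ), h0]; ring)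
  obtain ⟨p₂, hp₂⟩ : ∃ p, sq (1 - ρ ^ 2) = sq (1 - ρ) * p := ⟨_, (mul_div_cancel₀ _ h0).symm⟩
  have hd₂ : sq (1 - ρ ^ 2) / sq (1 - ρ) = p₂ := by rw [hp₂, mul_div_cancel_left₀ _ h0]
  have hq₂ : 1 + ρ = p₂ ^ 2 := by
    rw [← hd₂, div_pow, hsq, hsq]; field_simp; ring
  obtain ⟨p₃, hp₃⟩ : ∃ p, sq (1 - ρ ^ 3) = sq (1 - ρ) * p := ⟨_, (mul_div_cancel₀ _ h0).symm⟩
  have hd₃ : sq (1 - ρ ^ 3) / sq (1 - ρ) = p₃ := by rw [hp₃, mul_div_cancel_left₀ _ h0]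
  have hq₃ : (1 - ρ ^ 3) / (1 - ρ) = p₃ ^ 2 := by rw [← hd₃, div_pow, hsq, hsq]
  have hq₃' : 1 + ρ + ρ ^ 2 = p₃ ^ 2 := by rw [← hq₃]; field_simp; ring
  have hd₂₃ : sq (1 - ρ ^ 2) * sq (1 - ρ ^ 3) / (1 - ρ) = p₂ * p₃ := by
    rw [← hd₂, ← hd₃, div_mul_div_comm, ← pow_two, hsq]
  obtain rfl : b = t + r - l := by omega
  interval_cases t <;> interval_cases r <;> interval_cases l <;> try omega
  all_goals
    simp only [weightDA4, weightDA4Top1, weightDA4Top2, weightDA4Top3,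
      weightDA4Top4, mixedWeight, coreWeight,
      coreWeight4, coreWeight4Top0, coreWeight4Top1,
      coreWeight4Top2, coreWeight4Top3, gaugeTop, gaugeLeft,
      raiseFactor_eq_prod_sq hsq, Finset.prod_range_succ, Finset.prod_range_zero,
      Finset.prod_Ico_succ_top, Finset.Ico_self, Finset.prod_empty, Nat.reduceSub, Nat.reduceAdd,
      one_mul, mul_one, pow_zero, pow_one, zero_add, add_zero, Nat.reduceLeDiff, Nat.zero_le,
        le_refl]
    try simp only [hd₂, hd₃, hd₂₃, hq₃]
    try simp only [hq₃']
    try simp only [hp₂, hp₃, hq₂]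
    try ring

end Gauge
end

/-! ### Sums over configurations as matrix products. -/

section

section Paths
variable {R : Type*} [CommRing R]

theorem prod_ofFn_apply {ι : Type*} [Fintype ι] [DecidableEq ι] {n : ℕ} (A : Fin n → Matrix ι ι R)
    (a b : ι) : (List.ofFn A).prod a b =
      ∑ f : Fin (n + 1) → ι, if f 0 = a ∧ f (Fin.last n) = b then
        ∏ i, A i (f i.castSucc) (f i.succ) else 0 := by
  induction n generalizing a with
  | zero =>
    rw [← (Equiv.funUnique (Fin 1) ι).symm.sum_comp]
    simp [Matrix.one_apply, ite_and]
  | succ n ih =>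
    rw [List.ofFn_succ, List.prod_cons, Matrix.mul_apply, ← (Fin.consEquiv fun _ => ι).sum_comp,
      Fintype.sum_prod_type]
    simp only [Fin.consEquiv, Equiv.coe_fn_mk, Fin.cons_zero, ite_and, Finset.sum_ite_irrel,
      Finset.sum_const_zero, Finset.sum_ite_eq', Finset.mem_univ, if_true]
    simp only [ih, Finset.mul_sum]
    rw [Finset.sum_comm]
    refine Finset.sum_congr rfl fun f _ => ?_
    simp only [ite_and, mul_ite, mul_zero, Finset.sum_ite_eq, Finset.mem_univ, if_true]
    rw [← Fin.succ_last, Fin.cons_succ, Fin.prod_univ_succ]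
    simp only [Fin.castSucc_zero, Fin.cons_zero, Fin.cons_succ, ← Fin.succ_castSucc]

variable {M : ℕ}

-- Expanding the outer product gives a sum over the horizontal bond states, and expanding each
-- column gives the vertical ones. The boundary indices of the matrix products are the domain wall
-- conditions.
open Classical in
theorem partition_eq_wallOf {L : ℕ}
    (w : Fin L → Fin L → Fin (M + 1) → Fin (M + 1) → Fin (M + 1) → Fin (M + 1) → R) :
    ∑ c : BondConfig (M + 1) L with IsDomainWall c, ∏ i, ∏ j,
      w i j (c.1 i j.castSucc) (c.2 j i.succ) (c.2 j i.castSucc) (c.1 i j.succ) = wallOf w := by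
  -- A path of row vectors lists horizontal states by position first, a configuration by line first;
  -- `Equiv.piComm` transposes the two.
  rw [wallOf, prod_ofFn_apply, Finset.sum_filter, Fintype.sum_prod_type_right,
    ← (Equiv.piComm fun (_ : Fin L) (_ : Fin (L + 1)) => Fin (M + 1)).sum_comp]
  refine Finset.sum_congr rfl fun h _ => ?_
  simp only [columnOf, Matrix.of_apply, prod_ofFn_apply]
  simp only [Finset.prod_univ_sum, Fintype.piFinset_univ, Finset.prod_ite_zero]
  split_ifs with hP
  · refine Finset.sum_congr rfl fun V _ => ?_
    have hiff : IsDomainWall (V, h) ↔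
        ∀ i ∈ Finset.univ, V i 0 = 0 ∧ V i (Fin.last L) = Fin.last M := by
      obtain ⟨h₁, h₂⟩ := hP
      refine ⟨fun hV i _ => ⟨Fin.ext (by simpa using hV.1 i), Fin.ext (by simpa using hV.2.1 i)⟩,
        fun hV => ⟨fun i => ?_, fun i => ?_, fun j => ?_, fun j => ?_⟩⟩
      · show (V i 0 : ℕ) + 1 = 1
        rw [(hV i (Finset.mem_univ _)).1]; rfl
      · show (V i (Fin.last L) : ℕ) + 1 = M + 1
        rw [(hV i (Finset.mem_univ _)).2]; rfl
      · have := congrFun h₁ j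
        simp only [Equiv.piComm_apply, Function.swap] at this
        show (h j 0 : ℕ) + 1 = 1
        rw [this]; rfl
      · have := congrFun h₂ j
        simp only [Equiv.piComm_apply, Function.swap] at this
        show (h j (Fin.last L) : ℕ) + 1 = M + 1
        rw [this]; rfl
    by_cases hV : IsDomainWall (V, h)
    · rw [if_pos (hiff.1 hV)]
      exact if_pos hV
    · rw [if_neg (mt hiff.2 hV)]
      exact if_neg hV
  · refine Finset.sum_eq_zero fun V _ => if_neg fun hV => hP ?_
    simp only [IsDomainWall, Equiv.piComm_apply, Function.swap, funext_iff] at hV ⊢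
    exact ⟨fun j => Fin.ext (by simpa using hV.2.2.1 j),
      fun j => Fin.ext (by simpa using hV.2.2.2 j)⟩

end Paths
end

/-! ### Assembly. -/

section

theorem weightDA_gauge {M : ℕ} (hN : M + 1 = 2 ∨ M + 1 = 3 ∨ M + 1 = 4) {sq : ℂ → ℂ} {ρ : ℂ}
    (hsq : ∀ z, sq z ^ 2 = z) (h1 : 1 - ρ ≠ 0) (α β w : ℂ) (t r l b : Fin (M + 1)) :
    weightDA (M + 1) sq ρ α β w (t + 1) (r + 1) (l + 1) (b + 1) *
        (gaugeTop sq ρ α t * gaugeLeft sq M ρ β l) =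
      mixedWeight (M + 1) ρ α β (Complex.exp w) t r l b *
        (gaugeTop sq ρ α b * gaugeLeft sq M ρ β r) := by
  by_cases h : (t : ℕ) + r = l + b
  · rcases hN with hN | hN | hN
    · obtain rfl : M = 1 := by omega
      exact weightDA2_gauge hsq α β _ t.2 r.2 l.2 b.2 h
    · obtain rfl : M = 2 := by omega
      exact weightDA3_gauge hsq h1 α β _ t.2 r.2 l.2 b.2 h
    · obtain rfl : M = 3 := by omega
      exact weightDA4_gauge hsq h1 α β _ t.2 r.2 l.2 b.2 h
  · rw [weightDA_eq_zero h, mixedWeight, not_not.1 (mt coreWeight_ne_zero fun h' => h h'.1)]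
    simp

theorem partitionDA_eq {M L : ℕ} (hN : M + 1 = 2 ∨ M + 1 = 3 ∨ M + 1 = 4) {sq : ℂ → ℂ} {ρ : ℂ}
    (hsq : ∀ z, sq z ^ 2 = z) (hρ : IsPrimitiveRoot ρ (M + 1)) (α β u v : Fin L → ℂ) :
    partitionDA (M + 1) L sq ρ α β u v =
      wallOf (M := M) (fun i j t r l b =>
        mixedWeight (M + 1) ρ (α i) (β j) (Complex.exp (u i) / Complex.exp (v j)) t r l b) *
      ∏ j, ∏ k ∈ Finset.range M, (sq (1 - α j ^ 2 * ρ ^ k) * sq (1 - β j ^ 2 * ρ ^ k)) := by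
  have hr : ∀ k < M, sq (1 - ρ ^ (k + 1)) ≠ 0 := fun k hk h0 => by
    have := hsq (1 - ρ ^ (k + 1))
    rw [h0] at this
    exact hρ.pow_ne_one_of_pos_of_lt (by omega) (by omega : k + 1 < M + 1)
      (by linear_combination this)
  have h1 : 1 - ρ ≠ 0 := sub_ne_zero.2 (hρ.ne_one (by omega)).symm
  have hg := wallOf_gauge (M := M)
    (w := fun i j t r l b => weightDA (M + 1) sq ρ (α i) (β j) (u i - v j)
      (t + 1) (r + 1) (l + 1) (b + 1))
    (w' := fun i j t r l b => mixedWeight (M + 1) ρ (α i) (β j) (Complex.exp (u i - v j)) t r l b)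
    (P := fun i k => gaugeTop sq ρ (α i) k) (Q := fun j k => gaugeLeft sq M ρ (β j) k)
    fun i j t r l b => weightDA_gauge hN hsq h1 (α i) (β j) (u i - v j) t r l b
  rw [← partition_eq_wallOf] at hg
  -- These roots enter through `gaugeLeft` at state 0 on one side and through `gaugeTop` at state M
  -- on the other. They cancel because ρ is primitive of order M + 1.
  have hne : ∏ _j : Fin L, ∏ k ∈ Finset.range M, sq (1 - ρ ^ (k + 1)) ≠ 0 :=
    Finset.prod_ne_zero_iff.2 fun j _ => Finset.prod_ne_zero_iff.2 fun k hk =>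
      hr k (Finset.mem_range.1 hk)
  refine mul_right_cancel₀ hne ?_
  simp only [← Complex.exp_sub]
  simp only [gaugeTop, gaugeLeft, Fin.val_zero, Fin.val_last, Finset.range_zero, Finset.prod_empty,
    Finset.prod_const_one, one_mul, Finset.Ico_self, mul_one, Finset.prod_mul_distrib,
    Nat.Ico_zero_eq_range] at hg ⊢
  rw [partitionDA]
  refine hg.trans ?_
  ring

theorem exp_isPrimitiveRoot {N : ℕ} (hN : N ≠ 0) {n : ℤ} (hn : IsCoprime n (N : ℤ)) :
    IsPrimitiveRoot (Complex.exp (2 * Real.pi * Complex.I * n / N)) N := by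
  have h := (Complex.isPrimitiveRoot_exp N hN).zpow_of_gcd_eq_one n
    (Int.isCoprime_iff_gcd_eq_one.1 hn)
  rwa [← Complex.exp_int_mul, show (n : ℂ) * (2 * Real.pi * Complex.I / N) =
    2 * Real.pi * Complex.I * n / N by ring] at h

theorem prod_Icc_one_sub_one {R : Type*} [CommMonoid R] (M : ℕ) (f : ℕ → R) :
    ∏ k ∈ Finset.Icc 1 M, f (k - 1) = ∏ k ∈ Finset.range M, f k := by
  rw [← Finset.Ico_add_one_right_eq_Icc, Finset.prod_Ico_eq_prod_range]
  simp

theorem lemma2 (N : ℕ) (hN : N = 2 ∨ N = 3 ∨ N = 4)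
    (n : ℤ) (hn : IsCoprime n (N : ℤ))
    (ρ : ℂ) (hρ : ρ = Complex.exp (2 * Real.pi * Complex.I * n / N))
    (sq : ℂ → ℂ) (hsq : ∀ z, sq z ^ 2 = z)
    (L : ℕ) (α β u v : Fin L → ℂ) :
    partitionDA N L sq ρ α β u v =
      (∏ j : Fin L,
        (Complex.exp (((N : ℂ) - 1) * ((j : ℕ) + 1) * (u j - v j)) *
          ∏ k ∈ Finset.Icc 1 (N - 1),
            (sq (1 - ρ ^ (k - 1) * α j ^ 2) * sq (1 - ρ ^ (k - 1) * β j ^ 2)))) *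
      ∏ i : Fin L, ∏ j ∈ Finset.Ioi i, ∏ k ∈ Finset.Icc 1 (N - 1),
        ((1 - ρ ^ (k - 1) * α i * α j * Complex.exp (u i - u j)) *
          (1 - ρ ^ (k - 1) * β j * β i * Complex.exp (v j - v i))) := by

  obtain ⟨M, rfl⟩ : ∃ M, N = M + 1 := ⟨N - 1, by omega⟩
  have hprim : IsPrimitiveRoot ρ (M + 1) := hρ ▸ exp_isPrimitiveRoot (by omega) hn
  rw [partitionDA_eq hN hsq hprim, wallOf_mixedWeight hN hprim α β (fun i => Complex.exp (u i))
    (fun j => Complex.exp (v j)) (fun _ => Complex.exp_ne_zero _) fun _ => Complex.exp_ne_zero _]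
  have e₁ : ∀ j : Fin L, ∏ k ∈ Finset.Icc 1 (M + 1 - 1),
      (sq (1 - ρ ^ (k - 1) * α j ^ 2) * sq (1 - ρ ^ (k - 1) * β j ^ 2)) =
      ∏ k ∈ Finset.range M, (sq (1 - α j ^ 2 * ρ ^ k) * sq (1 - β j ^ 2 * ρ ^ k)) := fun j => by
    simp only [mul_comm (_ ^ 2) (ρ ^ _)]
    exact prod_Icc_one_sub_one M fun k => sq (1 - ρ ^ k * α j ^ 2) * sq (1 - ρ ^ k * β j ^ 2)
  have e₂ : ∀ i j : Fin L, ∏ k ∈ Finset.Icc 1 (M + 1 - 1),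
      ((1 - ρ ^ (k - 1) * α i * α j * Complex.exp (u i - u j)) *
        (1 - ρ ^ (k - 1) * β j * β i * Complex.exp (v j - v i))) =
      ∏ k ∈ Finset.range M, ((1 - ρ ^ k * α i * α j * (Complex.exp (u i) / Complex.exp (u j))) *
        (1 - ρ ^ k * β j * β i * (Complex.exp (v j) / Complex.exp (v i)))) := fun i j => by
    simp only [← Complex.exp_sub]
    exact prod_Icc_one_sub_one M fun k => (1 - ρ ^ k * α i * α j * Complex.exp (u i - u j)) *
        (1 - ρ ^ k * β j * β i * Complex.exp (v j - v i))
  have e₃ : ∀ j : Fin L, Complex.exp ((((M + 1 : ℕ) : ℂ) - 1) * ((j : ℕ) + 1) * (u j - v j)) =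
      (Complex.exp (u j) / Complex.exp (v j)) ^ (M * ((j : ℕ) + 1)) := fun j => by
    rw [← Complex.exp_sub, ← Complex.exp_nat_mul]
    push_cast
    ring_nf
  simp only [e₁, e₂, e₃]
  rw [Finset.prod_mul_distrib]
  ring
end
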